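/- Let $\mathscr{M}=(\underline{M},\otimes,\mathbb 1)$ be a symmetric monoidal closed model category (complete and cocomplete, satisfying the pushout-product and unit axioms) which is cofibrantly generated, with set $\mathbf I$ of generating cofibrations and set $\mathbf J$ of generating trivial cofibrations, and in which every object is cofibrant. Let $X$ be a (small) set. For $A,B\in X$ let $\mathcal S_{\overline X}(A,B)$ be the category whose objects are the chains $(A=E_0,E_1,\dots,E_n=B)$ of elements of $X$ with $n\ge 1$, and whose morphisms $t\to s$ are the ways of deleting intermediate letters of $t$ so as to obtain $s$ (endpoints being kept). Concatenation of chains at a common endpoint makes these categories into a strict semi-$2$-category $\mathcal S_{\overline X}$ (no identity $1$-morphisms). A *pre-Co-Segal category* with object set $X$ is a lax functor $F:(\mathcal S_{\overline X})^{2\text{-op}}\to\mathscr M$, i.e. functors $F_{AB}:\mathcal S_{\overline X}(A,B)^{op}\to\mathscr M$ with natural associative laxity maps $F(t)\otimes F(s)\to F(t\otimes s)$, where $t\otimes s$ denotes the concatenation of composable chains $t,s$ (no unit data); morphisms are families of natural transformations $F_{AB}\to G_{AB}$ compatible with the laxity maps. Let $\mathscr M_{\mathcal S}(X)$ be the resulting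 category, let $\mathcal K_X=\prod_{(A,B)\in X^2}\mathrm{Hom}[\mathcal S_{\overline X}(A,B)^{op},\mathscr M]$, and let $\mathcal U:\mathscr M_{\mathcal S}(X)\to\mathcal K_X$ be the functor forgetting the laxity maps. In the projective model structure on $\mathcal K_X$ the weak equivalences and the fibrations are the levelwise ones, and the generating sets are $\mathbf I_{\mathcal K}=\{\mathbf F^t_\alpha\}_{t,\ \alpha\in \mathbf I}$ and $\mathbf J_{\mathcal K}=\{\mathbf F^t_\alpha\}_{t,\ \alpha\in\mathbf J}$, where $t$ runs over all chains and $\mathbf F^t:\mathscr M\to\mathcal K_X$ is the left adjoint of evaluation at $t$. Then $\mathscr M_{\mathcal S}(X)$ is complete and cocomplete, $\mathcal U$ has a left adjoint $\Gamma$, the adjunction $\Gamma\dashv\mathcal U$ is monadic, and $\mathscr M_{\mathcal S}(X)$ has a (projective) model structure in which - a map $\sigma$ is a weak equivalence if and only if $\mathcal U(\sigma)$ is a levelwise weak equivalence; - a map $\sigma$ is a fibration if and only if $\mathcal U(\sigma)$ is a levelwise fibration; - the cofibrations are the maps having the left lifting property with respect to all trivial fibrations. This model structure is cofibrantly generated,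 with $\Gamma(\mathbf I_{\mathcal K})$ as set of generating cofibrations and $\Gamma(\mathbf J_{\mathcal K})$ as set of generating trivial cofibrations. If moreover $\underline M$ is locally presentable (so that $\mathscr M$ is combinatorial), then $\mathscr M_{\mathcal S}(X)$ is locally presentable, so that this model structure is combinatorial. -/

import Mathlib

open CategoryTheory Limits MonoidalCategory HomotopicalAlgebra Opposite

universe w v u

namespace CoSegal

/-! ### The strict semi-2-category of chains on a set -/

/-- `Del l l'` is the type of ways of deleting letters from the word `l` so as to obtain the
word `l'`: reading `l` from left to right, each letter is either kept or dropped.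
Equivalently, an element is a strictly increasing map from the positions of `l'` to the positions
of `l` that respects the letters. -/
inductive Del {X : Type w} : List X → List X → Type w
  | nil : Del [] []
  | keep (a : X) {l l' : List X} (d : Del l l') : Del (a :: l) (a :: l')
  | drop (a : X) {l l' : List X} (d : Del l l') : Del (a :: l) l'

namespace Del

variable {X : Type w}

/-- Deleting nothing. -/
def id : (l : List X) → Del l l
  | [] => nil
  | a :: l => keep a (id l)

/-- Successive deletions. -/
def comp : {l l' l'' : List X} → Del l l' → Del l' l'' → Del l l''
  | _, _, _, nil, e => e
  | _, _, _, keep a d, keep _ e => keep a (comp d e)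
  | _, _, _, keep a d, drop _ e => drop a (comp d e)
  | _, _, _, drop a d, e => drop a (comp d e)

/-- Deletions side by side. -/
def append : {l l' m m' : List X} → Del l l' → Del m m' → Del (l ++ m) (l' ++ m')
  | _, _, _, _, nil, e => e
  | _, _, _, _, keep a d, e => keep a (append d e)
  | _, _, _, _, drop a d, e => drop a (append d e)

theorem id_comp : {l l' : List X} → (d : Del l l') → comp (id l) d = d
  | _, _, nil => rfl
  | _, _, keep a d => by simp only [id, comp, id_comp d]
  | _, _, drop a d => by simp only [id, comp, id_comp d]

theorem comp_id : {l l' : List X} → (d : Del l l') → comp d (id l') = d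
  | _, _, nil => rfl
  | _, _, keep a d => by simp only [id, comp, comp_id d]
  | _, _, drop a d => by simp only [comp, comp_id d]

theorem comp_assoc : {l l' l'' l''' : List X} → (d : Del l l') → (e : Del l' l'') →
    (f : Del l'' l''') → comp (comp d e) f = comp d (comp e f)
  | _, _, _, _, nil, _, _ => rfl
  | _, _, _, _, drop a d, e, f => by simp only [comp, comp_assoc d e f]
  | _, _, _, _, keep a d, drop _ e, f => by simp only [comp, comp_assoc d e f]
  | _, _, _, _, keep a d, keep _ e, keep _ f => by simp only [comp, comp_assoc d e f]
  | _, _, _, _, keep a d, keep _ e, drop _ f => by simp only [comp, comp_assoc d e f]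

theorem append_id : (l m : List X) → append (id l) (id m) = id (l ++ m)
  | [], _ => rfl
  | a :: l, m => by simp only [id, append, append_id l m, List.cons_append]

theorem append_comp : {l l' l'' m m' m'' : List X} → (d : Del l l') → (e : Del l' l'') →
    (f : Del m m') → (g : Del m' m'') →
    append (comp d e) (comp f g) = comp (append d f) (append e g)
  | _, _, _, _, _, _, nil, nil, _, _ => rfl
  | _, _, _, _, _, _, drop a d, e, f, g => by simp only [comp, append, append_comp d e f g]
  | _, _, _, _, _, _, keep a d, keep _ e, f, g => by simp only [comp, append, append_comp d e f g]
  | _, _, _, _, _, _, keep a d, drop _ e, f, g => by simp only [comp, append, append_comp d e f g]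

end Del

/-- The objects of the category of 1-morphisms from `A` to `B`: chains `(A, E₁, …, Eₖ, B)` of
elements of `X`, with `k ≥ 0`. The field `mid` is the word `E₁ … Eₖ`; the chain has length
(degree) `k + 1 ≥ 1`. -/
@[ext]
structure Chain (X : Type w) (A B : X) : Type w where
  mid : List X

namespace Chain

variable {X : Type w}

/-- A morphism `t ⟶ s` deletes intermediate letters of `t` to get `s`, keeping the
endpoints `A` and `B` fixed. In terms of lengths these are the surjective nondecreasing maps
`{0, …, n-1} → {0, …, m-1}`, where `n` and `m` are the lengths of `t` and `s`, under which each
letter of `s` is the corresponding letter of `t`. -/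
instance (A B : X) : Category.{w} (Chain X A B) where
  Hom t s := Del t.mid s.mid
  id t := Del.id t.mid
  comp d e := Del.comp d e
  id_comp := Del.id_comp
  comp_id := Del.comp_id
  assoc := Del.comp_assoc

variable {A B C D : X}

/-- Composition of 1-morphisms: concatenation of a chain from `A` to `B` and a chain from `B` to
`C`, the common letter `B` being written once. -/
def concat (t : Chain X A B) (s : Chain X B C) : Chain X A C := ⟨t.mid ++ B :: s.mid⟩

/-- Horizontal composition of 2-morphisms. -/
def concatMap {t t' : Chain X A B} {s s' : Chain X B C} (d : t ⟶ t') (e : s ⟶ s') :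
    concat t s ⟶ concat t' s' :=
  Del.append d (Del.keep B e)

theorem concatMap_id (t : Chain X A B) (s : Chain X B C) :
    concatMap (𝟙 t) (𝟙 s) = 𝟙 (concat t s) :=
  Del.append_id t.mid (B :: s.mid)

theorem concatMap_comp {t t' t'' : Chain X A B} {s s' s'' : Chain X B C}
    (d : t ⟶ t') (d' : t' ⟶ t'') (e : s ⟶ s') (e' : s' ⟶ s'') :
    concatMap (d ≫ d') (e ≫ e') = concatMap d e ≫ concatMap d' e' :=
  Del.append_comp d d' (Del.keep B e) (Del.keep B e')

theorem concat_assoc (t : Chain X A B) (s : Chain X B C) (r : Chain X C D) :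
    concat (concat t s) r = concat t (concat s r) := by
  simp [concat]

end Chain

/-! ### Pre-Co-Segal categories -/

section

variable (M : Type u) [Category.{v} M] [MonoidalCategory M] (X : Type w)

/-- A pre-Co-Segal category with set of objects `X`: a lax functor (without unit data) from
the 2-opposite of the semi-2-category of chains on `X` to the monoidal category `M`. -/
structure PreCoSegal where
  /-- The components on the categories of 1-morphisms. -/
  F (A B : X) : (Chain X A B)ᵒᵖ ⥤ M
  /-- The laxity maps. -/
  lax {A B C : X} (t : Chain X A B) (s : Chain X B C) :
    (F A B).obj (op t) ⊗ (F B C).obj (op s) ⟶ (F A C).obj (op (t.concat s))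
  /-- Naturality of the laxity maps. -/
  lax_natural {A B C : X} {t t' : Chain X A B} {s s' : Chain X B C} (d : t ⟶ t') (e : s ⟶ s') :
    ((F A B).map d.op ⊗ₘ (F B C).map e.op) ≫ lax t s =
      lax t' s' ≫ (F A C).map (Chain.concatMap d e).op
  /-- Associativity of the laxity maps. -/
  lax_assoc {A B C D : X} (t : Chain X A B) (s : Chain X B C) (r : Chain X C D) :
    (lax t s ▷ (F C D).obj (op r)) ≫ lax (t.concat s) r ≫
        (F A D).map (eqToHom (congrArg op (Chain.concat_assoc t s r))) =
      (α_ _ _ _).hom ≫ ((F A B).obj (op t) ◁ lax s r) ≫ lax t (s.concat r)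

variable {M X}

namespace PreCoSegal

/-- A morphism is a simple transformation (icon): natural transformations of the components that
are compatible with the laxity maps. -/
@[ext]
structure Hom (F G : PreCoSegal M X) where
  app (A B : X) : F.F A B ⟶ G.F A B
  lax_comm {A B C : X} (t : Chain X A B) (s : Chain X B C) :
    F.lax t s ≫ (app A C).app (op (t.concat s)) =
      ((app A B).app (op t) ⊗ₘ (app B C).app (op s)) ≫ G.lax t s

instance : Category (PreCoSegal M X) where
  Hom := Hom
  id F := { app := fun _ _ => 𝟙 _, lax_comm := by simp }
  comp σ τ :=
    { app := fun A B => σ.app A B ≫ τ.app A B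
      lax_comm := fun t s => by
        simp only [NatTrans.comp_app, ← MonoidalCategory.tensorHom_comp_tensorHom,
          Category.assoc, ← τ.lax_comm]
        rw [← Category.assoc, ← Category.assoc, σ.lax_comm] }
  id_comp _ := Hom.ext (by funext; exact Category.id_comp _)
  comp_id _ := Hom.ext (by funext; exact Category.comp_id _)
  assoc _ _ _ := Hom.ext (by funext; exact Category.assoc _ _ _)

end PreCoSegal

end

section

variable (M : Type u) [Category.{v} M] (X : Type w)

/-- The category `∏_{(A, B)} Hom(S(A, B)ᵒᵖ, M)`. -/
abbrev KX : Type _ := ∀ p : X × X, (Chain X p.1 p.2)ᵒᵖ ⥤ M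

/-- The forgetful functor from pre-Co-Segal categories, which forgets the laxity maps. -/
def forgetLax [MonoidalCategory M] : PreCoSegal M X ⥤ KX M X where
  obj F := fun p => F.F p.1 p.2
  map σ := fun p => PreCoSegal.Hom.app σ p.1 p.2

/-- The weak equivalences of the projective model structure on `KX M X`
(product of the projective model structures): the levelwise weak equivalences. -/
def projWeakEquivalences [CategoryWithWeakEquivalences M] : MorphismProperty (KX M X) :=
  fun _ _ f => ∀ (p : X × X) (t : (Chain X p.1 p.2)ᵒᵖ), WeakEquivalence ((f p).app t)

/-- The fibrations of the projective model structure on `KX M X`: the levelwise fibrations. -/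
def projFibrations [CategoryWithFibrations M] : MorphismProperty (KX M X) :=
  fun _ _ f => ∀ (p : X × X) (t : (Chain X p.1 p.2)ᵒᵖ), Fibration ((f p).app t)

end

/-! ### The generators of the projective model structure on `KX M X` -/

section

variable {M : Type u} [Category.{v} M] {X : Type v}

/-- The type of morphisms between two chains whose endpoints are not assumed to be the same; it is
empty if the endpoints differ, and is the type of morphisms `v ⟶ t` of `Chain X A B` if they
agree. -/
def HHom {A' B' A B : X} (v : Chain X A' B') (t : Chain X A B) : Type v :=
  { _d : Del v.mid t.mid // A' = A ∧ B' = B }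

/-- Precomposition of `HHom` with a morphism. -/
def HHom.precomp {A' B' A B : X} {v v' : Chain X A' B'} {t : Chain X A B} (e : v' ⟶ v)
    (d : HHom v t) : HHom v' t :=
  ⟨Del.comp e d.1, d.2⟩

variable [HasColimitsOfSize.{v, v} M]

/-- The left adjoint `m ↦ F^t_m` of the evaluation functor `KX M X ⥤ M` at the chain `t`:
the value of `F^t_m` at a chain `v` is the coproduct of copies of `m` indexed by the morphisms
`v ⟶ t` (in particular it is initial when the endpoints of `v` and `t` differ). -/
noncomputable def freeAt {A B : X} (t : Chain X A B) : M ⥤ KX M X where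
  obj m := fun p =>
    { obj := fun v => ∐ fun _ : HHom v.unop t => m
      map := fun e => Limits.Sigma.desc fun d => Limits.Sigma.ι (fun _ => m) (d.precomp e.unop)
      map_id := fun v => by
        refine Sigma.hom_ext _ _ fun d => ?_
        rw [Sigma.ι_desc, Category.comp_id]
        congr 1
        exact Subtype.ext (Del.id_comp d.1)
      map_comp := fun e e' => by
        refine Sigma.hom_ext _ _ fun d => ?_
        rw [Sigma.ι_desc, Sigma.ι_desc_assoc, Sigma.ι_desc]
        congr 1
        exact Subtype.ext (Del.comp_assoc e'.unop e.unop d.1) }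
  map f := fun p =>
    { app := fun v => Limits.Sigma.desc fun d =>
          f ≫ Limits.Sigma.ι (fun _ : HHom v.unop t => _) d
      naturality := fun v v' e => by
        refine Sigma.hom_ext _ _ fun d => ?_
        rw [Sigma.ι_desc_assoc, Sigma.ι_desc_assoc, Sigma.ι_desc, Category.assoc, Sigma.ι_desc] }
  map_id m := by
    funext p
    ext v d
    simp
  map_comp f g := by
    funext p
    ext v d
    simp

/-- The set of maps `F^t_α` of `KX M X`, for `t` a chain and `α` in `I`. -/
inductive projGenerators (X : Type v) (I : MorphismProperty M) : MorphismProperty (KX M X)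
  | mk {A B : X} (t : Chain X A B) {m m' : M} (α : m ⟶ m') (hα : I α) :
      projGenerators X I ((freeAt t).map α)

end

/-! ### Model-categorical notions -/

section

variable {C : Type u} [Category.{v} C]

/-- The object `A` is small relative to `W`: for some regular cardinal `κ`, the functor
`Hom(A, -)` commutes with the colimits of all sequences, indexed by a `κ`-filtered well-ordered
set, of morphisms in `W`. -/
def IsSmallRelativeTo (A : C) (W : MorphismProperty C) : Prop :=
  ∃ (κ : Cardinal.{v}) (_ : Fact κ.IsRegular),
    ∀ (J : Type v) [LinearOrder J] [SuccOrder J] [OrderBot J] [WellFoundedLT J]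
      [IsCardinalFiltered J κ] (F : J ⥤ C) [F.IsWellOrderContinuous],
      (∀ j : J, ¬ IsMax j → W (F.map (homOfLE (Order.le_succ j)))) →
        PreservesColimit F (coyoneda.obj (op A))

/-- Relative `I`-cell complexes: transfinite compositions of pushouts of coproducts of morphisms
in `I`. -/
def cell (I : MorphismProperty C) : MorphismProperty C :=
  MorphismProperty.transfiniteCompositions.{v} (MorphismProperty.coproducts.{v} I).pushouts

/-- `I` and `J` are sets of generating cofibrations and of generating trivial
cofibrations of the model category `C`. -/
structure IsCofibrantlyGeneratedBy [ModelCategory C] (I J : MorphismProperty C) : Prop where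
  isSmall_left : MorphismProperty.IsSmall.{v} I
  isSmall_right : MorphismProperty.IsSmall.{v} J
  small_left {A B : C} (i : A ⟶ B) (hi : I i) : IsSmallRelativeTo A (cell I)
  small_right {A B : C} (j : A ⟶ B) (hj : J j) : IsSmallRelativeTo A (cell J)
  fibrations_eq : fibrations C = J.rlp
  trivialFibrations_eq : trivialFibrations C = I.rlp

variable (C) in
/-- The compatibility axioms of a monoidal model category: the pushout-product axiom and the unit
axiom. -/
class IsMonoidalModelCategory [ModelCategory C] [MonoidalCategory C] [HasPushouts C] : Prop where
  cofibration_pushoutProduct {A B K L : C} (f : A ⟶ B) (g : K ⟶ L)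
    [Cofibration f] [Cofibration g] :
    Cofibration ((Arrow.pushoutProduct.obj (Arrow.mk f)).obj (Arrow.mk g)).hom
  weakEquivalence_pushoutProduct {A B K L : C} (f : A ⟶ B) (g : K ⟶ L)
    [Cofibration f] [Cofibration g] (h : WeakEquivalence f ∨ WeakEquivalence g) :
    WeakEquivalence ((Arrow.pushoutProduct.obj (Arrow.mk f)).obj (Arrow.mk g)).hom
  weakEquivalence_unit {Q : C} (q : Q ⟶ 𝟙_ C) (A : C) [IsCofibrant Q] [WeakEquivalence q]
    [IsCofibrant A] : WeakEquivalence (q ▷ A)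

end

end CoSegal

namespace CoSegal

/-! ### Splitting and reassociating deletions -/

namespace Del

variable {X : Type w}

/-! The categorical statements are formal. Since `M` is closed symmetric, `⊗` preserves colimits in
each variable, hence sifted colimits in both at once, so reflexive coequalizers and filtered
colimits of pre-Co-Segal categories are levelwise. Explicit free objects give a left adjoint to
evaluation at all chains (`toFamily`). Crude monadicity and adjoint lifting then give `Γ`, limits
and colimits, and the left adjoints of the evaluations give a strong generator in the presentable
case.

The crux is that the saturated class generated by `Γ(J_K)` consists of levelwise weak equivalences.
No pushout of lax functors is analysed. Instead, `app_mem_llp` shows: if `R` is stable under base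
change, products and all `ihom K`, and `f : F ⟶ E` lifts against every map levelwise in `R`, then
each value `f_t` lies in `R.llp`. As every object is cofibrant, the pushout-product axiom lets `R`
be the fibrations (`J.rlp`) or the trivial fibrations (`I.rlp`).

The proof of `app_mem_llp` is coinduction of modules. A right module over `F` yields a map from `F`
to an endomorphism lax functor (`endo`). `E` acts on its unital free module `plus E`. A problem of
lifting `f_t` against `q` in `R` determines an `F`-module `coind`: its elements are an `x` of `plus
E` with chosen lifts of the images of all `x · f(y)`. The `F`-linear projection `coind ⟶ plus E` is
in `R`, and so is, levelwise, the map from the endomorphisms of this arrow to those of `plus E`.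
Lifting `f` against that map extends the action on `coind` from `F` to `E`. Letting `E` act on a
unit element that encodes the top of the problem, then evaluating, gives the diagonal. Modules are
indexed by words, not letters, to remember the chain that acted.

For smallness, values of cell complexes are only shown to lie in `I.rlp.llp`, so smallness is first
extended from `cell I` to that class (`IsSmallRelativeTo.llp_rlp`) and then moved along the
adjunction (`isSmallRelativeTo_leftAdjoint`). -/

theorem heq_keep {a : X} {l l' m m' : List X} {d : Del l l'} {e : Del m m'} (h : l = m)
    (h' : l' = m') (hd : d ≍ e) : keep a d ≍ keep a e := by
  subst h; subst h'; cases hd; rfl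

theorem heq_drop {a : X} {l l' m m' : List X} {d : Del l l'} {e : Del m m'} (h : l = m)
    (h' : l' = m') (hd : d ≍ e) : drop a d ≍ drop a e := by
  subst h; subst h'; cases hd; rfl

theorem append_assoc_heq (b c : X) : {l₁ l₂ l₃ m₁ m₂ m₃ : List X} → (d₁ : Del l₁ m₁) →
    (d₂ : Del l₂ m₂) → (d₃ : Del l₃ m₃) →
    append (append d₁ (keep b d₂)) (keep c d₃) ≍ append d₁ (keep b (append d₂ (keep c d₃)))
  | _, _, _, _, _, _, nil, _, _ => HEq.rfl
  | _, _, _, _, _, _, keep a d₁, d₂, d₃ =>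
    heq_keep (by simp) (by simp) (append_assoc_heq b c d₁ d₂ d₃)
  | _, _, _, _, _, _, drop a d₁, d₂, d₃ =>
    heq_drop (by simp) (by simp) (append_assoc_heq b c d₁ d₂ d₃)

/-- The letter `b` of the target is a kept letter of the source; cutting the source there cuts the
deletion in two. -/
theorem exists_split {l m : List X} (d : Del l m) (m₁ : List X) (b : X) (m₂ : List X)
    (h : m = m₁ ++ b :: m₂) :
    ∃ (l₁ l₂ : List X) (d₁ : Del l₁ m₁) (d₂ : Del l₂ m₂),
      l = l₁ ++ b :: l₂ ∧ d ≍ append d₁ (keep b d₂) := by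
  induction d generalizing m₁ with
  | nil => simp at h
  | @keep a l l' d ih =>
    cases m₁ with
    | nil =>
      obtain ⟨rfl, rfl⟩ : a = b ∧ l' = m₂ := by simpa using h
      exact ⟨[], l, nil, d, rfl, HEq.rfl⟩
    | cons a' m₁ =>
      obtain ⟨rfl, h'⟩ : a = a' ∧ l' = m₁ ++ b :: m₂ := by simpa using h
      obtain ⟨l₁, l₂, d₁, d₂, e, hd⟩ := ih m₁ h'
      exact ⟨a :: l₁, l₂, keep a d₁, d₂, by simp [e], heq_keep e h' hd⟩
  | @drop a l l' d ih =>
    obtain ⟨l₁, l₂, d₁, d₂, e, hd⟩ := ih m₁ h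
    exact ⟨a :: l₁, l₂, drop a d₁, d₂, by simp [e], heq_drop e h hd⟩

theorem comp_heq {l l' m n : List X} {d : Del l m} {d' : Del l' m} (h : l = l') (hd : d ≍ d')
    (e : Del m n) : comp d e ≍ comp d' e := by
  subst h; cases hd; rfl

theorem append_keep_heq {l₁ l₂ l₂' m₁ m₂ : List X} (d₁ : Del l₁ m₁) (b : X) {d : Del l₂ m₂}
    {d' : Del l₂' m₂} (h : l₂ = l₂') (hd : d ≍ d') :
    append d₁ (keep b d) ≍ append d₁ (keep b d') := by
  subst h; cases hd; rfl

theorem keep_heq_keep {a : X} {l l' m : List X} {d : Del l m} {e : Del l' m} (h : l = l')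
    (hd : keep a d ≍ keep a e) : d ≍ e := by
  subst h; cases hd; rfl

theorem drop_heq_drop {a : X} {l l' m : List X} {d : Del l m} {e : Del l' m} (h : l = l')
    (hd : drop a d ≍ drop a e) : d ≍ e := by
  subst h; cases hd; rfl

theorem not_keep_heq_drop {a : X} {l l' m : List X} {d : Del l m} {e : Del l' (a :: m)}
    (h : l = l') : ¬ keep a d ≍ drop a e := by
  subst h; intro hd; cases hd

/-- The cut is unique: read from the left, the two deletions use the same constructors, and the kept
`b` is the one preceded by exactly `m₁.length` kept letters. -/
theorem append_keep_injective {l₁ l₁' l₂ l₂' m₁ m₂ : List X} {b : X} (d₁ : Del l₁ m₁)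
    (d₁' : Del l₁' m₁) (d₂ : Del l₂ m₂) (d₂' : Del l₂' m₂)
    (h : l₁ ++ b :: l₂ = l₁' ++ b :: l₂')
    (hd : append d₁ (keep b d₂) ≍ append d₁' (keep b d₂')) :
    l₁ = l₁' ∧ l₂ = l₂' ∧ d₁ ≍ d₁' ∧ d₂ ≍ d₂' := by
  induction d₁ generalizing l₁' with
  | nil =>
    cases d₁' with
    | nil =>
      obtain rfl : l₂ = l₂' := by simpa using h
      exact ⟨rfl, rfl, HEq.rfl, keep_heq_keep rfl hd⟩
    | drop a d₁' =>
      simp only [List.nil_append, List.cons_append, List.cons.injEq] at h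
      obtain ⟨rfl, h'⟩ := h
      exact (not_keep_heq_drop h' hd).elim
  | @keep a l l' d ih =>
    cases d₁' with
    | @keep _ k _ d₁' =>
      have h' : l ++ b :: l₂ = k ++ b :: l₂' := by simpa using h
      obtain ⟨rfl, rfl, h₁, h₂⟩ := ih d₁' h' (keep_heq_keep h' hd)
      cases h₁
      exact ⟨rfl, rfl, HEq.rfl, h₂⟩
    | @drop _ k _ d₁' =>
      simp only [List.cons_append, List.cons.injEq] at h
      obtain ⟨rfl, h'⟩ := h
      exact (not_keep_heq_drop h' hd).elim
  | @drop a l l' d ih =>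
    cases d₁' with
    | nil =>
      simp only [List.nil_append, List.cons_append, List.cons.injEq] at h
      obtain ⟨rfl, h'⟩ := h
      exact (not_keep_heq_drop h'.symm hd.symm).elim
    | @keep _ k _ d₁' =>
      simp only [List.cons_append, List.cons.injEq] at h
      obtain ⟨rfl, h'⟩ := h
      exact (not_keep_heq_drop h'.symm hd.symm).elim
    | @drop _ k _ d₁' =>
      simp only [List.cons_append, List.cons.injEq] at h
      obtain ⟨rfl, h'⟩ := h
      obtain ⟨rfl, rfl, h₁, h₂⟩ := ih d₁' h' (drop_heq_drop h' hd)
      cases h₁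
      exact ⟨rfl, rfl, HEq.rfl, h₂⟩

end Del

namespace Chain

variable {X : Type w} {A B : X}

theorem comp_eqToHom_heq {t s s' : Chain X A B} (d : t ⟶ s) (h : s = s') :
    d ≫ eqToHom h ≍ d := by
  subst h; simp

theorem eqToHom_comp_heq {t t' s : Chain X A B} (d : t ⟶ s) (h : t' = t) :
    eqToHom h ≫ d ≍ d := by
  subst h; simp

end Chain

/-! ### Coinduced endomorphism lax functors -/

section

attribute [-instance] CategoryTheory.catToReflQuiver

section

variable {X : Type v}

/-- The ways of appending to a word `l A` a chain starting at `A` with a deletion onto the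
chain `t`: the result is `u B`, with `u = l A w`. -/
structure Extension {A B : X} (t : Chain X A B) : Type v where
  l : List X
  u : List X
  w : List X
  eq : u = l ++ A :: w
  del : (⟨w⟩ : Chain X A B) ⟶ t

namespace Extension

variable {A B C : X} {t t' : Chain X A B} {s : Chain X B C}

abbrev postcomp (e : Extension t) (d : t ⟶ t') : Extension t' where
  l := e.l
  u := e.u
  w := e.w
  eq := e.eq
  del := e.del ≫ d

/-- A factorization of an extension into two successive extensions. -/
structure Splitting (e : Extension (t.concat s)) where
  m : List X
  w₁ : List X
  w₂ : List X
  eq₁ : m = e.l ++ A :: w₁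
  eq₂ : e.u = m ++ B :: w₂
  del₁ : (⟨w₁⟩ : Chain X A B) ⟶ t
  del₂ : (⟨w₂⟩ : Chain X B C) ⟶ s
  eq_w : e.w = w₁ ++ B :: w₂
  heq_del : e.del ≍ Chain.concatMap del₁ del₂

namespace Splitting

variable {e : Extension (t.concat s)}

abbrev fst (r : Splitting e) : Extension t := ⟨e.l, r.m, r.w₁, r.eq₁, r.del₁⟩

abbrev snd (r : Splitting e) : Extension s := ⟨r.m, e.u, r.w₂, r.eq₂, r.del₂⟩

instance : Nonempty (Splitting e) := by
  obtain ⟨l, u, w, rfl, d⟩ := e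
  obtain ⟨w₁, w₂, d₁, d₂, rfl, hd⟩ := Del.exists_split d t.mid B s.mid rfl
  exact ⟨⟨l ++ A :: w₁, w₁, w₂, rfl, by simp, d₁, d₂, rfl, hd⟩⟩

/-- Uniqueness lets `endoLax`, defined through a chosen splitting, be computed with whichever
splitting is convenient (`endoLax_π`). -/
instance : Subsingleton (Splitting e) where
  allEq r r' := by
    obtain ⟨l, u, w, rfl, d⟩ := e
    obtain ⟨m, w₁, w₂, rfl, h₂, d₁, d₂, h, hd⟩ := r
    obtain ⟨m', w₁', w₂', rfl, h₂', d₁', d₂', h', hd'⟩ := r'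
    obtain ⟨rfl, rfl, h₃, h₄⟩ :=
      Del.append_keep_injective d₁ d₁' d₂ d₂' (h.symm.trans h') (hd.symm.trans hd')
    cases h₃
    cases h₄
    rfl

end Splitting

noncomputable def splitting (e : Extension (t.concat s)) : Splitting e :=
  Classical.arbitrary _

end Extension

end

section

variable (M : Type u) [Category.{v} M] [MonoidalCategory M]

/-- A category enriched in `M`, without identities, with objects indexed by `ι`. -/
structure Semienriched (ι : Type v) where
  hom : ι → ι → M
  comp (i j k : ι) : hom i j ⊗ hom j k ⟶ hom i k
  assoc (i j k l : ι) : comp i j k ▷ hom k l ≫ comp i k l =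
    (α_ _ _ _).hom ≫ hom i j ◁ comp j k l ≫ comp i j l

/-- A morphism of enriched semicategories which is the identity on objects. -/
structure Semienriched.Hom {M} [Category.{v} M] [MonoidalCategory M] {ι : Type v}
    (S T : Semienriched M ι) where
  map (i j : ι) : S.hom i j ⟶ T.hom i j
  map_comp (i j k : ι) : S.comp i j k ≫ map i k = (map i j ⊗ₘ map j k) ≫ T.comp i j k

variable {M} [HasProducts.{v} M] {X : Type v}

section

variable (S : Semienriched M (X × List X)) {A B C D : X}

/-- The product of the hom objects of `S` over the extensions by a deletion onto `t`. -/
noncomputable def endoObj (t : Chain X A B) : M :=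
  ∏ᶜ fun e : Extension t => S.hom (A, e.l) (B, e.u)

variable {S} {T : M} {t t' : Chain X A B} {s s' : Chain X B C} {r : Chain X C D}

noncomputable def endoπ (e : Extension t) : endoObj S t ⟶ S.hom (A, e.l) (B, e.u) :=
  Pi.π (fun e : Extension t => S.hom (A, e.l) (B, e.u)) e

theorem endoπ_congr {l u w : List X} {h : u = l ++ A :: w} {d d' : (⟨w⟩ : Chain X A B) ⟶ t}
    (hd : d = d') : endoπ (S := S) ⟨l, u, w, h, d⟩ = endoπ ⟨l, u, w, h, d'⟩ := by
  subst hd; rfl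

noncomputable def endoLift (φ : ∀ e : Extension t, T ⟶ S.hom (A, e.l) (B, e.u)) :
    T ⟶ endoObj S t :=
  Pi.lift φ

@[simp]
theorem endoLift_π (φ : ∀ e : Extension t, T ⟶ S.hom (A, e.l) (B, e.u)) (e : Extension t) :
    endoLift φ ≫ endoπ e = φ e :=
  Pi.lift_π φ e

theorem endo_hom_ext {f g : T ⟶ endoObj S t} (h : ∀ e, f ≫ endoπ e = g ≫ endoπ e) : f = g :=
  Pi.hom_ext _ _ h

variable (S) in
noncomputable def endoMap (d : t ⟶ t') : endoObj S t' ⟶ endoObj S t :=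
  endoLift fun e => endoπ (e.postcomp d)

@[simp]
theorem endoMap_π (d : t ⟶ t') (e : Extension t) :
    endoMap S d ≫ endoπ e = endoπ (e.postcomp d) :=
  endoLift_π _ e

variable (S t s) in
noncomputable def endoLax : endoObj S t ⊗ endoObj S s ⟶ endoObj S (t.concat s) :=
  endoLift fun e => (endoπ e.splitting.fst ⊗ₘ endoπ e.splitting.snd) ≫ S.comp _ _ _

theorem endoLax_π {e : Extension (t.concat s)} (r : e.Splitting) :
    endoLax S t s ≫ endoπ e = (endoπ r.fst ⊗ₘ endoπ r.snd) ≫ S.comp _ _ _ := by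
  rw [endoLax, endoLift_π, Subsingleton.elim r e.splitting]

theorem endoLax_natural (d₁ : t ⟶ t') (d₂ : s ⟶ s') :
    (endoMap S d₁ ⊗ₘ endoMap S d₂) ≫ endoLax S t s =
      endoLax S t' s' ≫ endoMap S (Chain.concatMap d₁ d₂) := by
  refine endo_hom_ext fun e => ?_
  let r := e.splitting
  -- Postcomposing the two halves of a splitting splits the postcomposed extension.
  let r' : (e.postcomp (Chain.concatMap d₁ d₂)).Splitting :=
    ⟨r.m, r.w₁, r.w₂, r.eq₁, r.eq₂, r.del₁ ≫ d₁, r.del₂ ≫ d₂, r.eq_w, by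
      refine (Del.comp_heq r.eq_w r.heq_del _).trans (heq_of_eq ?_)
      exact (Chain.concatMap_comp r.del₁ d₁ r.del₂ d₂).symm⟩
  rw [Category.assoc, Category.assoc, endoLax_π r, endoMap_π, endoLax_π r',
    tensorHom_comp_tensorHom_assoc, endoMap_π, endoMap_π]

/-- Both sides cut an extension into the same three pieces, which reduces the claim to associativity
in `S`. The words `l`, `m`, `u` are fields tied by equations, so both bracketings land in literally
the same hom object and no transport is needed. -/
theorem endoLax_assoc :
    endoLax S t s ▷ endoObj S r ≫ endoLax S (t.concat s) r ≫
        endoMap S (eqToHom (Chain.concat_assoc t s r).symm) =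
      (α_ _ _ _).hom ≫ endoObj S t ◁ endoLax S s r ≫ endoLax S t (s.concat r) := by
  refine endo_hom_ext fun e => ?_
  let z := e.splitting
  let z' := z.snd.splitting
  -- `z` cuts off the first piece and `z'` cuts the remainder; `y` regroups the first two pieces,
  -- and `y'` below separates them again.
  let y : (e.postcomp (eqToHom (Chain.concat_assoc t s r).symm)).Splitting :=
    { m := z'.m
      w₁ := z.w₁ ++ B :: z'.w₁
      w₂ := z'.w₂
      eq₁ := z'.eq₁.trans (by simp [z.eq₁])
      eq₂ := z'.eq₂
      del₁ := Chain.concatMap z.del₁ z'.del₁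
      del₂ := z'.del₂
      eq_w := (z.eq_w.trans (congrArg (fun x => z.w₁ ++ B :: x) z'.eq_w)).trans (by simp)
      heq_del := ((Chain.comp_eqToHom_heq _ _).trans (z.heq_del.trans
        (Del.append_keep_heq _ _ z'.eq_w z'.heq_del))).trans (Del.append_assoc_heq _ _ _ _ _).symm }
  let y' : y.fst.Splitting := ⟨z.m, z.w₁, z'.w₁, z.eq₁, z'.eq₁, z.del₁, z'.del₁, rfl, HEq.rfl⟩
  have h₁ : endoLax S t s ▷ endoObj S r ≫ (endoπ y.fst ⊗ₘ endoπ y.snd) =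
      ((endoπ z.fst ⊗ₘ endoπ z'.fst) ⊗ₘ endoπ z'.snd) ≫ S.comp _ _ _ ▷ _ := by
    rw [whiskerRight_comp_tensorHom, endoLax_π y', tensorHom_comp_whiskerRight]
  have h₂ : endoObj S t ◁ endoLax S s r ≫ (endoπ z.fst ⊗ₘ endoπ z.snd) =
      (endoπ z.fst ⊗ₘ (endoπ z'.fst ⊗ₘ endoπ z'.snd)) ≫ _ ◁ S.comp _ _ _ := by
    rw [whiskerLeft_comp_tensorHom, endoLax_π z', tensorHom_comp_whiskerLeft]
  simp only [Category.assoc]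
  rw [endoMap_π, endoLax_π y, endoLax_π z, reassoc_of% h₁, reassoc_of% h₂, S.assoc,
    associator_naturality_assoc]

end

/-- The pre-Co-Segal category of endomorphisms, freely adapted to deletions: its value at a chain
`t` is the product, over all ways of extending a word by a chain with a deletion onto `t`, of the
hom objects of `S`. -/
noncomputable abbrev endo (S : Semienriched M (X × List X)) : PreCoSegal M X where
  F A B :=
    { obj t := endoObj S t.unop
      map f := endoMap S f.unop
      map_id t := endo_hom_ext fun e => by
        rw [unop_id, endoMap_π, Category.id_comp]
        exact endoπ_congr (Category.comp_id e.del)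
      map_comp f g := endo_hom_ext fun e => by
        rw [unop_comp, endoMap_π, Category.assoc, endoMap_π, endoMap_π]
        exact endoπ_congr (Category.assoc e.del _ _).symm }
  lax t s := endoLax S t s
  lax_natural d e := endoLax_natural d e
  lax_assoc t s r := by
    rw [← endoLax_assoc]
    simp only [eqToHom_unop]

end

end

/-! ### Actions as morphisms to endomorphism lax functors -/

section

attribute [-instance] CategoryTheory.catToReflQuiver

section

variable {M : Type u} [Category.{v} M] [MonoidalCategory M] [HasProducts.{v} M] {X : Type v}

/-- Constructor for morphisms to the endomorphism object. -/
noncomputable abbrev endoHomMk {G : PreCoSegal M X} {S : Semienriched M (X × List X)}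
    (app : ∀ {A B : X} (t : Chain X A B), (G.F A B).obj (op t) ⟶ endoObj S t)
    (naturality : ∀ {A B : X} {t t' : Chain X A B} (d : t ⟶ t'),
      (G.F A B).map d.op ≫ app t = app t' ≫ endoMap S d)
    (lax : ∀ {A B C : X} (t : Chain X A B) (s : Chain X B C),
      G.lax t s ≫ app (t.concat s) = (app t ⊗ₘ app s) ≫ endoLax S t s) :
    G ⟶ endo S where
  app _ _ :=
    { app t := app t.unop
      naturality _ _ f := naturality f.unop }
  lax_comm := lax

/-- The functoriality of `endo`. -/
noncomputable def endoHom {S T : Semienriched M (X × List X)} (φ : S.Hom T) : endo S ⟶ endo T :=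
  endoHomMk (fun t => endoLift fun e => endoπ e ≫ φ.map _ _)
    (fun d => endo_hom_ext fun e => by
      rw [Category.assoc, Category.assoc, endoMap_π, endoLift_π, endoLift_π]
      exact (reassoc_of% endoMap_π d e) _)
    (fun t s => endo_hom_ext fun e => by
      rw [Category.assoc, Category.assoc, endoLift_π, endoLax_π e.splitting,
        tensorHom_comp_tensorHom_assoc, endoLift_π, endoLift_π, ← tensorHom_comp_tensorHom_assoc,
        ← φ.map_comp]
      exact (reassoc_of% endoLax_π e.splitting) _)

theorem endoHom_app_π {S T : Semienriched M (X × List X)} (φ : S.Hom T) {A B : X}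
    {t : Chain X A B} (e : Extension t) :
    (PreCoSegal.Hom.app (endoHom φ) A B).app (op t) ≫ endoπ (S := T) e =
      endoπ e ≫ φ.map _ _ :=
  endoLift_π _ e

/-- An action of a pre-Co-Segal category on an enriched semicategory whose objects are indexed
by words. -/
structure Action (G : PreCoSegal M X) (S : Semienriched M (X × List X)) where
  act {A B : X} (t : Chain X A B) (l u : List X) (h : u = l ++ A :: t.mid) :
    (G.F A B).obj (op t) ⟶ S.hom (A, l) (B, u)
  lax_act {A B C : X} (t : Chain X A B) (s : Chain X B C) (l m u : List X)
    (h₁ : m = l ++ A :: t.mid) (h₂ : u = m ++ B :: s.mid) (h : u = l ++ A :: (t.concat s).mid) :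
    G.lax t s ≫ act (t.concat s) l u h = (act t l m h₁ ⊗ₘ act s m u h₂) ≫ S.comp _ _ _

namespace Action

variable {G : PreCoSegal M X} {S : Semienriched M (X × List X)}

omit [HasProducts.{v} M] in
theorem map_act_congr (a : Action G S) {A B : X} {t : Chain X A B} {w w' l u : List X}
    (hw : w = w') {d : (⟨w⟩ : Chain X A B) ⟶ t} {d' : (⟨w'⟩ : Chain X A B) ⟶ t} (hd : d ≍ d')
    (h : u = l ++ A :: w) (h' : u = l ++ A :: w') :
    (G.F A B).map d.op ≫ a.act ⟨w⟩ l u h = (G.F A B).map d'.op ≫ a.act ⟨w'⟩ l u h' := by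
  subst hw; cases hd; rfl

/-- The morphism to the endomorphism object corresponding to an action. -/
noncomputable def toHom (a : Action G S) : G ⟶ endo S :=
  endoHomMk (fun {A B} t => endoLift fun e =>
      (G.F A B).map e.del.op ≫
        a.act ⟨e.w⟩ e.l e.u e.eq)
    (fun d => endo_hom_ext fun e => by
      rw [Category.assoc, Category.assoc, endoMap_π, endoLift_π, endoLift_π,
        ← Functor.map_comp_assoc]
      rfl)
    (fun {A B C} t s => endo_hom_ext fun e => by
      let s' := e.splitting
      rw [Category.assoc, Category.assoc, endoLax_π s', tensorHom_comp_tensorHom_assoc,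
        endoLift_π, endoLift_π, endoLift_π, ← tensorHom_comp_tensorHom_assoc,
        ← a.lax_act ⟨_⟩ ⟨_⟩ _ _ _ _ _ (s'.eq₂.trans (by rw [s'.eq₁]; simp [Chain.concat])),
        ← Category.assoc (_ ⊗ₘ _), G.lax_natural, Category.assoc]
      congr 1
      exact a.map_act_congr s'.eq_w s'.heq_del _ _)

theorem toHom_app_π (a : Action G S) {A B : X} {t : Chain X A B} (e : Extension t) :
    (PreCoSegal.Hom.app a.toHom A B).app (op t) ≫ endoπ (S := S) e =
      (G.F A B).map e.del.op ≫ a.act ⟨e.w⟩ e.l e.u e.eq :=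
  endoLift_π _ e

end Action

end

/-! ### Internal homs of families of objects and of families of arrows -/

section

variable {M : Type u} [Category.{v} M] [MonoidalCategory M] [MonoidalClosed M]

open MonoidalClosed

/-- With the next two lemmas: internal composition is natural in its target and its source and
dinatural in the middle object. This is what makes compatible pairs of internal homs composable in
`arrowComp`. -/
theorem comp_ihom_map {x y z z' : M} (g : z ⟶ z') :
    MonoidalClosed.comp x y z ≫ (ihom x).map g =
      _ ◁ (ihom y).map g ≫ MonoidalClosed.comp x y z' := by
  apply uncurry_injective
  rw [uncurry_natural_right, uncurry_natural_left, comp_eq, comp_eq, uncurry_curry, uncurry_curry,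
    compTranspose_eq, compTranspose_eq, associator_inv_naturality_right_assoc,
    whisker_exchange_assoc]
  dsimp only [Functor.id_obj]
  rw [ihom.ev_naturality, Category.assoc, Category.assoc]

theorem comp_pre {x x' y z : M} (f : x' ⟶ x) :
    MonoidalClosed.comp x y z ≫ (pre f).app z =
      (pre f).app y ▷ _ ≫ MonoidalClosed.comp x' y z := by
  apply uncurry_injective
  rw [uncurry_pre_app, uncurry_natural_left, comp_eq, comp_eq, uncurry_curry, uncurry_curry,
    compTranspose_eq, compTranspose_eq, associator_inv_naturality_middle_assoc,
    ← comp_whiskerRight_assoc, id_tensor_pre_app_comp_ev, comp_whiskerRight_assoc,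
    associator_inv_naturality_left_assoc]

theorem pre_comp {x y y' z : M} (f : y' ⟶ y) :
    _ ◁ (pre f).app z ≫ MonoidalClosed.comp x y' z =
      (ihom x).map f ▷ _ ≫ MonoidalClosed.comp x y z := by
  apply uncurry_injective
  rw [uncurry_natural_left, uncurry_natural_left, comp_eq, comp_eq, uncurry_curry, uncurry_curry,
    compTranspose_eq, compTranspose_eq]
  rw [associator_inv_naturality_right_assoc, associator_inv_naturality_middle_assoc,
    whisker_exchange_assoc]
  dsimp only [Functor.id_obj]
  rw [id_tensor_pre_app_comp_ev, ← comp_whiskerRight_assoc, ← comp_whiskerRight_assoc,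
    ihom.ev_naturality]

variable {ι : Type v}

/-- The internal homs between the members of a family. -/
abbrev ihomSemi (V : ι → M) : Semienriched M ι where
  hom i j := (ihom (V i)).obj (V j)
  comp _ _ _ := MonoidalClosed.comp _ _ _
  assoc i j k l := by
    rw [← MonoidalClosed.assoc, Iso.hom_inv_id_assoc]

variable [HasPullbacks M] {V W : ι → M} (p : ∀ i, V i ⟶ W i)

/-- The internal hom between two members of a family of morphisms, in the category of arrows. -/
noncomputable def arrowHom (i j : ι) : M :=
  pullback ((ihom (V i)).map (p j)) ((pre (p i)).app (W j))

noncomputable def arrowFst (i j : ι) : arrowHom p i j ⟶ (ihom (V i)).obj (V j) :=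
  pullback.fst _ _

noncomputable def arrowSnd (i j : ι) : arrowHom p i j ⟶ (ihom (W i)).obj (W j) :=
  pullback.snd _ _

theorem arrow_condition (i j : ι) : arrowFst p i j ≫ (ihom (V i)).map (p j) =
    arrowSnd p i j ≫ (pre (p i)).app (W j) :=
  pullback.condition

variable {p} in
theorem arrow_hom_ext {i j : ι} {T : M} {f g : T ⟶ arrowHom p i j}
    (h₁ : f ≫ arrowFst p i j = g ≫ arrowFst p i j)
    (h₂ : f ≫ arrowSnd p i j = g ≫ arrowSnd p i j) : f = g :=
  pullback.hom_ext h₁ h₂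

noncomputable def arrowLift {i j : ι} {T : M} (f : T ⟶ (ihom (V i)).obj (V j))
    (g : T ⟶ (ihom (W i)).obj (W j)) (h : f ≫ (ihom (V i)).map (p j) = g ≫ (pre (p i)).app (W j)) :
    T ⟶ arrowHom p i j :=
  pullback.lift f g h

section

variable {i j : ι} {T : M} (f : T ⟶ (ihom (V i)).obj (V j)) (g : T ⟶ (ihom (W i)).obj (W j))
  (h : f ≫ (ihom (V i)).map (p j) = g ≫ (pre (p i)).app (W j))

theorem arrowLift_fst : arrowLift p f g h ≫ arrowFst p i j = f :=
  pullback.lift_fst _ _ _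

theorem arrowLift_snd : arrowLift p f g h ≫ arrowSnd p i j = g :=
  pullback.lift_snd _ _ _

end

noncomputable def arrowComp (i j k : ι) : arrowHom p i j ⊗ arrowHom p j k ⟶ arrowHom p i k :=
  pullback.lift ((arrowFst p i j ⊗ₘ arrowFst p j k) ≫ MonoidalClosed.comp _ _ _)
    ((arrowSnd p i j ⊗ₘ arrowSnd p j k) ≫ MonoidalClosed.comp _ _ _) (by
      -- In elements, for arrows `(g, g')` and `(h, h')`: first `p h = h' p` on the second factor,
      -- then `pre_comp` moves the middle `p` to the first factor, then `p g = g' p`.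
      rw [Category.assoc, Category.assoc, comp_ihom_map, comp_pre,
        tensorHom_comp_whiskerLeft_assoc, tensorHom_comp_whiskerRight_assoc, arrow_condition,
        ← tensorHom_comp_whiskerLeft_assoc, pre_comp, tensorHom_comp_whiskerRight_assoc,
        arrow_condition])

theorem arrowComp_fst (i j k : ι) : arrowComp p i j k ≫ arrowFst p i k =
    (arrowFst p i j ⊗ₘ arrowFst p j k) ≫ MonoidalClosed.comp _ _ _ :=
  pullback.lift_fst _ _ _

theorem arrowComp_snd (i j k : ι) : arrowComp p i j k ≫ arrowSnd p i k =
    (arrowSnd p i j ⊗ₘ arrowSnd p j k) ≫ MonoidalClosed.comp _ _ _ :=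
  pullback.lift_snd _ _ _

/-- The internal homs, in the category of arrows, between the members of a family of morphisms. -/
noncomputable abbrev arrowSemi : Semienriched M ι where
  hom := arrowHom p
  comp := arrowComp p
  assoc i j k l := by
    apply arrow_hom_ext
    · simp only [Category.assoc, arrowComp_fst]
      rw [whiskerRight_comp_tensorHom_assoc, whiskerLeft_comp_tensorHom_assoc, arrowComp_fst,
        arrowComp_fst, ← tensorHom_comp_whiskerRight_assoc, ← tensorHom_comp_whiskerLeft_assoc,
        ← associator_naturality_assoc]
      exact congrArg _ ((ihomSemi V).assoc i j k l)
    · simp only [Category.assoc, arrowComp_snd]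
      rw [whiskerRight_comp_tensorHom_assoc, whiskerLeft_comp_tensorHom_assoc, arrowComp_snd,
        arrowComp_snd, ← tensorHom_comp_whiskerRight_assoc, ← tensorHom_comp_whiskerLeft_assoc,
        ← associator_naturality_assoc]
      exact congrArg _ ((ihomSemi W).assoc i j k l)

/-- The projection to the internal homs between the targets. -/
noncomputable def arrowProj : (arrowSemi p).Hom (ihomSemi W) where
  map := arrowSnd p
  map_comp := arrowComp_snd p

end

end

/-! ### Right modules, the free module with units, and coinduction -/

section

attribute [-instance] CategoryTheory.catToReflQuiver

section

variable {M : Type u} [Category.{v} M] [MonoidalCategory M] {X : Type v}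

/-- A right module over a pre-Co-Segal category, indexed by words with a marked last letter. -/
structure RightModule (G : PreCoSegal M X) (V : X × List X → M) where
  act {A B : X} (t : Chain X A B) (l u : List X) (h : u = l ++ A :: t.mid) :
    V (A, l) ⊗ (G.F A B).obj (op t) ⟶ V (B, u)
  act_act {A B C : X} (t : Chain X A B) (s : Chain X B C) (l m u : List X)
    (h₁ : m = l ++ A :: t.mid) (h₂ : u = m ++ B :: s.mid) (h : u = l ++ A :: (t.concat s).mid) :
    act t l m h₁ ▷ _ ≫ act s m u h₂ = (α_ _ _ _).hom ≫ _ ◁ G.lax t s ≫ act (t.concat s) l u h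

/-- Restriction of a module along a morphism. -/
def RightModule.restrict {F E : PreCoSegal M X} (f : F ⟶ E) {V : X × List X → M}
    (a : RightModule E V) : RightModule F V where
  act {A B} t l u h := V (A, l) ◁ (PreCoSegal.Hom.app f A B).app (op t) ≫ a.act t l u h
  act_act {A B C} t s l m u h₁ h₂ h := by
    have h₃ := a.act_act t s l m u h₁ h₂ h
    have h₄ := PreCoSegal.Hom.lax_comm f t s
    rw [comp_whiskerRight, Category.assoc, ← whisker_exchange_assoc, h₃, ← whiskerLeft_comp_assoc,
      h₄, associator_naturality_right_assoc, associator_naturality_middle_assoc,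
      MonoidalCategory.tensorHom_def, Category.assoc, whiskerLeft_comp, whiskerLeft_comp]
    simp only [Category.assoc]

section

open MonoidalClosed

variable [MonoidalClosed M] {G : PreCoSegal M X} {V W : X × List X → M}

/-- Composing transposes is the transpose of acting twice; this turns the associativity of a module
into the axiom of an action. -/
theorem curry_tensor_curry_comp {x y z S T : M} (f : x ⊗ S ⟶ y) (g : y ⊗ T ⟶ z) :
    (curry f ⊗ₘ curry g) ≫ MonoidalClosed.comp x y z = curry ((α_ _ _ _).inv ≫ f ▷ T ≫ g) := by
  apply uncurry_injective
  rw [uncurry_natural_left, uncurry_curry, comp_eq, uncurry_curry, compTranspose_eq,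
    ← id_tensorHom, associator_inv_naturality_assoc, id_tensorHom, tensorHom_def_assoc,
    whisker_exchange_assoc, ← comp_whiskerRight_assoc, ← uncurry_eq, uncurry_curry]
  exact congrArg (fun k => _ ≫ f ▷ T ≫ k) ((uncurry_eq (curry g)).symm.trans (uncurry_curry g))

noncomputable def RightModule.toAction (a : RightModule G V) : Action G (ihomSemi V) where
  act t l u h := curry (a.act t l u h)
  lax_act t s l m u h₁ h₂ h := by
    refine (curry_natural_left _ _).symm.trans ((congrArg curry ?_).trans
      (curry_tensor_curry_comp _ _).symm)
    rw [a.act_act t s l m u h₁ h₂ h, Iso.inv_hom_id_assoc]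

end

section

variable (E : PreCoSegal M X)

/-- The free right module on units at the words of length one. -/
def plus : X × List X → M
  | (_, []) => 𝟙_ M
  | (A, C :: l) => (E.F C A).obj (op ⟨l⟩)

/-- One-letter words carry the unit object, acted on through the left unitor: this adjoins the units
that `E` lacks. On longer words the action is the laxity map. -/
def plusActAux {A B : X} (t : Chain X A B) : (l : List X) →
    (plus E (A, l) ⊗ (E.F A B).obj (op t) ⟶ plus E (B, l ++ A :: t.mid))
  | [] => (λ_ _).hom
  | _ :: l => E.lax ⟨l⟩ t

theorem plusActAux_assoc {A B C : X} (t : Chain X A B) (s : Chain X B C) : (l : List X) →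
    (h : plus E (C, l ++ A :: t.mid ++ B :: s.mid) = plus E (C, l ++ A :: (t.concat s).mid)) →
    plusActAux E t l ▷ _ ≫ plusActAux E s (l ++ A :: t.mid) ≫ eqToHom h =
      (α_ _ _ _).hom ≫ _ ◁ E.lax t s ≫ plusActAux E (t.concat s) l
  | [], _ => by
    change (λ_ _).hom ▷ _ ≫ E.lax t s ≫ 𝟙 _ = (α_ _ _ _).hom ≫ 𝟙_ M ◁ E.lax t s ≫ (λ_ _).hom
    rw [Category.comp_id, leftUnitor_naturality, leftUnitor_whiskerRight, Category.assoc]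
  | D :: l, _ => by
    have := E.lax_assoc (A := D) ⟨l⟩ t s
    rwa [eqToHom_map] at this

def plusModule : RightModule E (plus E) where
  act t l u h := plusActAux E t l ≫ eqToHom (by rw [h])
  act_act {A B C} t s l m u h₁ h₂ h := by
    subst h₁
    subst h₂
    have h' := congrArg (fun u => plus E (C, u)) h
    rw [← cancel_mono (eqToHom h'), eqToHom_refl, eqToHom_refl, Category.comp_id,
      Category.comp_id, Category.assoc, plusActAux_assoc E t s l h']
    simp only [Category.assoc, eqToHom_trans, eqToHom_refl, Category.comp_id]

variable {E}

theorem plusModule_act_nil {A B : X} (t : Chain X A B) :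
    (plusModule E).act t [] (A :: t.mid) rfl = (λ_ _).hom :=
  Category.comp_id _

/-- The functoriality of `plus`. -/
def plusMap {F : PreCoSegal M X} (f : F ⟶ E) : (i : X × List X) → (plus F i ⟶ plus E i)
  | (_, []) => 𝟙 _
  | (A, C :: l) => (PreCoSegal.Hom.app f C A).app (op ⟨l⟩)

end

section

variable {F : PreCoSegal M X}

/-- The ways of completing a word `l A` to a word `l A w`, where `w` is empty or the end of a chain
starting at `A`. -/
inductive Completion (A : X) (l : List X) : Type v
  | none : Completion A l
  | some {B : X} (t : Chain X A B) (u : List X) (h : u = l ++ A :: t.mid) : Completion A l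

namespace Completion

variable (F) {A : X} {l : List X}

abbrev obj : Completion A l → M
  | none => 𝟙_ M
  | some (B := B) t _ _ => (F.F A B).obj (op t)

abbrev word : Completion A l → X × List X
  | none => (A, l)
  | some (B := B) _ u _ => (B, u)

end Completion

variable [SymmetricCategory M] [MonoidalClosed M]

/-- Currying on the right. -/
def curryRight {S K T : M} (g : S ⊗ K ⟶ T) : S ⟶ (ihom K).obj T :=
  MonoidalClosed.curry ((β_ K S).hom ≫ g)

theorem curryRight_injective {S K T : M} {g g' : S ⊗ K ⟶ T} (h : curryRight g = curryRight g') :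
    g = g' :=
  (cancel_epi _).1 (MonoidalClosed.curry_injective h)

theorem curryRight_natural_left {S S' K T : M} (d : S' ⟶ S) (g : S ⊗ K ⟶ T) :
    d ≫ curryRight g = curryRight (d ▷ K ≫ g) := by
  rw [curryRight, curryRight, ← MonoidalClosed.curry_natural_left,
    BraidedCategory.braiding_naturality_right_assoc]

theorem curryRight_natural_right {S K T T' : M} (g : S ⊗ K ⟶ T) (e : T ⟶ T') :
    curryRight g ≫ (ihom K).map e = curryRight (g ≫ e) := by
  rw [curryRight, curryRight, ← MonoidalClosed.curry_natural_right, Category.assoc]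

def uncurryRight {S K T : M} (g : S ⟶ (ihom K).obj T) : S ⊗ K ⟶ T :=
  (β_ S K).hom ≫ MonoidalClosed.uncurry g

theorem curryRight_uncurryRight {S K T : M} (g : S ⟶ (ihom K).obj T) :
    curryRight (uncurryRight g) = g := by
  rw [curryRight, uncurryRight, SymmetricCategory.symmetry_assoc, MonoidalClosed.curry_uncurry]

variable [HasProducts.{v} M] [HasPullbacks M]
  {E : PreCoSegal M X} (f : F ⟶ E) {Y Z : X × List X → M} (p : ∀ i, Y i ⟶ Z i)
  (b : ∀ i, plus E i ⟶ Z i)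

/-- In elements this is `b (x · f(y))` for a completion `y`, or `b x` for the empty completion: the
element of `Z` that a point of `coind` over `x` must lift to `Y`. -/
def baseEval (A : X) (l : List X) : (q : Completion A l) → plus E (A, l) ⊗ q.obj F ⟶ Z q.word
  | .none => (ρ_ _).hom ≫ b (A, l)
  | .some (B := B) t u h =>
      ((plusModule E).restrict f).act t l u h ≫ b (B, u)

/-- The pullback whose generalized elements are the generalized elements `x` of `plus E (A, l)` with
lifts to `Y` of the images in `Z` of the completions of `x` by elements of `F`. -/
noncomputable def coind (i : X × List X) : M :=
  pullback (Pi.lift fun q : Completion i.1 i.2 => curryRight (baseEval f b i.1 i.2 q))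
    (Limits.Pi.map fun q : Completion i.1 i.2 => (ihom (q.obj F)).map (p q.word))

noncomputable def coindProj (i : X × List X) : coind f p b i ⟶ plus E i :=
  pullback.fst _ _

noncomputable def coindEval (A : X) (l : List X) (q : Completion A l) :
    coind f p b (A, l) ⊗ q.obj F ⟶ Y q.word :=
  uncurryRight (pullback.snd _ _ ≫ Pi.π _ q)

theorem coind_condition (A : X) (l : List X) (q : Completion A l) :
    coindProj f p b (A, l) ▷ _ ≫ baseEval f b A l q = coindEval f p b A l q ≫ p q.word := by
  apply curryRight_injective
  rw [← curryRight_natural_left, ← curryRight_natural_right, coindEval, curryRight_uncurryRight]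
  have := congrArg (fun k => k ≫ Pi.π _ q) (pullback.condition
    (f := Pi.lift fun q : Completion A l => curryRight (baseEval f b A l q))
    (g := Limits.Pi.map fun q : Completion A l => (ihom (q.obj F)).map (p q.word)))
  simp only [Category.assoc, Pi.lift_π, Pi.map_π] at this
  exact this.trans (Category.assoc _ _ _).symm

variable {f p b} in
theorem coind_hom_ext {A : X} {l : List X} {T : M} {g g' : T ⟶ coind f p b (A, l)}
    (h₁ : g ≫ coindProj f p b (A, l) = g' ≫ coindProj f p b (A, l))
    (h₂ : ∀ q, g ▷ _ ≫ coindEval f p b A l q = g' ▷ _ ≫ coindEval f p b A l q) : g = g' := by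
  refine pullback.hom_ext h₁ (Pi.hom_ext _ _ fun q => ?_)
  have := congrArg curryRight (h₂ q)
  rw [← curryRight_natural_left, ← curryRight_natural_left, coindEval,
    curryRight_uncurryRight] at this
  exact (Category.assoc _ _ _).trans (this.trans (Category.assoc _ _ _).symm)

section

variable {A : X} {l : List X} {T : M} (w : T ⟶ plus E (A, l))
  (e : ∀ q : Completion A l, T ⊗ q.obj F ⟶ Y q.word)
  (h : ∀ q, w ▷ _ ≫ baseEval f b A l q = e q ≫ p q.word)

noncomputable def coindLift : T ⟶ coind f p b (A, l) :=
  pullback.lift w (Pi.lift fun q => curryRight (e q)) (by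
    refine Pi.hom_ext _ _ fun q => ?_
    simp only [Category.assoc, Pi.lift_π, Pi.map_π, Pi.lift_π_assoc]
    rw [curryRight_natural_left, curryRight_natural_right, h])

theorem coindLift_proj : coindLift f p b w e h ≫ coindProj f p b (A, l) = w :=
  pullback.lift_fst _ _ _

theorem coindLift_eval (q : Completion A l) :
    coindLift f p b w e h ▷ _ ≫ coindEval f p b A l q = e q := by
  apply curryRight_injective
  rw [← curryRight_natural_left, coindEval, curryRight_uncurryRight, coindLift]
  exact (Category.assoc _ _ _).symm.trans
    ((congrArg (· ≫ Pi.π _ q) (pullback.lift_snd _ _ _)).trans (Pi.lift_π _ _))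

end

end

end

end

/-! ### The coinduced module and the lifting property of the values -/

section

attribute [-instance] CategoryTheory.catToReflQuiver

section

open MonoidalClosed

variable {M : Type u} [Category.{v} M] [MonoidalCategory M] {X : Type v}
  [SymmetricCategory M] [MonoidalClosed M] [HasProducts.{v} M] [HasPullbacks M]
  {F E : PreCoSegal M X} (f : F ⟶ E) {Y Z : X × List X → M} (p : ∀ i, Y i ⟶ Z i)
  (b : ∀ i, plus E i ⟶ Z i)

omit [SymmetricCategory M] [MonoidalClosed M] [HasProducts.{v} M] [HasPullbacks M] in
theorem baseEval_act {A B : X} (t : Chain X A B) (l u : List X) (h : u = l ++ A :: t.mid)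
    {D : X} (s : Chain X B D) (x : List X) (h' : x = u ++ B :: s.mid)
    (h'' : x = l ++ A :: (t.concat s).mid) :
    ((plusModule E).restrict f).act t l u h ▷ _ ≫ baseEval f b B u (.some s x h') =
      (α_ _ _ _).hom ≫ _ ◁ F.lax t s ≫ baseEval f b A l (.some (t.concat s) x h'') := by
  have h₁ := ((plusModule E).restrict f).act_act t s l u x h h' h''
  exact (reassoc_of% h₁) _

/-- In elements, `(x, e) · y = (x · f(y), e')`, where `e'` at the empty completion is `e` at `y`,
and `e'` at `z` is `e` at the product of `y` and `z`. The empty completion needs its own clause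
because `F` has no units. -/
noncomputable def coindAct {A B : X} (t : Chain X A B) (l u : List X) (h : u = l ++ A :: t.mid) :
    coind f p b (A, l) ⊗ (F.F A B).obj (op t) ⟶ coind f p b (B, u) :=
  coindLift f p b (coindProj f p b (A, l) ▷ _ ≫ ((plusModule E).restrict f).act t l u h)
    (fun
      | .none => (ρ_ _).hom ≫ coindEval f p b A l (.some t u h)
      | .some s x h' => (α_ _ _ _).hom ≫ _ ◁ F.lax t s ≫
          coindEval f p b A l (.some (t.concat s) x (by rw [h', h]; simp [Chain.concat])))
    (fun q => by
      cases q with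
      | none =>
        have := coind_condition f p b A l (.some t u h)
        dsimp only [baseEval] at this ⊢
        rw [rightUnitor_naturality_assoc, Category.assoc, Category.assoc, this]
      | some s x h' =>
        have h'' : x = l ++ A :: (t.concat s).mid := by rw [h', h]; simp [Chain.concat]
        have := coind_condition f p b A l (.some (t.concat s) x h'')
        dsimp only
        rw [comp_whiskerRight_assoc, baseEval_act f b t l u h s x h' h'', Category.assoc,
          Category.assoc,
          ← this, associator_naturality_left_assoc, whisker_exchange_assoc])

section

variable {A B : X} (t : Chain X A B) (l u : List X) (h : u = l ++ A :: t.mid)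

theorem coindAct_proj : coindAct f p b t l u h ≫ coindProj f p b (B, u) =
    coindProj f p b (A, l) ▷ _ ≫ ((plusModule E).restrict f).act t l u h :=
  coindLift_proj f p b _ _ _

theorem coindAct_eval_none : coindAct f p b t l u h ▷ _ ≫ coindEval f p b B u .none =
    (ρ_ _).hom ≫ coindEval f p b A l (.some t u h) :=
  coindLift_eval f p b _ _ _ _

theorem coindAct_eval_some {C : X} (s : Chain X B C) (x : List X) (h' : x = u ++ B :: s.mid)
    (h'' : x = l ++ A :: (t.concat s).mid) :
    coindAct f p b t l u h ▷ _ ≫ coindEval f p b B u (.some s x h') =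
      (α_ _ _ _).hom ≫ _ ◁ F.lax t s ≫ coindEval f p b A l (.some (t.concat s) x h'') :=
  coindLift_eval f p b _ _ _ _

theorem coindEval_congr {t' : Chain X A B} (ht : t' = t) (h' : u = l ++ A :: t'.mid) :
    coindEval f p b A l (.some t u h) =
      _ ◁ eqToHom (by subst ht; rfl) ≫ coindEval f p b A l (.some t' u h') := by
  subst ht
  simp

end

noncomputable def coindModule : RightModule F (coind f p b) where
  act t l u h := coindAct f p b t l u h
  act_act {A B C} t s l m u h₁ h₂ h := by
    apply coind_hom_ext
    · have h₃ := ((plusModule E).restrict f).act_act t s l m u h₁ h₂ h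
      simp only [Category.assoc, coindAct_proj]
      rw [← comp_whiskerRight_assoc, coindAct_proj, comp_whiskerRight_assoc, h₃,
        associator_naturality_left_assoc, whisker_exchange_assoc]
    · intro q
      cases q with
      | none =>
        rw [comp_whiskerRight, Category.assoc, coindAct_eval_none, rightUnitor_naturality_assoc,
          coindAct_eval_some (h'' := h), comp_whiskerRight, comp_whiskerRight, Category.assoc,
          Category.assoc, coindAct_eval_none, rightUnitor_naturality_assoc,
          rightUnitor_naturality_assoc]
      -- Both sides evaluate at a triple concatenation, bracketed in two ways; `lax_assoc` and the
      -- pentagon compare them.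
      | @some D r x h' =>
        have h₃ : x = m ++ B :: (s.concat r).mid := by rw [h', h₂]; simp [Chain.concat]
        have h₄ : x = l ++ A :: (t.concat (s.concat r)).mid := by
          rw [h₃, h₁]; simp [Chain.concat]
        have h₅ : x = l ++ A :: ((t.concat s).concat r).mid := by
          rw [h', h]; simp [Chain.concat]
        have h₆ := F.lax_assoc t s r
        rw [eqToHom_map] at h₆
        rw [comp_whiskerRight, Category.assoc, coindAct_eval_some (h'' := h₃),
          associator_naturality_left_assoc, ← whisker_exchange_assoc, coindAct_eval_some (h'' := h₄),
          comp_whiskerRight, comp_whiskerRight, Category.assoc,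
          Category.assoc, coindAct_eval_some (h'' := h₅), associator_naturality_middle_assoc,
          coindEval_congr f p b _ l x h₅ (Chain.concat_assoc t s r).symm h₄,
          associator_naturality_right_assoc]
        have h₇ := congrArg (coind f p b (A, l) ◁ ·) h₆
        rw [whiskerLeft_comp, whiskerLeft_comp, whiskerLeft_comp, whiskerLeft_comp] at h₇
        rw [reassoc_of% h₇, pentagon_assoc]

/-- The action on the internal homs in the category of arrows induced by a linear family of
morphisms. -/
noncomputable def RightModule.arrowAction {V W : X × List X → M} (a : RightModule F V)
    (a' : RightModule F W) (p : ∀ i, V i ⟶ W i)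
    (h : ∀ {A B : X} (t : Chain X A B) (l u : List X) (h : u = l ++ A :: t.mid),
      a.act t l u h ≫ p (B, u) = p (A, l) ▷ _ ≫ a'.act t l u h) : Action F (arrowSemi p) where
  act t l u h' := arrowLift p (curry (a.act t l u h')) (curry (a'.act t l u h')) (by
    rw [← curry_natural_right, curry_pre_app, h])
  lax_act t s l m u h₁ h₂ h' := by
    refine arrow_hom_ext ?_ ?_
    · refine (Category.assoc _ _ _).trans (Eq.trans ?_ (Category.assoc _ _ _).symm)
      rw [arrowComp_fst, arrowLift_fst, tensorHom_comp_tensorHom_assoc, arrowLift_fst,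
        arrowLift_fst]
      exact a.toAction.lax_act t s l m u h₁ h₂ h'
    · refine (Category.assoc _ _ _).trans (Eq.trans ?_ (Category.assoc _ _ _).symm)
      rw [arrowComp_snd, arrowLift_snd, tensorHom_comp_tensorHom_assoc, arrowLift_snd,
        arrowLift_snd]
      exact a'.toAction.lax_act t s l m u h₁ h₂ h'

/-- The action of the source on the semicategory of morphisms in the category of arrows between the
projections `coindProj`. -/
noncomputable def coindAction : Action F (arrowSemi (coindProj f p b)) :=
  (coindModule f p b).arrowAction ((plusModule E).restrict f) _ fun t l u h =>
    coindAct_proj f p b t l u h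

theorem coindAction_act_fst {A B : X} (t : Chain X A B) (l u : List X) (h : u = l ++ A :: t.mid) :
    (coindAction f p b).act t l u h ≫ arrowFst _ _ _ = curry (coindAct f p b t l u h) :=
  arrowLift_fst _ _ _ _

theorem coindAction_act_snd {A B : X} (t : Chain X A B) (l u : List X) (h : u = l ++ A :: t.mid) :
    (coindAction f p b).act t l u h ≫ arrowSnd _ _ _ =
      (PreCoSegal.Hom.app f A B).app (op t) ≫ (plusModule E).toAction.act t l u h :=
  (arrowLift_snd _ _ _ _).trans (curry_natural_left _ _)

/-- This is the square to be filled. It commutes because `coindProj` is `F`-linear: on `plus E`, `F`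
acts through `f`. -/
theorem coindAction_commSq :
    CommSq (coindAction f p b).toHom f (endoHom (arrowProj (coindProj f p b)))
      (plusModule E).toAction.toHom where
  w := PreCoSegal.Hom.ext (by
    funext A B
    ext t
    refine endo_hom_ext fun e => ?_
    have h := coindAction_act_snd f p b (B := B) ⟨e.w⟩ e.l e.u e.eq
    have h' := (PreCoSegal.Hom.app f A B).naturality e.del.op
    have h₁ := (coindAction f p b).toHom_app_π e
    have h₂ := endoHom_app_π (arrowProj (coindProj f p b)) e
    have h₃ := (plusModule E).toAction.toHom_app_π e
    calc
      _ = (PreCoSegal.Hom.app (coindAction f p b).toHom A B).app t ≫ endoπ e ≫ _ :=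
        (Category.assoc _ _ _).trans (congrArg _ h₂)
      _ = (F.F A B).map e.del.op ≫ (coindAction f p b).act ⟨e.w⟩ e.l e.u e.eq ≫ _ :=
        (reassoc_of% h₁) _
      _ = _ := (congrArg _ h).trans ((reassoc_of% h') _)
      _ = _ := ((Category.assoc _ _ _).trans (congrArg _ h₃)).symm)

section

variable (a : ∀ i, plus F i ⟶ Y i) (h : ∀ i, a i ≫ p i = plusMap f i ≫ b i)

-- Acting on the generator of a one-letter word returns the acting element, so the claim reduces to
-- the hypothesis `h` at the resulting word.
include h in
omit [SymmetricCategory M] [MonoidalClosed M] [HasProducts.{v} M] [HasPullbacks M] in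
theorem plus_act_nil_comp {A B : X} (t : Chain X A B) (u : List X) (hu : u = [] ++ A :: t.mid) :
    ((plusModule E).restrict f).act t [] u hu ≫ b (B, u) =
      ((plusModule F).act t [] u hu ≫ a (B, u)) ≫ p (B, u) := by
  subst hu
  have e := h (B, A :: t.mid)
  refine Eq.trans ?_ ((congrArg _ e).symm.trans (Category.assoc _ _ _).symm)
  have h₁ := plusModule_act_nil (E := F) t
  have h₂ := plusModule_act_nil (E := E) t
  refine Eq.trans ?_ (congrArg (· ≫ _) h₁).symm
  refine (congrArg (fun k => (_ ◁ _ ≫ k) ≫ _) h₂).trans ?_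
  refine Eq.trans (congrArg (· ≫ _) (leftUnitor_naturality _)) (Category.assoc _ _ _)

/-- The unit element of the module `coind`. -/
noncomputable def coindOne (A : X) : 𝟙_ M ⟶ coind f p b (A, []) :=
  coindLift f p b (𝟙 _)
    (fun
      | .none => (ρ_ _).hom ≫ a (A, [])
      | .some (B := B) t u h => (plusModule F).act t [] u h ≫ a (B, u))
    (fun q => by
      cases q with
      | none =>
        have e : a (A, []) ≫ p (A, []) = b (A, []) := (h (A, [])).trans (Category.id_comp _)
        refine Eq.trans ?_ ((congrArg _ e).symm.trans (Category.assoc _ _ _).symm)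
        exact (congrArg (· ≫ _) (id_whiskerRight _ _)).trans (Category.id_comp _)
      | some t u hu =>
        exact Eq.trans ((congrArg (· ≫ _) (id_whiskerRight _ _)).trans (Category.id_comp _))
          (plus_act_nil_comp f p b a h t u hu))

theorem coindOne_proj (A : X) : coindOne f p b a h A ≫ coindProj f p b (A, []) = 𝟙 _ :=
  coindLift_proj f p b _ _ _

theorem coindOne_eval_some {A B : X} (t : Chain X A B) (u : List X) (hu : u = [] ++ A :: t.mid) :
    coindOne f p b a h A ▷ _ ≫ coindEval f p b A [] (.some t u hu) =
      (plusModule F).act t [] u hu ≫ a (B, u) :=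
  coindLift_eval f p b _ _ _ _

end

section

variable (R : MorphismProperty M) [R.IsStableUnderBaseChange]
  [∀ T : Type v, R.IsStableUnderProductsOfShape T]
  (hR : ∀ (K : M) {Y Z : M} (g : Y ⟶ Z), R g → R ((ihom K).map g))

include hR

/-- `coindProj` is a base change of a product of maps `(ihom K).map (p j)`. -/
theorem coindProj_mem (hp : ∀ i, R (p i)) (i : X × List X) : R (coindProj f p b i) :=
  R.pullback_fst _ _ (MorphismProperty.limMap _ fun _ => hR _ _ (hp _))

-- At each chain the map is a product, over extensions, of base changes of maps `(ihom (V i)).map (p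
-- j)`.
omit [SymmetricCategory M] in
theorem endoHom_arrowProj_mem {V W : X × List X → M} (p : ∀ i, V i ⟶ W i) (hp : ∀ i, R (p i))
    (A B : X) (t : Chain X A B) :
    R ((PreCoSegal.Hom.app (endoHom (arrowProj p)) A B).app (op t)) := by
  have h : (PreCoSegal.Hom.app (endoHom (arrowProj p)) A B).app (op t) =
      Limits.Pi.map fun e : Extension t => arrowSnd p (A, e.l) (B, e.u) :=
    Pi.hom_ext _ _ fun e => (endoHom_app_π _ e).trans
      (Pi.map_π (fun e : Extension t => arrowSnd p (A, e.l) (B, e.u)) e).symm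
  rw [h]
  exact MorphismProperty.limMap _ fun _ => R.pullback_snd _ _ (hR _ _ (hp _))

/-- The extension of the action of the source to an action of the target. -/
theorem exists_lift_of_hasLiftingProperty
    (hf : ∀ {G H : PreCoSegal M X} (g : G ⟶ H),
      (∀ (A B : X) (t : Chain X A B), R ((PreCoSegal.Hom.app g A B).app (op t))) →
        HasLiftingProperty f g)
    (hp : ∀ i, R (p i)) (a : ∀ i, plus F i ⟶ Y i) (h : ∀ i, a i ≫ p i = plusMap f i ≫ b i)
    (A B : X) (t : Chain X A B) :
    ∃ c : (E.F A B).obj (op t) ⟶ Y (B, A :: t.mid),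
      (PreCoSegal.Hom.app f A B).app (op t) ≫ c = a (B, A :: t.mid) ∧
      c ≫ p (B, A :: t.mid) = b (B, A :: t.mid) := by
  have sq := coindAction_commSq f p b
  have := hf (endoHom (arrowProj (coindProj f p b)))
    (endoHom_arrowProj_mem R hR _ (coindProj_mem f p b R hR hp))
  let φ := sq.lift
  -- The extension of the one-letter word `A` by `t` itself, with nothing deleted: its component
  -- recovers the action of `E` at `t` on that word.
  let e : Extension t := ⟨[], A :: t.mid, t.mid, rfl, 𝟙 t⟩
  let c₀ : (E.F A B).obj (op t) ⟶ arrowHom (coindProj f p b) (A, []) (B, A :: t.mid) :=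
    (PreCoSegal.Hom.app φ A B).app (op t) ≫ endoπ (S := arrowSemi (coindProj f p b)) e
  have h₁ : (PreCoSegal.Hom.app f A B).app (op t) ≫ c₀ =
      (coindAction f p b).act t [] (A :: t.mid) rfl := by
    have h₅ : (PreCoSegal.Hom.app f A B).app (op t) ≫ (PreCoSegal.Hom.app φ A B).app (op t) =
        (PreCoSegal.Hom.app (coindAction f p b).toHom A B).app (op t) :=
      congrArg (fun k => (PreCoSegal.Hom.app k A B).app (op t)) sq.fac_left
    refine ((reassoc_of% h₅) _).trans (((coindAction f p b).toHom_app_π e).trans ?_)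
    exact (congrArg (· ≫ _) ((F.F A B).map_id (op t))).trans (Category.id_comp _)
  have h₂ : c₀ ≫ arrowSnd _ _ _ = curry ((plusModule E).act t [] (A :: t.mid) rfl) := by
    have h₅ : (PreCoSegal.Hom.app φ A B).app (op t) ≫
        (PreCoSegal.Hom.app (endoHom (arrowProj (coindProj f p b))) A B).app (op t) =
          (PreCoSegal.Hom.app (plusModule E).toAction.toHom A B).app (op t) :=
      congrArg (fun k => (PreCoSegal.Hom.app k A B).app (op t)) sq.fac_right
    have h₆ := endoHom_app_π (arrowProj (coindProj f p b)) e
    refine (Category.assoc _ _ _).trans ((congrArg _ h₆).symm.trans ?_)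
    refine ((reassoc_of% h₅) _).trans (((plusModule E).toAction.toHom_app_π e).trans ?_)
    exact (congrArg (· ≫ _) ((E.F A B).map_id (op t))).trans (Category.id_comp _)
  -- The extended action `coind (A, []) ⊗ E(t) ⟶ coind (B, A :: t.mid)`: it restricts to the action
  -- of `F` (`h₃`) and makes `coindProj` linear (`h₄`).
  let c₁ := uncurry (c₀ ≫ arrowFst _ _ _)
  have h₃ : _ ◁ (PreCoSegal.Hom.app f A B).app (op t) ≫ c₁ =
      coindAct f p b t [] (A :: t.mid) rfl := by
    rw [← uncurry_natural_left, reassoc_of% h₁, coindAction_act_fst, uncurry_curry]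
  have h₄ : c₁ ≫ coindProj f p b (B, A :: t.mid) = coindProj f p b (A, []) ▷ _ ≫
      (plusModule E).act t [] (A :: t.mid) rfl := by
    rw [← uncurry_natural_right, Category.assoc, arrow_condition, reassoc_of% h₂, curry_pre_app,
      uncurry_curry]
  have h₅ := coindAct_eval_none f p b t [] (A :: t.mid) rfl
  have h₆ := coindOne_eval_some f p b a h t (A :: t.mid) rfl
  have h₇ := coind_condition f p b B (A :: t.mid) .none
  have h₈ := coindOne_proj f p b a h A
  rw [plusModule_act_nil] at h₆
  -- In elements, `c y` evaluates `1 · y` at the empty completion. For `y` in the image of `F` this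
  -- is the evaluation of `1` at a preimage, which is given by `a`; its image in `Z` is `b` of the
  -- projection of `1 · y`, that is `b y`.
  refine ⟨(λ_ _).inv ≫ coindOne f p b a h A ▷ _ ≫ c₁ ≫ (ρ_ _).inv ≫
    coindEval f p b B (A :: t.mid) .none, ?_, ?_⟩
  · rw [leftUnitor_inv_naturality_assoc, whisker_exchange_assoc, reassoc_of% h₃,
      rightUnitor_inv_naturality_assoc, h₅, Iso.inv_hom_id_assoc, h₆]
    exact Iso.inv_hom_id_assoc _ _
  · dsimp only [baseEval] at h₇
    rw [Category.assoc, Category.assoc, Category.assoc, Category.assoc, ← h₇,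
      rightUnitor_naturality_assoc, Iso.inv_hom_id_assoc, reassoc_of% h₄,
      ← comp_whiskerRight_assoc, h₈]
    refine (congrArg (fun k => (λ_ _).inv ≫ k ≫ (plusModule E).act t [] (A :: t.mid) rfl ≫ b _)
      (id_whiskerRight _ _)).trans ((congrArg _ (Category.id_comp _)).trans ?_)
    exact (congrArg (fun k => (λ_ _).inv ≫ k ≫ b _) (plusModule_act_nil t)).trans
      (Iso.inv_hom_id_assoc _ _)

/-- The values of a morphism with the left lifting property with respect to all morphisms which
are levelwise in `R` have the left lifting property with respect to `R`. -/
theorem app_mem_llp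
    (hf : ∀ {G H : PreCoSegal M X} (g : G ⟶ H),
      (∀ (A B : X) (t : Chain X A B), R ((PreCoSegal.Hom.app g A B).app (op t))) →
        HasLiftingProperty f g)
    (A B : X) (t : Chain X A B) : R.llp ((PreCoSegal.Hom.app f A B).app (op t)) := by
  intro y z q hq
  refine ⟨fun {a₀ b₀} sq => ?_⟩
  let i₀ : X × List X := (B, A :: t.mid)
  -- The families are `y` and `z` at `i₀` and terminal (empty products) elsewhere, so the lifting
  -- problem of families is the given one. The lifts of propositions put the index types in `Type
  -- v`.
  let a (i : X × List X) : plus F i ⟶ ∏ᶜ fun _ : ULift.{v} (PLift (i = i₀)) => y :=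
    Pi.lift fun h => eqToHom (congrArg (plus F) h.down.down) ≫ a₀
  let b (i : X × List X) : plus E i ⟶ ∏ᶜ fun _ : ULift.{v} (PLift (i = i₀)) => z :=
    Pi.lift fun h => eqToHom (congrArg (plus E) h.down.down) ≫ b₀
  let p (i : X × List X) : (∏ᶜ fun _ : ULift.{v} (PLift (i = i₀)) => y) ⟶
      ∏ᶜ fun _ : ULift.{v} (PLift (i = i₀)) => z := Limits.Pi.map fun _ => q
  obtain ⟨c, hc₁, hc₂⟩ := exists_lift_of_hasLiftingProperty f p b R hR hf
    (fun i => MorphismProperty.limMap _ fun _ => hq) a (fun i => by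
      refine Pi.hom_ext _ _ fun h => ?_
      obtain ⟨⟨rfl⟩⟩ := h
      dsimp only [a, b, p]
      rw [Category.assoc, Category.assoc, Pi.map_π, Pi.lift_π_assoc, Pi.lift_π, eqToHom_refl,
        eqToHom_refl]
      exact (congrArg (· ≫ q) (Category.id_comp a₀)).trans
        (sq.w.trans (congrArg _ (Category.id_comp b₀).symm))) A B t
  refine ⟨⟨⟨c ≫ Pi.π _ ⟨⟨rfl⟩⟩, ?_, ?_⟩⟩⟩
  · refine ((reassoc_of% hc₁) _).trans ((Pi.lift_π _ _).trans ?_)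
    exact Category.id_comp _
  · have := congrArg (· ≫ Pi.π _ ⟨⟨rfl⟩⟩) hc₂
    dsimp only [b, p] at this
    rw [Category.assoc, Pi.map_π] at this
    exact (Category.assoc _ _ _).trans (this.trans ((Pi.lift_π _ _).trans (Category.id_comp _)))

end

end

end

/-! ### Sifted colimits of pre-Co-Segal categories are levelwise -/

section

attribute [-instance] CategoryTheory.catToReflQuiver

section

open WalkingReflexivePair WalkingReflexivePair.Hom

theorem hom_zero_zero (f : Hom zero zero) : f = 𝟙 zero := by
  cases f
  rfl

theorem hom_one_zero (f : Hom one zero) : f = left ∨ f = right := by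
  cases f
  exacts [Or.inl rfl, Or.inr rfl]

/-- The object of the category of structured arrows to the diagonal given by two morphisms. -/
abbrev diagArrow {C : Type*} [Category* C] {x y z : C} (f : x ⟶ z) (g : y ⟶ z) :
    StructuredArrow (x, y) (Functor.diag C) :=
  StructuredArrow.mk (Y := z) (Prod.mkHom f g)

def diagArrowHom {C : Type*} [Category* C] {x y z z' : C} (f : x ⟶ z) (g : y ⟶ z) {f' : x ⟶ z'}
    {g' : y ⟶ z'} (h : z ⟶ z') (hf : f ≫ h = f') (hg : g ≫ h = g') :
    diagArrow f g ⟶ diagArrow f' g' :=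
  StructuredArrow.homMk h (Prod.ext hf hg)

/-- The pairs with first leg `left` and `right` are both images of `(𝟙, g ≫ reflexion)`, under
`left` and `right`, because `reflexion` is a common section of the two. -/
theorem zigzag_diagArrow_left {x y : WalkingReflexivePair} (f f' : x ⟶ zero) (g : y ⟶ zero) :
    Zigzag (diagArrow f g) (diagArrow f' g) := by
  have key : Zigzag (diagArrow (x := one) (z := zero) left g) (diagArrow right g) := by
    refine Zigzag.trans (j₂ := diagArrow (𝟙 one) (g ≫ reflexion))
      (Zigzag.of_inv (diagArrowHom _ _ left ?_ ?_)) (Zigzag.of_hom (diagArrowHom _ _ right ?_ ?_))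
    all_goals simp
  cases x with
  | zero => rw [hom_zero_zero f, hom_zero_zero f']
  | one =>
    obtain rfl | rfl := hom_one_zero f <;> obtain rfl | rfl := hom_one_zero f'
    exacts [.refl _, key, key.symm, .refl _]

theorem zigzag_diagArrow_right {x y : WalkingReflexivePair} (f : x ⟶ zero) (g g' : y ⟶ zero) :
    Zigzag (diagArrow f g) (diagArrow f g') := by
  have key : Zigzag (diagArrow (y := one) (z := zero) f left) (diagArrow f right) := by
    refine Zigzag.trans (j₂ := diagArrow (f ≫ reflexion) (𝟙 one))
      (Zigzag.of_inv (diagArrowHom _ _ left ?_ ?_)) (Zigzag.of_hom (diagArrowHom _ _ right ?_ ?_))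
    all_goals simp
  cases y with
  | zero => rw [hom_zero_zero g, hom_zero_zero g']
  | one =>
    obtain rfl | rfl := hom_one_zero g <;> obtain rfl | rfl := hom_one_zero g'
    exacts [.refl _, key, key.symm, .refl _]

/-- Every object maps to `zero`, and the two zigzag lemmas connect all pairs of maps to `zero`. This
brings reflexive coequalizers, needed for monadicity, under the sifted colimits below. -/
instance isSifted_walkingReflexivePair : IsSifted WalkingReflexivePair where
  out := by
    rintro ⟨x, y⟩
    have toZero (x : WalkingReflexivePair) : Nonempty (x ⟶ zero) := by
      cases x
      exacts [⟨𝟙 _⟩, ⟨left⟩]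
    obtain ⟨f⟩ := toZero x
    obtain ⟨g⟩ := toZero y
    have : Nonempty (StructuredArrow (x, y) (Functor.diag WalkingReflexivePair)) :=
      ⟨diagArrow f g⟩
    have key (u : StructuredArrow (x, y) (Functor.diag WalkingReflexivePair)) :
        Zigzag u (diagArrow f g) := by
      obtain ⟨⟨⟨⟩⟩, z, k⟩ := u
      obtain ⟨h⟩ := toZero z
      exact ((Zigzag.of_hom (diagArrowHom k.1 k.2 h rfl rfl)).trans
        (zigzag_diagArrow_left _ f _)).trans (zigzag_diagArrow_right _ _ g)
    exact zigzag_isConnected fun u v => (key u).trans (key v).symm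

end

section

variable {M : Type u} [Category.{v} M] [MonoidalCategory M] {X : Type w}

/-- The component of a pre-Co-Segal category, as a functor. -/
def compAt (A B : X) : PreCoSegal M X ⥤ (Chain X A B)ᵒᵖ ⥤ M where
  obj F := F.F A B
  map σ := PreCoSegal.Hom.app σ A B

/-- The evaluation at a chain. -/
abbrev evAt {A B : X} (t : Chain X A B) : PreCoSegal M X ⥤ M :=
  compAt A B ⋙ (evaluation _ _).obj (op t)

variable {J : Type*} [Category* J] [HasColimitsOfShape J M]
  (G : J ⥤ PreCoSegal M X)

noncomputable def colimEvAt {A B : X} (t : Chain X A B) : Cocone (G ⋙ evAt t) :=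
  ((evaluation _ _).obj (op t)).mapCocone (colimit.cocone (G ⋙ compAt A B))

noncomputable def isColimitColimEvAt {A B : X} (t : Chain X A B) : IsColimit (colimEvAt G t) :=
  isColimitOfPreserves _ (colimit.isColimit _)

noncomputable def colimι (j : J) {A B : X} (t : Chain X A B) :
    ((G.obj j).F A B).obj (op t) ⟶ (colimit (G ⋙ compAt A B)).obj (op t) :=
  (colimit.ι (G ⋙ compAt A B) j).app (op t)

theorem colimι_naturality (j : J) {A B : X} {t t' : Chain X A B} (d : op t' ⟶ op t) :
    ((G.obj j).F A B).map d ≫ colimι G j t =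
      colimι G j t' ≫ (colimit (G ⋙ compAt A B)).map d :=
  (colimit.ι (G ⋙ compAt A B) j).naturality d

theorem map_colimι {i j : J} (f : i ⟶ j) {A B : X} (t : Chain X A B) :
    (PreCoSegal.Hom.app (G.map f) A B).app (op t) ≫ colimι G j t = colimι G i t :=
  congrArg (fun k => k.app (op t)) (colimit.w (G ⋙ compAt A B) f)

variable {G} in
noncomputable def colimDesc (c : Cocone G) (A B : X) :
    colimit (G ⋙ compAt A B) ⟶ c.pt.F A B :=
  colimit.desc (G ⋙ compAt A B) ((compAt A B).mapCocone c)

theorem colimι_desc (j : J) {A B : X} (t : Chain X A B) (c : Cocone G) :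
    colimι G j t ≫ (colimDesc c A B).app (op t) =
      (PreCoSegal.Hom.app (c.ι.app j) A B).app (op t) :=
  congrArg (fun k => k.app (op t)) (colimit.ι_desc ((compAt A B).mapCocone c) j)

variable [IsSifted J] [∀ A : M, PreservesColimitsOfShape J (tensorLeft A)]
  [∀ A : M, PreservesColimitsOfShape J (tensorRight A)]

instance preservesColimit₂_curriedTensor (F₁ F₂ : J ⥤ M) :
    PreservesColimit₂ F₁ F₂ (curriedTensor M) := by
  have (A : M) : PreservesColimitsOfShape J ((curriedTensor M).obj A) :=
    inferInstanceAs (PreservesColimitsOfShape J (tensorLeft A))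
  have (A : M) : PreservesColimitsOfShape J ((curriedTensor M).flip.obj A) :=
    inferInstanceAs (PreservesColimitsOfShape J (tensorRight A))
  infer_instance

/-- Over a sifted `J`, the tensor product of two colimits is the colimit of the diagonal diagram, so
the laxity maps of the `G.obj j` induce one on the colimit. -/
noncomputable def colimLax {A B C : X} (t : Chain X A B) (s : Chain X B C) :
    (colimit (G ⋙ compAt A B)).obj (op t) ⊗ (colimit (G ⋙ compAt B C)).obj (op s) ⟶
      (colimit (G ⋙ compAt A C)).obj (op (t.concat s)) :=
  ((isColimitColimEvAt G t).tensor (isColimitColimEvAt G s)).desc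
    { pt := (colimit (G ⋙ compAt A C)).obj (op (t.concat s))
      ι := 
        { app j := (G.obj j).lax t s ≫ colimι G j (t.concat s)
          naturality i j f := by
            have h₁ := (G.map f).lax_comm t s
            have h₂ := map_colimι G f (t.concat s)
            exact ((reassoc_of% h₁) _).symm.trans ((congrArg _ h₂).trans
              (Category.comp_id _).symm) } }

theorem ι_colimLax (j : J) {A B C : X} (t : Chain X A B) (s : Chain X B C) :
    (colimι G j t ⊗ₘ colimι G j s) ≫
      colimLax G t s = (G.obj j).lax t s ≫ colimι G j (t.concat s) :=
  ((isColimitColimEvAt G t).tensor (isColimitColimEvAt G s)).fac _ j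

theorem tensor_hom_ext {A B C D : X} {t : Chain X A B} {s : Chain X C D} {T : M}
    {f g : (colimit (G ⋙ compAt A B)).obj (op t) ⊗ (colimit (G ⋙ compAt C D)).obj (op s) ⟶ T}
    (h : ∀ j, (colimι G j t ⊗ₘ
        colimι G j s) ≫ f =
      (colimι G j t ⊗ₘ
        colimι G j s) ≫ g) : f = g :=
  ((isColimitColimEvAt G t).tensor (isColimitColimEvAt G s)).hom_ext h

theorem tensor₃_hom_ext {A B C D E F : X} {t : Chain X A B} {s : Chain X C D} {r : Chain X E F}
    {T : M} {f g : ((colimit (G ⋙ compAt A B)).obj (op t) ⊗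
      (colimit (G ⋙ compAt C D)).obj (op s)) ⊗ (colimit (G ⋙ compAt E F)).obj (op r) ⟶ T}
    (h : ∀ j, ((colimι G j t ⊗ₘ
        colimι G j s) ⊗ₘ
          colimι G j r) ≫ f =
      ((colimι G j t ⊗ₘ
        colimι G j s) ⊗ₘ
          colimι G j r) ≫ g) : f = g :=
  (((isColimitColimEvAt G t).tensor (isColimitColimEvAt G s)).tensor
    (isColimitColimEvAt G r)).hom_ext h

/-- The levelwise colimit of a diagram of pre-Co-Segal categories indexed by a sifted category. -/
noncomputable def siftedColimit : PreCoSegal M X where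
  F A B := colimit (G ⋙ compAt A B)
  lax t s := colimLax G t s
  lax_natural {A B C t t' s s'} d e := by
    refine tensor_hom_ext G fun j => ?_
    have h₁ := (G.obj j).lax_natural d e
    rw [tensorHom_comp_tensorHom_assoc, ← colimι_naturality, ← colimι_naturality,
      ← tensorHom_comp_tensorHom_assoc, ι_colimLax, reassoc_of% ι_colimLax, ← colimι_naturality,
      reassoc_of% h₁]
  lax_assoc {A B C D} t s r := by
    refine tensor₃_hom_ext G fun j => ?_
    have h₁ := (G.obj j).lax_assoc t s r
    rw [tensorHom_comp_whiskerRight_assoc, ι_colimLax, ← whiskerRight_comp_tensorHom_assoc,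
      reassoc_of% ι_colimLax, ← colimι_naturality, reassoc_of% h₁, associator_naturality_assoc,
      tensorHom_comp_whiskerLeft_assoc, ι_colimLax, ← whiskerLeft_comp_tensorHom_assoc,
      ι_colimLax]

noncomputable def siftedCocone : Cocone G where
  pt := siftedColimit G
  ι :=
    { app j :=
        { app A B := colimit.ι (G ⋙ compAt A B) j
          lax_comm t s := (ι_colimLax G j t s).symm }
      naturality i j f := PreCoSegal.Hom.ext (by
        funext A B
        exact (colimit.w (G ⋙ compAt A B) f).trans (Category.comp_id _).symm) }

noncomputable def isColimitSiftedCocone : IsColimit (siftedCocone G) where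
  desc c :=
    { app := colimDesc c
      lax_comm {A B C} t s := by
        refine tensor_hom_ext G fun j => ?_
        have h₁ := (c.ι.app j).lax_comm t s
        dsimp only [siftedCocone, siftedColimit]
        rw [tensorHom_comp_tensorHom_assoc, reassoc_of% ι_colimLax, colimι_desc, colimι_desc,
          colimι_desc]
        exact h₁ }
  fac c j := PreCoSegal.Hom.ext (by
    funext A B
    exact colimit.ι_desc ((compAt A B).mapCocone c) j)
  uniq c m h := PreCoSegal.Hom.ext (by
    funext A B
    refine colimit.hom_ext fun j => ?_
    refine Eq.trans ?_ (colimit.ι_desc ((compAt A B).mapCocone c) j).symm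
    exact congrArg (fun k => PreCoSegal.Hom.app k A B) (h j))

include G in
theorem hasColimit_of_isSifted : HasColimit G :=
  ⟨⟨siftedCocone G, isColimitSiftedCocone G⟩⟩

instance hasColimitsOfShape_of_isSifted : HasColimitsOfShape J (PreCoSegal M X) :=
  ⟨fun G => hasColimit_of_isSifted G⟩

instance preservesColimitsOfShape_compAt (A B : X) :
    PreservesColimitsOfShape J (compAt (M := M) A B) where
  preservesColimit {G} := preservesColimit_of_preserves_colimit_cocone (isColimitSiftedCocone G)
    (IsColimit.ofIsoColimit (colimit.isColimit (G ⋙ compAt A B))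
      (Cocone.ext (Iso.refl _) fun _ => Category.comp_id _))

instance preservesColimitsOfShape_evAt {A B : X} (t : Chain X A B) :
    PreservesColimitsOfShape J (evAt (M := M) t) :=
  inferInstance

end

/-! ### Colimits in categories of families -/

section

variable {I : Type*} {C : I → Type*} [∀ i, Category* (C i)] {J : Type*} [Category* J]

def isColimitOfEval {F : J ⥤ ∀ i, C i} {c : Cocone F}
    (h : ∀ i, IsColimit ((Pi.eval C i).mapCocone c)) : IsColimit c where
  desc s i := (h i).desc ((Pi.eval C i).mapCocone s)
  fac s j := by
    funext i
    exact (h i).fac ((Pi.eval C i).mapCocone s) j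
  uniq s m w := by
    funext i
    exact (h i).uniq ((Pi.eval C i).mapCocone s) (m i) fun j => congrFun (w j) i

theorem preservesColimitsOfShape_of_eval {E : Type*} [Category* E] (G : E ⥤ ∀ i, C i)
    (h : ∀ i, PreservesColimitsOfShape J (G ⋙ Pi.eval C i)) : PreservesColimitsOfShape J G where
  preservesColimit := ⟨fun hc => ⟨isColimitOfEval fun i =>
    isColimitOfPreserves (G ⋙ Pi.eval C i) hc⟩⟩

variable [∀ i, HasColimitsOfShape J (C i)]

noncomputable def piColimitCocone (F : J ⥤ ∀ i, C i) : Cocone F where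
  pt i := colimit (F ⋙ Pi.eval C i)
  ι :=
    { app j i := colimit.ι (F ⋙ Pi.eval C i) j
      naturality j j' f := by
        funext i
        exact (colimit.cocone (F ⋙ Pi.eval C i)).ι.naturality f }

noncomputable def isColimitPiColimitCocone (F : J ⥤ ∀ i, C i) : IsColimit (piColimitCocone F) :=
  isColimitOfEval fun i =>
    IsColimit.ofIsoColimit (colimit.isColimit (F ⋙ Pi.eval C i))
      (Cocone.ext (Iso.refl _) fun _ => Category.comp_id _)

instance hasColimitsOfShape_pi : HasColimitsOfShape J (∀ i, C i) :=
  ⟨fun F => ⟨⟨piColimitCocone F, isColimitPiColimitCocone F⟩⟩⟩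

instance preservesColimitsOfShape_eval (i : I) : PreservesColimitsOfShape J (Pi.eval C i) where
  preservesColimit {F} := preservesColimit_of_preserves_colimit_cocone (isColimitPiColimitCocone F)
    (IsColimit.ofIsoColimit (colimit.isColimit (F ⋙ Pi.eval C i))
      (Cocone.ext (Iso.refl _) fun _ => Category.comp_id _))

end

section

variable {I : Type*} {C : I → Type*} [∀ i, Category* (C i)] {J : Type*} [Category* J]

def isLimitOfEval {F : J ⥤ ∀ i, C i} {c : Cone F}
    (h : ∀ i, IsLimit ((Pi.eval C i).mapCone c)) : IsLimit c where
  lift s i := (h i).lift ((Pi.eval C i).mapCone s)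
  fac s j := by
    funext i
    exact (h i).fac ((Pi.eval C i).mapCone s) j
  uniq s m w := by
    funext i
    exact (h i).uniq ((Pi.eval C i).mapCone s) (m i) fun j => congrFun (w j) i

variable [∀ i, HasLimitsOfShape J (C i)]

noncomputable def piLimitCone (F : J ⥤ ∀ i, C i) : Cone F where
  pt i := limit (F ⋙ Pi.eval C i)
  π :=
    { app j i := limit.π (F ⋙ Pi.eval C i) j
      naturality j j' f := by
        funext i
        exact (limit.cone (F ⋙ Pi.eval C i)).π.naturality f }

instance hasLimitsOfShape_pi : HasLimitsOfShape J (∀ i, C i) :=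
  ⟨fun F => ⟨⟨piLimitCone F, isLimitOfEval fun i =>
    IsLimit.ofIsoLimit (limit.isLimit (F ⋙ Pi.eval C i))
      (Cone.ext (Iso.refl _) fun _ => (Category.id_comp _).symm)⟩⟩⟩

end

section

variable {I : Type*} {C : I → Type*} [∀ i, Category* (C i)]

theorem isIso_of_isIso_apply {x y : ∀ i, C i} (f : x ⟶ y) (h : ∀ i, IsIso (f i)) : IsIso f :=
  ⟨fun i => inv (f i), by
    funext i
    exact IsIso.hom_inv_id (f i), by
    funext i
    exact IsIso.inv_hom_id (f i)⟩

theorem isIso_apply {x y : ∀ i, C i} (f : x ⟶ y) [IsIso f] (i : I) : IsIso (f i) :=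
  inferInstanceAs (IsIso ((Pi.eval C i).map f))

end

end

/-! ### Free pre-Co-Segal categories -/

section

attribute [-instance] CategoryTheory.catToReflQuiver

section

variable {M : Type u} [Category.{v} M] [MonoidalCategory M] [SymmetricCategory M]
  [MonoidalClosed M] [HasColimitsOfSize.{v, v} M] {I J K : Type v} {a : I → M} {b : J → M}
  {c : K → M} {T : M}

/-- Currying in either variable, by closedness and symmetry, reduces maps out of a tensor product of
coproducts to families. -/
noncomputable def tensorSigmaDesc (g : ∀ i j, a i ⊗ b j ⟶ T) : (∐ a) ⊗ (∐ b) ⟶ T :=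
  uncurryRight (Sigma.desc fun i => curryRight
    (MonoidalClosed.uncurry (Sigma.desc fun j => MonoidalClosed.curry (g i j))))

omit [HasColimitsOfSize.{v, v} M] in
theorem whiskerRight_uncurryRight {S S' K T : M} (d : S' ⟶ S) (g : S ⟶ (ihom K).obj T) :
    d ▷ K ≫ uncurryRight g = uncurryRight (d ≫ g) :=
  curryRight_injective (by
    rw [← curryRight_natural_left, curryRight_uncurryRight, curryRight_uncurryRight])

omit [HasColimitsOfSize.{v, v} M] in
theorem uncurryRight_curryRight {S K T : M} (g : S ⊗ K ⟶ T) : uncurryRight (curryRight g) = g :=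
  curryRight_injective (curryRight_uncurryRight _)

theorem ι_tensorSigmaDesc (g : ∀ i j, a i ⊗ b j ⟶ T) (i : I) (j : J) :
    (Sigma.ι a i ⊗ₘ Sigma.ι b j) ≫ tensorSigmaDesc g = g i j := by
  rw [tensorSigmaDesc, tensorHom_def', Category.assoc, whiskerRight_uncurryRight, Sigma.ι_desc,
    uncurryRight_curryRight, ← MonoidalClosed.uncurry_natural_left, Sigma.ι_desc,
    MonoidalClosed.uncurry_curry]

theorem sigma_tensor_hom_ext {S : M} {f g : (∐ a) ⊗ S ⟶ T}
    (h : ∀ i, Sigma.ι a i ▷ S ≫ f = Sigma.ι a i ▷ S ≫ g) : f = g :=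
  curryRight_injective (Sigma.hom_ext _ _ fun i => by
    rw [curryRight_natural_left, curryRight_natural_left, h])

omit [SymmetricCategory M] in
theorem tensor_sigma_hom_ext {S : M} {f g : S ⊗ (∐ a) ⟶ T}
    (h : ∀ i, S ◁ Sigma.ι a i ≫ f = S ◁ Sigma.ι a i ≫ g) : f = g :=
  MonoidalClosed.curry_injective (Sigma.hom_ext _ _ fun i => by
    rw [← MonoidalClosed.curry_natural_left, ← MonoidalClosed.curry_natural_left, h])

theorem tensorSigma_hom_ext {f g : (∐ a) ⊗ (∐ b) ⟶ T}
    (h : ∀ i j, (Sigma.ι a i ⊗ₘ Sigma.ι b j) ≫ f = (Sigma.ι a i ⊗ₘ Sigma.ι b j) ≫ g) : f = g :=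
  sigma_tensor_hom_ext fun i => tensor_sigma_hom_ext fun j => by
    rw [← tensorHom_def'_assoc, ← tensorHom_def'_assoc, h]

theorem tensorSigma₃_hom_ext {f g : ((∐ a) ⊗ (∐ b)) ⊗ (∐ c) ⟶ T}
    (h : ∀ i j k, ((Sigma.ι a i ⊗ₘ Sigma.ι b j) ⊗ₘ Sigma.ι c k) ≫ f =
      ((Sigma.ι a i ⊗ₘ Sigma.ι b j) ⊗ₘ Sigma.ι c k) ≫ g) : f = g :=
  tensor_sigma_hom_ext fun k => curryRight_injective (tensorSigma_hom_ext fun i j => by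
    rw [curryRight_natural_left, curryRight_natural_left, ← tensorHom_def_assoc,
      ← tensorHom_def_assoc, h])

end

/-- Nonempty composable sequences of chains. -/
inductive Bead (X : Type v) : X → X → Type v
  | single {A B : X} (t : Chain X A B) : Bead X A B
  | cons {A B C : X} (t : Chain X A B) (p : Bead X B C) : Bead X A C

namespace Bead

variable {X : Type v}

/-- The concatenation of the chains in the sequence. -/
def total : {A B : X} → Bead X A B → Chain X A B
  | _, _, single t => t
  | _, _, cons t p => t.concat p.total

def append {C : X} : {A B : X} → Bead X A B → Bead X B C → Bead X A C
  | _, _, single t, q => cons t q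
  | _, _, cons t p, q => cons t (p.append q)

theorem total_append {C : X} : {A B : X} → (p : Bead X A B) → (q : Bead X B C) →
    (p.append q).total = p.total.concat q.total
  | _, _, single t, q => rfl
  | _, _, cons t p, q => by
    rw [append, total, total_append p q, total, Chain.concat_assoc]

theorem append_assoc {C D : X} (r : Bead X C D) : {A B : X} → (p : Bead X A B) →
    (q : Bead X B C) → (p.append q).append r = p.append (q.append r)
  | _, _, single t, q => rfl
  | _, _, cons t p, q => by
    rw [append, append, append_assoc r p q, append]

variable {M : Type u} [Category.{v} M] [MonoidalCategory M]
  (Y : (Σ p : X × X, Chain X p.1 p.2) → M)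

/-- The tensor product of the values of `Y` at the chains in the sequence. -/
def val : {A B : X} → Bead X A B → M
  | _, _, single t => Y ⟨(_, _), t⟩
  | _, _, cons t p => Y ⟨(_, _), t⟩ ⊗ p.val

def appendMap {C : X} : {A B : X} → (p : Bead X A B) → (q : Bead X B C) →
    (p.val Y ⊗ q.val Y ⟶ (p.append q).val Y)
  | _, _, single _, _ => 𝟙 _
  | _, _, cons _ p, q => (α_ _ _ _).hom ≫ _ ◁ p.appendMap q

theorem appendMap_assoc {C D : X} (r : Bead X C D) : {A B : X} → (p : Bead X A B) →
    (q : Bead X B C) → (h : ((p.append q).append r).val Y = (p.append (q.append r)).val Y) →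
    p.appendMap Y q ▷ _ ≫ (p.append q).appendMap Y r ≫ eqToHom h =
      (α_ _ _ _).hom ≫ _ ◁ q.appendMap Y r ≫ p.appendMap Y (q.append r)
  | _, _, single t, q, h => by
    change 𝟙 _ ▷ _ ≫ ((α_ _ _ _).hom ≫ _ ◁ q.appendMap Y r) ≫ 𝟙 _ = _ ≫ _ ≫ 𝟙 _
    rw [id_whiskerRight, Category.id_comp, Category.comp_id, Category.comp_id]
  | _, _, cons t p, q, h => by
    have h' : ((p.append q).append r).val Y = (p.append (q.append r)).val Y := by
      rw [append_assoc]
    have ih := appendMap_assoc r p q h'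
    change ((α_ _ _ _).hom ≫ _ ◁ p.appendMap Y q) ▷ _ ≫ ((α_ _ _ _).hom ≫
        _ ◁ (p.append q).appendMap Y r) ≫ eqToHom (congrArg (Y ⟨(_, _), t⟩ ⊗ ·) h') =
      (α_ _ _ _).hom ≫ _ ◁ q.appendMap Y r ≫ ((α_ _ _ _).hom ≫ _ ◁ p.appendMap Y (q.append r))
    rw [← whiskerLeft_eqToHom _ h', comp_whiskerRight, Category.assoc, Category.assoc,
      associator_naturality_middle_assoc, ← whiskerLeft_comp, ← whiskerLeft_comp, ih,
      whiskerLeft_comp, whiskerLeft_comp, pentagon_assoc, associator_naturality_right_assoc]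

variable {Y} {G : PreCoSegal M X}
  (y : ∀ c : Σ p : X × X, Chain X p.1 p.2, Y c ⟶ (G.F c.1.1 c.1.2).obj (op c.2))

def valMap : {A B : X} → (p : Bead X A B) → (p.val Y ⟶ (G.F A B).obj (op p.total))
  | _, _, single t => y ⟨(_, _), t⟩
  | _, _, cons t p => (y ⟨(_, _), t⟩ ⊗ₘ p.valMap) ≫ G.lax t p.total

theorem lax_eqToHom {A B C : X} (t : Chain X A B) {s s' : Chain X B C} (h : s = s') :
    G.lax t s ≫ eqToHom (congrArg (fun c => (G.F A C).obj (op (t.concat c))) h) =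
      _ ◁ eqToHom (congrArg (fun c => (G.F B C).obj (op c)) h) ≫ G.lax t s' := by
  subst h
  simp

theorem lax_assoc_eqToHom {A B C D : X} (t : Chain X A B) (s : Chain X B C) (r : Chain X C D) :
    G.lax t s ▷ _ ≫ G.lax (t.concat s) r = (α_ _ _ _).hom ≫ _ ◁ G.lax s r ≫ G.lax t (s.concat r) ≫
      eqToHom (congrArg (fun c => (G.F A D).obj (op c)) (Chain.concat_assoc t s r).symm) := by
  have := G.lax_assoc t s r
  rw [eqToHom_map] at this
  rw [← reassoc_of% this, eqToHom_trans, eqToHom_refl, Category.comp_id]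

/-- Iterated laxity maps are multiplicative: induction peels off the first chain and `lax_assoc`
rebrackets. -/
theorem appendMap_valMap {C : X} : {A B : X} → (p : Bead X A B) → (q : Bead X B C) → 
    p.appendMap Y q ≫ (p.append q).valMap y ≫
        eqToHom (congrArg (fun c => (G.F A C).obj (op c)) (total_append p q)) =
      (p.valMap y ⊗ₘ q.valMap y) ≫ G.lax p.total q.total
  | _, _, single t, q => by
    exact (Category.id_comp _).trans (Category.comp_id _)
  | _, _, cons t p, q => by
    have ih := appendMap_valMap p q
    have h₁ := lax_eqToHom (G := G) t (total_append p q)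
    have h₂ := lax_assoc_eqToHom (G := G) t p.total q.total
    have h₃ := congrArg (fun c => (G.F _ C).obj (op (t.concat c))) (total_append p q)
    have h₄ := congrArg (fun c => (G.F _ C).obj (op c)) (Chain.concat_assoc t p.total q.total).symm
    change ((α_ _ _ _).hom ≫ _ ◁ p.appendMap Y q) ≫ ((y ⟨(_, _), t⟩ ⊗ₘ (p.append q).valMap y) ≫
        G.lax t (p.append q).total) ≫ eqToHom (h₃.trans h₄) =
      (((y ⟨(_, _), t⟩ ⊗ₘ p.valMap y) ≫ G.lax t p.total) ⊗ₘ q.valMap y) ≫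
        G.lax (t.concat p.total) q.total
    rw [← eqToHom_trans h₃ h₄, Category.assoc, Category.assoc, reassoc_of% h₁,
      ← tensorHom_comp_whiskerRight_assoc, h₂, associator_naturality_assoc,
      tensorHom_comp_whiskerLeft_assoc, tensorHom_comp_whiskerLeft_assoc,
      whiskerLeft_comp_tensorHom_assoc, ih]

end Bead

section

variable {X : Type v}

/-- The index set of the coproduct defining the value at `v` of a free pre-Co-Segal category. -/
@[ext]
structure FreeIndex {A B : X} (v : Chain X A B) where
  bead : Bead X A B
  chain : Chain X A B
  eq : bead.total = chain
  hom : v ⟶ chain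

namespace FreeIndex

variable {A B C D : X} {v v' : Chain X A B} {w w' : Chain X B C} {x : Chain X C D}

abbrev precomp (e : v' ⟶ v) (i : FreeIndex v) : FreeIndex v' :=
  ⟨i.bead, i.chain, i.eq, e ≫ i.hom⟩

abbrev append (i : FreeIndex v) (j : FreeIndex w) : FreeIndex (v.concat w) where
  bead := i.bead.append j.bead
  chain := i.chain.concat j.chain
  eq := by rw [Bead.total_append, i.eq, j.eq]
  hom := Chain.concatMap i.hom j.hom

theorem append_assoc (i : FreeIndex v) (j : FreeIndex w) (k : FreeIndex x) :
    i.append (j.append k) = ((i.append j).append k).precomp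
      (eqToHom (Chain.concat_assoc v w x).symm) :=
  FreeIndex.ext (Bead.append_assoc _ _ _).symm (Chain.concat_assoc _ _ _).symm
    ((Del.append_assoc_heq _ _ _ _ _).symm.trans (Chain.eqToHom_comp_heq _ _).symm)

end FreeIndex

variable {M : Type u} [Category.{v} M] [MonoidalCategory M] [SymmetricCategory M]
  [MonoidalClosed M] [HasColimitsOfSize.{v, v} M] (Y : (Σ p : X × X, Chain X p.1 p.2) → M)

noncomputable def freeObj {A B : X} (v : Chain X A B) : M :=
  ∐ fun i : FreeIndex v => i.bead.val Y

variable {Y} {A B C D : X} {v v' : Chain X A B} {w w' : Chain X B C} {x : Chain X C D}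

noncomputable def freeι (i : FreeIndex v) : i.bead.val Y ⟶ freeObj Y v :=
  Sigma.ι (fun i : FreeIndex v => i.bead.val Y) i

omit [SymmetricCategory M] [MonoidalClosed M] in
theorem freeι_congr {i j : FreeIndex v} (h : i = j) :
    freeι (Y := Y) i = eqToHom (by rw [h]) ≫ freeι j := by
  subst h
  simp

omit [SymmetricCategory M] [MonoidalClosed M] in
theorem freeι_congr_hom {p : Bead X A B} {c : Chain X A B} {h : p.total = c} {d d' : v ⟶ c}
    (hd : d = d') : freeι (Y := Y) ⟨p, c, h, d⟩ = freeι ⟨p, c, h, d'⟩ := by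
  subst hd
  rfl

omit [SymmetricCategory M] [MonoidalClosed M] in
theorem free_hom_ext {T : M} {f g : freeObj Y v ⟶ T} (h : ∀ i, freeι i ≫ f = freeι i ≫ g) :
    f = g :=
  Sigma.hom_ext _ _ h

variable (Y) in
noncomputable def freeMap (e : v' ⟶ v) : freeObj Y v ⟶ freeObj Y v' :=
  Sigma.desc fun i => freeι (i.precomp e)

omit [SymmetricCategory M] [MonoidalClosed M] in
theorem freeι_freeMap (e : v' ⟶ v) (i : FreeIndex v) :
    freeι i ≫ freeMap Y e = freeι (i.precomp e) :=
  Sigma.ι_desc _ _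

variable (Y v w) in
noncomputable def freeLax : freeObj Y v ⊗ freeObj Y w ⟶ freeObj Y (v.concat w) :=
  tensorSigmaDesc fun i j => i.bead.appendMap Y j.bead ≫ freeι (i.append j)

theorem freeι_freeLax (i : FreeIndex v) (j : FreeIndex w) :
    (freeι i ⊗ₘ freeι j) ≫ freeLax Y v w = i.bead.appendMap Y j.bead ≫ freeι (i.append j) :=
  ι_tensorSigmaDesc _ _ _

variable (Y) in
/-- The free pre-Co-Segal category on a family of objects indexed by chains. -/
noncomputable def free : PreCoSegal M X where
  F A B :=
    { obj v := freeObj Y v.unop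
      map e := freeMap Y e.unop
      map_id v := free_hom_ext fun i => by
        rw [freeι_freeMap, Category.comp_id]
        exact freeι_congr_hom (Category.id_comp i.hom)
      map_comp e f := free_hom_ext fun i => by
        rw [freeι_freeMap, reassoc_of% freeι_freeMap, freeι_freeMap]
        exact freeι_congr_hom (Category.assoc f.unop e.unop i.hom) }
  lax v w := freeLax Y v w
  lax_natural d e := tensorSigma_hom_ext fun i j => by
    refine (tensorHom_comp_tensorHom_assoc (freeι i) (freeι j) (freeMap Y d) (freeMap Y e)
      (freeLax Y _ _)).trans (Eq.trans ?_ ((reassoc_of% freeι_freeLax i j) _).symm)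
    refine Eq.trans ?_ (congrArg _ (freeι_freeMap (Chain.concatMap d e) (i.append j)).symm)
    rw [freeι_freeMap, freeι_freeMap, freeι_freeLax]
    exact congrArg _ (freeι_congr_hom (Chain.concatMap_comp d i.hom e j.hom))
  lax_assoc {A B C D} v w x := tensorSigma₃_hom_ext fun i j k => by
    have h := congrArg (Bead.val Y) (Bead.append_assoc k.bead i.bead j.bead)
    have h₁ := Bead.appendMap_assoc Y k.bead i.bead j.bead h
    have h₂ := freeι_congr (Y := Y) (FreeIndex.append_assoc i j k)
    change ((freeι i ⊗ₘ freeι j) ⊗ₘ freeι k) ≫ freeLax Y v w ▷ freeObj Y x ≫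
        freeLax Y (v.concat w) x ≫ freeMap Y (eqToHom (congrArg op (Chain.concat_assoc v w x))).unop =
      ((freeι i ⊗ₘ freeι j) ⊗ₘ freeι k) ≫ (α_ _ _ _).hom ≫ freeObj Y v ◁ freeLax Y w x ≫
        freeLax Y v (w.concat x)
    rw [eqToHom_unop, tensorHom_comp_whiskerRight_assoc, freeι_freeLax,
      ← whiskerRight_comp_tensorHom_assoc,
      reassoc_of% freeι_freeLax, freeι_freeMap, associator_naturality_assoc,
      tensorHom_comp_whiskerLeft_assoc, freeι_freeLax, ← whiskerLeft_comp_tensorHom_assoc,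
      freeι_freeLax, h₂, ← reassoc_of% h₁, eqToHom_trans_assoc, eqToHom_refl, Category.id_comp]

variable {G : PreCoSegal M X}

section

variable (y : ∀ c : Σ p : X × X, Chain X p.1 p.2, Y c ⟶ (G.F c.1.1 c.1.2).obj (op c.2))

variable (v) in
noncomputable def freeDesc : freeObj Y v ⟶ (G.F A B).obj (op v) :=
  Sigma.desc fun i => i.bead.valMap y ≫
    eqToHom (congrArg (fun c => (G.F A B).obj (op c)) i.eq) ≫ (G.F A B).map i.hom.op

omit [SymmetricCategory M] [MonoidalClosed M] in
theorem freeι_freeDesc (i : FreeIndex v) : freeι i ≫ freeDesc v y = i.bead.valMap y ≫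
    eqToHom (congrArg (fun c => (G.F A B).obj (op c)) i.eq) ≫ (G.F A B).map i.hom.op :=
  Sigma.ι_desc _ _

noncomputable def freeHom : free Y ⟶ G where
  app A B :=
    { app v := freeDesc v.unop y
      naturality v w e := free_hom_ext fun i => by
        refine ((reassoc_of% freeι_freeMap e.unop i) _).trans
          (Eq.trans ?_ ((reassoc_of% freeι_freeDesc y i) _).symm)
        rw [freeι_freeDesc]
        congr 2
        exact (G.F A B).map_comp i.hom.op e }
  lax_comm {A B C} v w := tensorSigma_hom_ext fun i j => by
    refine ((reassoc_of% freeι_freeLax i j) _).trans (Eq.trans ?_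
      (tensorHom_comp_tensorHom_assoc (freeι i) (freeι j) (freeDesc v y) (freeDesc w y) _).symm)
    refine (congrArg _ (freeι_freeDesc y _)).trans ?_
    rw [freeι_freeDesc, freeι_freeDesc]
    obtain ⟨p, _, rfl, d⟩ := i
    obtain ⟨q, _, rfl, e⟩ := j
    have h := Bead.appendMap_valMap y p q
    have h₁ := G.lax_natural d e
    rw [eqToHom_refl, eqToHom_refl, Category.id_comp, Category.id_comp,
      ← tensorHom_comp_tensorHom_assoc, h₁, ← reassoc_of% h]

/-- The generator of a composable sequence is the product of the generators of its chains, so a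
morphism from `free Y` is determined on single chains (`freeι_app`). -/
theorem freeι_cons (t : Chain X A B) (p : Bead X B C) :
    freeι (Y := Y) ⟨.cons t p, t.concat p.total, rfl, 𝟙 _⟩ =
      (freeι ⟨.single t, t, rfl, 𝟙 _⟩ ⊗ₘ freeι ⟨p, p.total, rfl, 𝟙 _⟩) ≫ freeLax Y _ _ := by
  rw [freeι_freeLax]
  refine Eq.trans ?_ (Category.id_comp _).symm
  exact freeι_congr_hom (Chain.concatMap_id _ _).symm

end

noncomputable def freeUnit (φ : free Y ⟶ G) (c : Σ p : X × X, Chain X p.1 p.2) :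
    Y c ⟶ (G.F c.1.1 c.1.2).obj (op c.2) :=
  freeι ⟨.single c.2, c.2, rfl, 𝟙 _⟩ ≫ (PreCoSegal.Hom.app φ c.1.1 c.1.2).app (op c.2)

theorem freeι_app (φ : free Y ⟶ G) : {A B : X} → (p : Bead X A B) →
    freeι (Y := Y) ⟨p, p.total, rfl, 𝟙 _⟩ ≫ (PreCoSegal.Hom.app φ A B).app (op p.total) =
      p.valMap (freeUnit φ)
  | _, _, .single t => rfl
  | _, _, .cons t p => by
    have h := φ.lax_comm t p.total
    refine (congrArg (· ≫ _) (freeι_cons t p)).trans ((Category.assoc _ _ _).trans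
      ((congrArg _ h).trans ((tensorHom_comp_tensorHom_assoc _ _ _ _ _).trans ?_)))
    rw [freeι_app φ p]
    rfl

noncomputable def freeHomEquiv : (free Y ⟶ G) ≃
    (∀ c : Σ p : X × X, Chain X p.1 p.2, Y c ⟶ (G.F c.1.1 c.1.2).obj (op c.2)) where
  toFun := freeUnit
  invFun := freeHom
  left_inv φ := PreCoSegal.Hom.ext (by
    funext A B
    ext v
    refine free_hom_ext fun i => (freeι_freeDesc _ i).trans ?_
    obtain ⟨p, _, rfl, d⟩ := i
    have h := (PreCoSegal.Hom.app φ A B).naturality d.op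
    have h₁ : freeι (Y := Y) ⟨p, p.total, rfl, d⟩ =
        freeι ⟨p, p.total, rfl, 𝟙 _⟩ ≫ freeMap Y d :=
      (freeι_congr_hom (Category.comp_id d).symm).trans
        (freeι_freeMap d ⟨p, p.total, rfl, 𝟙 _⟩).symm
    rw [eqToHom_refl, Category.id_comp, ← freeι_app, h₁]
    exact (Category.assoc _ _ _).trans ((congrArg _ h.symm).trans (Category.assoc _ _ _).symm))
  right_inv y := by
    funext c
    refine (freeι_freeDesc y _).trans ?_
    refine (congrArg _ ((Category.id_comp _).trans ((G.F _ _).map_id _))).trans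
      (Category.comp_id _)

end

end

/-! ### Monadicity -/

section

attribute [-instance] CategoryTheory.catToReflQuiver

section

variable {M : Type u} [Category.{v} M] {X : Type v}

/-- The evaluation of a family of functors at a chain. -/
abbrev kEvAt {A B : X} (t : Chain X A B) : KX M X ⥤ M :=
  Pi.eval (fun p : X × X => (Chain X p.1 p.2)ᵒᵖ ⥤ M) (A, B) ⋙ (evaluation _ _).obj (op t)

/-- The endpoints are variables identified by equations; matching on `rfl` avoids transports in the
statements about `HHom`. -/
def delAct (G : KX M X) : {A' B' A B : X} → {v : Chain X A' B'} → {t : Chain X A B} →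
    Del v.mid t.mid → A' = A → B' = B → ((G (A, B)).obj (op t) ⟶ (G (A', B')).obj (op v))
  | A, B, _, _, v, t, d, rfl, rfl => (G (A, B)).map (Quiver.Hom.op (X := v) (Y := t) d)

def HHom.act (G : KX M X) {A' B' A B : X} {v : Chain X A' B'} {t : Chain X A B}
    (d : HHom v t) : (G (A, B)).obj (op t) ⟶ (G (A', B')).obj (op v) :=
  delAct G d.1 d.2.1 d.2.2

theorem HHom.act_mk (G : KX M X) {A B : X} {v t : Chain X A B} (d : v ⟶ t) (h : A = A ∧ B = B) :
    HHom.act G (⟨d, h⟩ : HHom v t) = (G (A, B)).map d.op :=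
  rfl

theorem HHom.act_precomp (G : KX M X) {A' B' A B : X} {v v' : Chain X A' B'} {t : Chain X A B}
    (e : v' ⟶ v) (d : HHom v t) :
    (d.precomp e).act G = d.act G ≫ (G (A', B')).map e.op := by
  obtain ⟨d, rfl, rfl⟩ := d
  rw [HHom.act_mk G (show v ⟶ t from d)]
  refine Eq.trans (HHom.act_mk G (e ≫ (show v ⟶ t from d)) ⟨rfl, rfl⟩) ?_
  exact (G (A', B')).map_comp (Quiver.Hom.op (X := v) (Y := t) d) e.op

def HHom.refl {A B : X} (t : Chain X A B) : HHom t t :=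
  ⟨Del.id t.mid, rfl, rfl⟩

variable [HasColimitsOfSize.{v, v} M]

noncomputable def ιFreeAt {A B : X} (t : Chain X A B) (m : M) {A' B' : X} {v : Chain X A' B'}
    (d : HHom v t) : m ⟶ ((freeAt t).obj m (A', B')).obj (op v) :=
  Sigma.ι (fun _ : HHom v t => m) d

theorem ιFreeAt_refl {A B : X} (t : Chain X A B) (m : M) {A' B' : X} {v : Chain X A' B'}
    (d : HHom v t) :
    ιFreeAt t m (HHom.refl t) ≫ d.act ((freeAt t).obj m) = ιFreeAt t m d := by
  obtain ⟨d, rfl, rfl⟩ := d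
  have h := Sigma.ι_desc (fun e : HHom t t => Sigma.ι (fun _ : HHom v t => m)
    (e.precomp (show v ⟶ t from d))) (HHom.refl t)
  refine h.trans (congrArg (Sigma.ι (fun _ : HHom v t => m)) (Subtype.ext ?_))
  exact Del.comp_id d

omit [HasColimitsOfSize.{v, v} M] in
theorem HHom.act_naturality {G H : KX M X} (φ : G ⟶ H) {A' B' A B : X} {v : Chain X A' B'}
    {t : Chain X A B} (d : HHom v t) :
    d.act G ≫ (φ (A', B')).app (op v) = (φ (A, B)).app (op t) ≫ d.act H := by
  obtain ⟨d, rfl, rfl⟩ := d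
  exact (φ (A', B')).naturality (Quiver.Hom.op (X := v) (Y := t) d)

noncomputable def freeAtDesc {A B : X} (t : Chain X A B) {m : M} {G : KX M X}
    (y : m ⟶ (G (A, B)).obj (op t)) : (freeAt t).obj m ⟶ G := fun p =>
  { app v := Sigma.desc fun d : HHom v.unop t => y ≫ d.act G
    naturality v v' e := by
      refine Sigma.hom_ext _ _ fun d => ?_
      have h₀ : (d.precomp e.unop).act G = d.act G ≫ (G p).map e := HHom.act_precomp G e.unop d
      have h₁ := Sigma.ι_desc (fun e' : HHom v.unop t => Sigma.ι (fun _ : HHom v'.unop t => m)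
        (e'.precomp e.unop)) d
      have h₂ := Sigma.ι_desc (fun d : HHom v'.unop t => y ≫ d.act G) (d.precomp e.unop)
      have h₃ := Sigma.ι_desc (fun d : HHom v.unop t => y ≫ d.act G) d
      refine ((reassoc_of% h₁) _).trans (h₂.trans (Eq.trans ?_ ((reassoc_of% h₃) _).symm))
      exact congrArg (y ≫ ·) h₀ }

theorem ι_freeAtDesc {A B : X} (t : Chain X A B) {m : M} {G : KX M X}
    (y : m ⟶ (G (A, B)).obj (op t)) {A' B' : X} {v : Chain X A' B'} (d : HHom v t) :
    ιFreeAt t m d ≫ (freeAtDesc t y (A', B')).app (op v) = y ≫ d.act G :=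
  Sigma.ι_desc _ _

theorem freeAt_hom_ext {A B : X} (t : Chain X A B) {m : M} {G : KX M X}
    {φ ψ : (freeAt t).obj m ⟶ G}
    (h : ιFreeAt t m (HHom.refl t) ≫ (φ (A, B)).app (op t) =
      ιFreeAt t m (HHom.refl t) ≫ (ψ (A, B)).app (op t)) : φ = ψ := by
  funext p
  ext v
  refine Sigma.hom_ext _ _ fun d => ?_
  have (φ : (freeAt t).obj m ⟶ G) : ιFreeAt t m d ≫ (φ p).app v =
      (ιFreeAt t m (HHom.refl t) ≫ (φ (A, B)).app (op t)) ≫ d.act G := by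
    have h₁ := HHom.act_naturality φ d
    rw [← ιFreeAt_refl t m d, Category.assoc, Category.assoc]
    exact congrArg _ h₁
  exact (this φ).trans ((congrArg (· ≫ _) h).trans (this ψ).symm)

omit [HasColimitsOfSize.{v, v} M] in
theorem act_refl {A B : X} (t : Chain X A B) (G : KX M X) : (HHom.refl t).act G = 𝟙 _ :=
  (HHom.act_mk G (𝟙 t) ⟨rfl, rfl⟩).trans ((G (A, B)).map_id (op t))

noncomputable def freeAtHomEquiv {A B : X} (t : Chain X A B) (m : M) (G : KX M X) :
    ((freeAt t).obj m ⟶ G) ≃ (m ⟶ (kEvAt t).obj G) where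
  toFun φ := ιFreeAt t m (HHom.refl t) ≫ (φ (A, B)).app (op t)
  invFun := freeAtDesc t
  left_inv _ := freeAt_hom_ext t ((ι_freeAtDesc t _ _).trans
    ((congrArg _ (act_refl t G)).trans (Category.comp_id _)))
  right_inv _ := (ι_freeAtDesc t _ _).trans
    ((congrArg _ (act_refl t G)).trans (Category.comp_id _))

/-- `freeAt t` is left adjoint to the evaluation at `t`. -/
noncomputable def freeAtAdj {A B : X} (t : Chain X A B) :
    (freeAt t : M ⥤ KX M X) ⊣ kEvAt t :=
  Adjunction.mkOfHomEquiv
    { homEquiv := freeAtHomEquiv t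
      homEquiv_naturality_left_symm {m' m G} f y := freeAt_hom_ext t (by
        have h : ιFreeAt t m' (HHom.refl t) ≫ ((freeAt t).map f (A, B)).app (op t) =
          f ≫ ιFreeAt t m (HHom.refl t) := Sigma.ι_desc _ _
        refine (ι_freeAtDesc t _ _).trans (Eq.trans ?_ ((reassoc_of% h) _).symm)
        exact (Category.assoc _ _ _).trans (congrArg _ (ι_freeAtDesc t _ _).symm))
      homEquiv_naturality_right f g := (Category.assoc _ _ _).symm }

end

section

variable (M : Type u) [Category.{v} M] (X : Type v)

/-- The evaluations at all chains. -/
def kToFamily : KX M X ⥤ ∀ _ : (Σ p : X × X, Chain X p.1 p.2), M where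
  obj G c := (G c.1).obj (op c.2)
  map φ c := (φ c.1).app (op c.2)

/-- The evaluations at all chains. -/
def toFamily [MonoidalCategory M] :
    PreCoSegal M X ⥤ ∀ _ : (Σ p : X × X, Chain X p.1 p.2), M :=
  forgetLax M X ⋙ kToFamily M X

instance : (kToFamily M X).ReflectsIsomorphisms where
  reflects {G H} f _ := isIso_of_isIso_apply _ fun p => by
    have : ∀ v, IsIso ((f p).app v) := fun v =>
      isIso_apply ((kToFamily M X).map f) ⟨p, v.unop⟩
    exact NatIso.isIso_of_isIso_app _

theorem isIso_of_isIso_app [MonoidalCategory M] {G H : PreCoSegal M X} (f : G ⟶ H)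
    (h : ∀ A B, IsIso (PreCoSegal.Hom.app f A B)) : IsIso f := by
  refine ⟨{ app A B := inv (PreCoSegal.Hom.app f A B), lax_comm {A B C} t s := ?_ }, ?_, ?_⟩
  · have h₁ := f.lax_comm t s
    have h₂ (A B : X) (t : Chain X A B) : (PreCoSegal.Hom.app f A B).app (op t) ≫
        (inv (PreCoSegal.Hom.app f A B)).app (op t) = 𝟙 _ :=
      congrArg (fun k => k.app (op t)) (IsIso.hom_inv_id (PreCoSegal.Hom.app f A B))
    rw [← cancel_epi ((PreCoSegal.Hom.app f A B).app (op t) ⊗ₘ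
        (PreCoSegal.Hom.app f B C).app (op s)), ← reassoc_of% h₁, h₂,
      tensorHom_comp_tensorHom_assoc, h₂, h₂, id_tensorHom_id, Category.id_comp,
      Category.comp_id]
  · exact PreCoSegal.Hom.ext (by
      funext A B
      exact IsIso.hom_inv_id (PreCoSegal.Hom.app f A B))
  · exact PreCoSegal.Hom.ext (by
      funext A B
      exact IsIso.inv_hom_id (PreCoSegal.Hom.app f A B))

instance [MonoidalCategory M] : (forgetLax M X).ReflectsIsomorphisms where
  reflects f _ := isIso_of_isIso_app M X f fun A B =>
    isIso_apply ((forgetLax M X).map f) (A, B)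

instance [MonoidalCategory M] : (toFamily M X).ReflectsIsomorphisms :=
  inferInstanceAs (forgetLax M X ⋙ kToFamily M X).ReflectsIsomorphisms

end

section

variable {M : Type u} [Category.{v} M] {X : Type v} {J : Type*} [Category* J]

instance [HasColimitsOfShape J M] : PreservesColimitsOfShape J (kToFamily M X) :=
  preservesColimitsOfShape_of_eval _ fun c =>
    inferInstanceAs (PreservesColimitsOfShape J (kEvAt (M := M) c.2))

variable [MonoidalCategory M] [HasColimitsOfShape J M]
  [IsSifted J] [∀ A : M, PreservesColimitsOfShape J (tensorLeft A)]
  [∀ A : M, PreservesColimitsOfShape J (tensorRight A)]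

instance preservesColimitsOfShape_forgetLax : PreservesColimitsOfShape J (forgetLax M X) :=
  preservesColimitsOfShape_of_eval _ fun p =>
    inferInstanceAs (PreservesColimitsOfShape J (compAt (M := M) p.1 p.2))

instance preservesColimitsOfShape_toFamily : PreservesColimitsOfShape J (toFamily M X) :=
  inferInstanceAs (PreservesColimitsOfShape J (forgetLax M X ⋙ kToFamily M X))

end

section

variable {C : Type*} {D : Type*} [Category.{v} C] [Category.{v} D]
  {F : C ⥤ D} {G : D ⥤ C} (adj : F ⊣ G)
  [G.ReflectsIsomorphisms] [HasColimitsOfShape WalkingReflexivePair D]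
  [PreservesColimitsOfShape WalkingReflexivePair G]

/-- The crude monadicity theorem, in terms of the walking reflexive pair. -/
abbrev monadicOfReflexive : MonadicRightAdjoint G := by
  have := hasReflexiveCoequalizers_iff.1 ‹HasColimitsOfShape WalkingReflexivePair D›
  have : Monad.PreservesColimitOfIsReflexivePair G := ⟨fun _ _ f g _ =>
    preservesColimit_of_iso_diagram G (inclusionWalkingReflexivePairOfIsReflexivePairIso f g)⟩
  exact Monad.monadicOfHasPreservesReflexiveCoequalizersOfReflectsIsomorphisms adj

theorem comparison_isEquivalence : (Monad.comparison adj).IsEquivalence :=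
  (monadicOfReflexive adj).eqv

end

section

variable {C : Type*} {D : Type*} [Category.{v} C] [Category.{v} D] (G : D ⥤ C) [G.IsRightAdjoint]
  [G.ReflectsIsomorphisms] [HasColimitsOfShape WalkingReflexivePair D]
  [PreservesColimitsOfShape WalkingReflexivePair G]

include G in
theorem hasLimitsOfShape_of_monadic (J : Type*) [Category* J] [HasLimitsOfShape J C] :
    HasLimitsOfShape J D := by
  let := monadicOfReflexive (Adjunction.ofIsRightAdjoint G)
  have := monadicCreatesLimits G
  exact hasLimitsOfShape_of_hasLimitsOfShape_createsLimitsOfShape G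

-- Colimits are a left adjoint to the diagonal of `D`. Followed by the monadic functor `W`, that
-- diagonal becomes `G` followed by the diagonal of `C`, a right adjoint; the adjoint triangle
-- theorem lifts the left adjoint.
include G in
theorem hasColimitsOfShape_of_monadic [HasColimitsOfShape WalkingReflexivePair C]
    (J : Type v) [Category.{v} J] [HasColimitsOfShape J C] :
    HasColimitsOfShape J D := by
  let W : (J ⥤ D) ⥤ (J ⥤ C) := (Functor.whiskeringRight J D C).obj G
  let adj := (Adjunction.ofIsRightAdjoint G).whiskerRight J
  have : PreservesColimitsOfShape WalkingReflexivePair W := inferInstance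
  let := monadicOfReflexive adj
  have := hasReflexiveCoequalizers_iff.1 ‹HasColimitsOfShape WalkingReflexivePair D›
  have := hasColimitsOfShape_iff_isRightAdjoint_const.1 ‹HasColimitsOfShape J C›
  rw [hasColimitsOfShape_iff_isRightAdjoint_const]
  have : (Functor.const J ⋙ W).IsRightAdjoint :=
    Functor.isRightAdjoint_of_iso (Functor.compConstIso J G)
  exact isRightAdjoint_triangle_lift_monadic W

end

section

variable {M : Type u} [Category.{v} M] {X : Type v} [HasColimitsOfSize.{v, v} M]

noncomputable def kToFamilyHomEquiv (Y : ∀ _ : (Σ p : X × X, Chain X p.1 p.2), M)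
    (G : KX M X) :
    ((∐ fun c : Σ p : X × X, Chain X p.1 p.2 => (freeAt c.2 : M ⥤ KX M X).obj (Y c)) ⟶ G) ≃
      (Y ⟶ (kToFamily M X).obj G) where
  toFun φ c := freeAtHomEquiv.{v, u} c.2 (Y c) G
    (Sigma.ι (fun c : Σ p : X × X, Chain X p.1 p.2 => (freeAt.{v, u} c.2).obj (Y c)) c ≫ φ)
  invFun y := Sigma.desc fun c => (freeAtHomEquiv.{v, u} c.2 (Y c) G).symm (y c)
  left_inv φ := Sigma.hom_ext _ _ fun c => by simp
  right_inv y := by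
    funext c
    exact (congrArg _ (Sigma.ι_desc _ _)).trans (Equiv.apply_symm_apply _ _)

instance : (kToFamily M X).IsRightAdjoint :=
  (Adjunction.adjunctionOfEquivLeft (G := kToFamily M X) kToFamilyHomEquiv.{v, u} fun Y G H φ f => by
    funext c
    exact (congrArg (freeAtHomEquiv.{v, u} c.2 (Y c) H) (Category.assoc _ _ _).symm).trans
      (Category.assoc _ _ _).symm).isRightAdjoint

variable [MonoidalCategory M] [SymmetricCategory M] [MonoidalClosed M]

instance (A : M) : (tensorRight A).IsLeftAdjoint :=
  inferInstance

instance : (toFamily M X).IsRightAdjoint :=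
  (Adjunction.adjunctionOfEquivLeft (G := toFamily M X) (F_obj := free) (fun _ _ => freeHomEquiv)
    fun Y G H φ f => by
      funext c
      exact (Category.assoc _ _ _).symm).isRightAdjoint

/-- Adjoint triangle: the composite with the monadic `kToFamily` is `toFamily`, whose left adjoint
is `free`, and reflexive coequalizers exist upstairs. -/
instance : (forgetLax M X).IsRightAdjoint := by
  let := monadicOfReflexive (Adjunction.ofIsRightAdjoint (kToFamily M X))
  have : HasReflexiveCoequalizers (PreCoSegal M X) :=
    hasReflexiveCoequalizers_iff.1 inferInstance
  have : (forgetLax M X ⋙ kToFamily M X).IsRightAdjoint :=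
    inferInstanceAs (toFamily M X).IsRightAdjoint
  exact isRightAdjoint_triangle_lift_monadic (kToFamily M X)

instance : HasColimitsOfSize.{v, v} (PreCoSegal M X) :=
  ⟨fun J _ => hasColimitsOfShape_of_monadic (toFamily M X) J⟩

instance [HasLimitsOfSize.{v, v} M] : HasLimitsOfSize.{v, v} (PreCoSegal M X) :=
  ⟨fun J _ => hasLimitsOfShape_of_monadic (toFamily M X) J⟩

end

end

/-! ### Transfinite compositions and smallness -/

section

attribute [-instance] CategoryTheory.catToReflQuiver

section

variable {C : Type*} [Category* C] {K : Type*} [Category* K] {S F T P : K ⥤ C} {α : S ⟶ F}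
  {β : S ⟶ T} {inl : F ⟶ P} {inr : T ⟶ P}

/-- A levelwise pushout of colimit cocones is a colimit cocone. -/
noncomputable def isColimitOfIsPushout
    (h : ∀ k, IsPushout (α.app k) (β.app k) (inl.app k) (inr.app k))
    {cS : Cocone S} {cF : Cocone F} {cT : Cocone T} {cP : Cocone P} (hS : IsColimit cS)
    (hF : IsColimit cF) (hT : IsColimit cT) {a : cS.pt ⟶ cF.pt} {b : cS.pt ⟶ cT.pt}
    {i : cF.pt ⟶ cP.pt} {j : cT.pt ⟶ cP.pt} (sq : IsPushout a b i j)
    (ha : ∀ k, α.app k ≫ cF.ι.app k = cS.ι.app k ≫ a)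
    (hb : ∀ k, β.app k ≫ cT.ι.app k = cS.ι.app k ≫ b)
    (hi : ∀ k, inl.app k ≫ cP.ι.app k = cF.ι.app k ≫ i)
    (hj : ∀ k, inr.app k ≫ cP.ι.app k = cT.ι.app k ≫ j) : IsColimit cP where
  desc s := sq.desc (hF.desc ((Cocone.precompose inl).obj s))
    (hT.desc ((Cocone.precompose inr).obj s)) (hS.hom_ext fun k => by
      rw [← reassoc_of% (ha k), ← reassoc_of% (hb k), hF.fac, hT.fac]
      exact (Category.assoc _ _ _).symm.trans ((congrArg (· ≫ _) (h k).w).trans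
        (Category.assoc _ _ _)))
  fac s k := (h k).hom_ext (by
    rw [reassoc_of% (hi k), sq.inl_desc, hF.fac]
    rfl) (by
    rw [reassoc_of% (hj k), sq.inr_desc, hT.fac]
    rfl)
  uniq s m hm := sq.hom_ext (by
    rw [sq.inl_desc]
    refine hF.hom_ext fun k => ?_
    rw [← reassoc_of% (hi k), hm, hF.fac]
    rfl) (by
    rw [sq.inr_desc]
    refine hT.hom_ext fun k => ?_
    rw [← reassoc_of% (hj k), hm, hT.fac]
    rfl)

end

section

variable {C : Type*} [Category* C] {J : Type*} [LinearOrder J]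

theorem isConnected_Iio {m : J} (hm : Order.IsSuccLimit m) : IsConnected (Set.Iio m) := by
  have : Nonempty (Set.Iio m) := by
    obtain ⟨i, hi⟩ := not_isMin_iff.1 hm.1
    exact ⟨⟨i, hi⟩⟩
  exact IsFiltered.isConnected _

instance isWellOrderContinuous_const (A : C) :
    ((Functor.const J).obj A).IsWellOrderContinuous where
  nonempty_isColimit m hm := by
    have := isConnected_Iio hm
    exact ⟨IsColimit.ofIsoColimit (isColimitConstCocone (Set.Iio m) A)
      (Cocone.ext (Iso.refl _) fun _ => Category.comp_id _)⟩

theorem isWellOrderContinuous_of_isPushout [HasPushouts C] {S F T P : J ⥤ C} {α : S ⟶ F}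
    {β : S ⟶ T} {inl : F ⟶ P} {inr : T ⟶ P} (h : IsPushout α β inl inr)
    [S.IsWellOrderContinuous] [F.IsWellOrderContinuous] [T.IsWellOrderContinuous] :
    P.IsWellOrderContinuous where
  nonempty_isColimit m hm := by
    have h' (k : J) : IsPushout (α.app k) (β.app k) (inl.app k) (inr.app k) :=
      h.map ((evaluation _ _).obj k)
    let e := (Set.principalSegIio m).monotone.functor
    refine ⟨isColimitOfIsPushout (α := Functor.whiskerLeft e α) (β := Functor.whiskerLeft e β)
      (inl := Functor.whiskerLeft e inl) (inr := Functor.whiskerLeft e inr) (fun k => h' _)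
      (S.isColimitOfIsWellOrderContinuous m hm) (F.isColimitOfIsWellOrderContinuous m hm)
      (T.isColimitOfIsWellOrderContinuous m hm) (h' m) (fun k => ?_) (fun k => ?_)
      (fun k => ?_) (fun k => ?_)⟩
    exacts [(α.naturality _).symm, (β.naturality _).symm, (inl.naturality _).symm,
      (inr.naturality _).symm]

variable [SuccOrder J] [OrderBot J] [WellFoundedLT J]

/-- Push out every stage along `g`, as one pushout of sequences with `A` and `B` constant. By
pasting, each new step is a cobase change of the old one; pushouts commute with the colimits
involved, and constant sequences are continuous by connectedness. -/
instance isStableUnderCobaseChange_transfiniteCompositionsOfShape [HasPushouts C]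
    (W : MorphismProperty C) [W.IsStableUnderCobaseChange] :
    (W.transfiniteCompositionsOfShape J).IsStableUnderCobaseChange where
  of_isPushout {A A' B B' f g f' g'} sq hf := by
    obtain ⟨h⟩ := hf
    let α : (Functor.const J).obj A ⟶ (Functor.const J).obj B := (Functor.const J).map g
    let β : (Functor.const J).obj A ⟶ h.F :=
      { app j := h.isoBot.inv ≫ h.F.map (homOfLE bot_le)
        naturality i j φ := by
          rw [Category.assoc, ← h.F.map_comp]
          exact Category.id_comp _ }
    have hβ (j : J) : β.app j ≫ h.incl.app j = f := by
      have := h.incl.naturality (homOfLE (bot_le (a := j)))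
      exact (Category.assoc _ _ _).trans ((congrArg _ (this.trans (Category.comp_id _))).trans
        h.fac)
    have h₀ : IsPushout α β (pushout.inl α β) (pushout.inr α β) := .of_hasPushout α β
    have h₁ (k : J) : IsPushout g (β.app k) ((pushout.inl α β).app k)
        ((pushout.inr α β).app k) := h₀.map ((evaluation _ _).obj k)
    have : IsIso (β.app ⊥) := by
      have : IsIso (h.F.map (homOfLE (bot_le (a := (⊥ : J))))) :=
        inferInstanceAs (IsIso (h.F.map (𝟙 ⊥)))
      exact inferInstanceAs (IsIso (h.isoBot.inv ≫ h.F.map (homOfLE bot_le)))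
    have : IsIso ((pushout.inl α β).app ⊥) := (h₁ ⊥).isIso_inl_of_isIso
    let γ : pushout α β ⟶ (Functor.const J).obj B' :=
      pushout.desc ((Functor.const J).map f') (h.incl ≫ (Functor.const J).map g') (by
        ext k
        exact sq.w.trans ((congrArg (· ≫ g') (hβ k).symm).trans (Category.assoc _ _ _)))
    have hl (k : J) : (pushout.inl α β).app k ≫ γ.app k = f' :=
      congrArg (fun x : (Functor.const J).obj B ⟶ (Functor.const J).obj B' => x.app k)
        (pushout.inl_desc _ _ _)
    have hr (k : J) : (pushout.inr α β).app k ≫ γ.app k = h.incl.app k ≫ g' :=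
      congrArg (fun x : h.F ⟶ (Functor.const J).obj B' => x.app k) (pushout.inr_desc _ _ _)
    have : IsConnected J := IsFiltered.isConnected J
    exact ⟨{
      F := pushout α β
      isoBot := (asIso ((pushout.inl α β).app ⊥)).symm
      isWellOrderContinuous := isWellOrderContinuous_of_isPushout h₀
      incl := γ
      isColimit := isColimitOfIsPushout (α := α) (β := β) h₁
          (isColimitConstCocone J A) (isColimitConstCocone J B)
        h.isColimit sq
        (fun k => (Category.comp_id g).trans (Category.id_comp g).symm)
        (fun k => (hβ k).trans (Category.id_comp _).symm)
        (fun k => (hl k).trans (Category.id_comp _).symm) hr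
      fac := hl ⊥
      map_mem j hj := W.of_isPushout (IsPushout.of_top (h₁₁ := g)
        (h₂₁ := (pushout.inr α β).app j) (v₁₁ := β.app j)
        (v₁₂ := (pushout.inl α β).app j) (h₃₁ := (pushout.inr α β).app (Order.succ j))
        (by
          have e₁ : β.app j ≫ h.F.map (homOfLE (Order.le_succ j)) = β.app (Order.succ j) := by
            rw [← β.naturality]
            exact Category.id_comp _
          have e₂ : (pushout.inl α β).app j ≫ (pushout α β).map (homOfLE (Order.le_succ j)) =
              (pushout.inl α β).app (Order.succ j) := by
            rw [← (pushout.inl α β).naturality]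
            exact Category.id_comp _
          rw [e₁, e₂]
          exact h₁ _)
        ((pushout.inr α β).naturality _).symm (h₁ j)) (h.map_mem j hj) }⟩

instance isStableUnderCobaseChange_transfiniteCompositions {C : Type u} [Category.{v} C]
    [HasPushouts C] (W : MorphismProperty C) [W.IsStableUnderCobaseChange] :
    (MorphismProperty.transfiniteCompositions.{w} W).IsStableUnderCobaseChange where
  of_isPushout sq hf := by
    rw [MorphismProperty.transfiniteCompositions_iff] at hf ⊢
    obtain ⟨J, _, _, _, _, hf⟩ := hf
    exact ⟨J, _, _, _, _, MorphismProperty.of_isPushout sq hf⟩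

end

section

variable {C : Type u} [Category.{v} C] [HasCoproducts.{w} C] {J : Type w} [LinearOrder J]

/-- The sequence which adds the object `Z j` right after the step `j`. -/
noncomputable def attach (Z : J → C) : J ⥤ C where
  obj k := ∐ fun j : Set.Iio k => Z j
  map {k k'} f := Sigma.desc fun j =>
    Sigma.ι (fun j : Set.Iio k' => Z j) ⟨j.1, j.2.trans_le (leOfHom f)⟩
  map_id k := Sigma.hom_ext _ _ fun j => (Sigma.ι_desc _ _).trans (Category.comp_id _).symm
  map_comp f g := Sigma.hom_ext _ _ fun j => by
    rw [Sigma.ι_desc, Sigma.ι_desc_assoc, Sigma.ι_desc]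

variable {Z Z' : J → C}

variable (Z) in
noncomputable def attachι {j k : J} (h : j < k) : Z j ⟶ (attach Z).obj k :=
  Sigma.ι (fun j : Set.Iio k => Z j) ⟨j, h⟩

theorem attachι_map {j k k' : J} (h : j < k) (f : k ⟶ k') :
    attachι Z h ≫ (attach Z).map f = attachι Z (h.trans_le (leOfHom f)) :=
  Sigma.ι_desc _ _

theorem attachι_map_assoc {j k k' : J} (h : j < k) (f : k ⟶ k') {T : C}
    (g : (attach Z).obj k' ⟶ T) :
    attachι Z h ≫ (attach Z).map f ≫ g = attachι Z (h.trans_le (leOfHom f)) ≫ g :=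
  (reassoc_of% attachι_map h f) g

theorem attach_hom_ext {k : J} {T : C} {f g : (attach Z).obj k ⟶ T}
    (h : ∀ (j : J) (hj : j < k), attachι Z hj ≫ f = attachι Z hj ≫ g) : f = g :=
  Sigma.hom_ext _ _ fun j => h j.1 j.2

noncomputable def attachDesc {k : J} {T : C} (g : ∀ (j : J), j < k → (Z j ⟶ T)) :
    (attach Z).obj k ⟶ T :=
  Sigma.desc fun j => g j.1 j.2

theorem attachι_desc {j k : J} (h : j < k) {T : C} (g : ∀ (j : J), j < k → (Z j ⟶ T)) :
    attachι Z h ≫ attachDesc g = g j h :=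
  Sigma.ι_desc _ _

noncomputable def attachMap (φ : ∀ j, Z j ⟶ Z' j) : attach Z ⟶ attach Z' where
  app k := attachDesc fun j hj => φ j ≫ attachι Z' hj
  naturality k k' f := attach_hom_ext fun j hj => by
    rw [reassoc_of% attachι_map, attachι_desc, reassoc_of% (attachι_desc hj), Category.assoc,
      attachι_map]

theorem attachι_attachMap (φ : ∀ j, Z j ⟶ Z' j) {j k : J} (h : j < k) :
    attachι Z h ≫ (attachMap φ).app k = φ j ≫ attachι Z' h :=
  attachι_desc h fun j hj => φ j ≫ attachι Z' hj

variable [SuccOrder J]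

/-- Below a limit `m`, `j < m` implies `succ j < m`, so every summand `Z j` has already appeared at
an earlier stage. -/
instance isWellOrderContinuous_attach : (attach Z).IsWellOrderContinuous where
  nonempty_isColimit m hm := by
    refine ⟨{ desc := fun s => attachDesc fun j hj =>
                attachι Z (Order.lt_succ_of_not_isMax hj.not_isMax) ≫ s.ι.app
                  ⟨Order.succ j, hm.succ_lt hj⟩
              fac := fun s k => ?_
              uniq := fun s f hf => ?_ }⟩
    · refine attach_hom_ext fun j hj => ?_
      refine (attachι_map_assoc hj (homOfLE k.2.le) _).trans ((attachι_desc _ _).trans ?_)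
      have h := s.w (homOfLE (Order.succ_le_of_lt hj) :
        (⟨Order.succ j, hm.succ_lt (hj.trans k.2)⟩ : Set.Iio m) ⟶ k)
      rw [← h]
      exact attachι_map_assoc _ (homOfLE (Order.succ_le_of_lt hj)) _
    · refine attach_hom_ext fun j hj => ?_
      rw [attachι_desc, ← hf]
      exact (attachι_map_assoc _
        (homOfLE (Order.succ_le_of_lt hj)) _).symm

noncomputable def attachTo {F : J ⥤ C} (φ : ∀ j, Z j ⟶ F.obj (Order.succ j)) : attach Z ⟶ F where
  app k := attachDesc fun j hj => φ j ≫ F.map (homOfLE (Order.succ_le_of_lt hj))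
  naturality k k' f := attach_hom_ext fun j hj => by
    rw [reassoc_of% attachι_map, attachι_desc, reassoc_of% (attachι_desc hj), Category.assoc,
      ← F.map_comp]
    rfl

theorem attachι_attachTo {F : J ⥤ C} (φ : ∀ j, Z j ⟶ F.obj (Order.succ j)) {j k : J} (h : j < k) :
    attachι Z h ≫ (attachTo φ).app k = φ j ≫ F.map (homOfLE (Order.succ_le_of_lt h)) :=
  attachι_desc h fun j hj => φ j ≫ F.map (homOfLE (Order.succ_le_of_lt hj))

noncomputable def attachSuccDesc {k : J} (hk : ¬ IsMax k) {T : C} (a : (attach Z).obj k ⟶ T)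
    (b : Z k ⟶ T) : (attach Z).obj (Order.succ k) ⟶ T :=
  attachDesc fun _ hj => if h : _ < k then attachι Z h ≫ a else
    eqToHom (congrArg Z (((Order.lt_succ_iff_of_not_isMax hk).1 hj).eq_of_not_lt h)) ≫ b

theorem map_attachSuccDesc {k : J} (hk : ¬ IsMax k) {T : C} (a : (attach Z).obj k ⟶ T)
    (b : Z k ⟶ T) :
    (attach Z).map (homOfLE (Order.le_succ k)) ≫ attachSuccDesc hk a b = a :=
  attach_hom_ext fun _ hj =>
    (attachι_map_assoc hj _ _).trans ((attachι_desc _ _).trans (dif_pos hj))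

theorem attachι_attachSuccDesc {k : J} (hk : ¬ IsMax k) {T : C} (a : (attach Z).obj k ⟶ T)
    (b : Z k ⟶ T) :
    attachι Z (Order.lt_succ_of_not_isMax hk) ≫ attachSuccDesc hk a b = b :=
  ((attachι_desc _ _).trans (dif_neg (lt_irrefl k))).trans (Category.id_comp b)

theorem attach_succ_hom_ext {k : J} (hk : ¬ IsMax k) {T : C}
    {f g : (attach Z).obj (Order.succ k) ⟶ T}
    (h₁ : (attach Z).map (homOfLE (Order.le_succ k)) ≫ f =
      (attach Z).map (homOfLE (Order.le_succ k)) ≫ g)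
    (h₂ : attachι Z (Order.lt_succ_of_not_isMax hk) ≫ f =
      attachι Z (Order.lt_succ_of_not_isMax hk) ≫ g) : f = g := by
  refine attach_hom_ext fun j hj => ?_
  obtain h | rfl := ((Order.lt_succ_iff_of_not_isMax hk).1 hj).lt_or_eq
  · exact (attachι_map_assoc h (homOfLE (Order.le_succ k)) f).symm.trans
      ((congrArg _ h₁).trans (attachι_map_assoc h (homOfLE (Order.le_succ k)) g))
  · exact h₂

/-- The projection of the sequence of all the objects of `F` to `F`. -/
noncomputable def attachSelf (F : J ⥤ C) : attach (fun j => F.obj (Order.succ j)) ⟶ F :=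
  attachTo fun j => 𝟙 (F.obj (Order.succ j))

variable [HasPushouts C] (F : J ⥤ C) (i : ∀ j, F.obj (Order.succ j) ⟶ Z j)

omit [HasPushouts C] in
theorem attachι_attachSelf {j k : J} (h : j < k) :
    attachι _ h ≫ (attachSelf F).app k = F.map (homOfLE (Order.succ_le_of_lt h)) :=
  (attachι_attachTo _ h).trans (Category.id_comp _)

/-- The sequence obtained from `F` by attaching `i j` right after the step `j`. -/
noncomputable abbrev attachSeq : J ⥤ C :=
  pushout (attachSelf F) (attachMap i)

noncomputable abbrev toAttachSeq : F ⟶ attachSeq F i := pushout.inl _ _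

noncomputable abbrev cellsAttachSeq : attach Z ⟶ attachSeq F i := pushout.inr _ _

theorem isPushout_attachSeq (k : J) :
    IsPushout ((attachSelf F).app k) ((attachMap i).app k)
      ((toAttachSeq F i).app k) ((cellsAttachSeq F i).app k) :=
  (IsPushout.of_hasPushout (attachSelf F) (attachMap i)).map ((evaluation J C).obj k)

instance [F.IsWellOrderContinuous] : (attachSeq F i).IsWellOrderContinuous :=
  isWellOrderContinuous_of_isPushout (IsPushout.of_hasPushout _ _)

theorem attachSeq_w {j k : J} (h : j < k) :
    F.map (homOfLE (Order.succ_le_of_lt h)) ≫ (toAttachSeq F i).app k =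
      i j ≫ attachι Z h ≫ (cellsAttachSeq F i).app k := by
  have h₁ := congrArg (attachι _ h ≫ ·) (isPushout_attachSeq F i k).w
  rw [← reassoc_of% attachι_attachMap, ← h₁, ← reassoc_of% attachι_attachSelf]

/-- The only new summand at stage `succ k` is `Z k`, glued along `F (succ k)`, so the step is a
cobase change of `F k ⟶ F (succ k) ⟶ Z k`. At a maximal `k` nothing would be added. -/
theorem isPushout_attachSeq_succ {k : J} (hk : ¬ IsMax k) :
    IsPushout (F.map (homOfLE (Order.le_succ k)) ≫ i k) ((toAttachSeq F i).app k)
      (attachι Z (Order.lt_succ_of_not_isMax hk) ≫ (cellsAttachSeq F i).app (Order.succ k))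
      ((attachSeq F i).map (homOfLE (Order.le_succ k))) := by
  have hl := (toAttachSeq F i).naturality (homOfLE (Order.le_succ k))
  have hr := (cellsAttachSeq F i).naturality (homOfLE (Order.le_succ k))
  have hw := attachSeq_w F i (Order.lt_succ_of_not_isMax hk)
  have hid : F.map (homOfLE (Order.succ_le_of_lt (Order.lt_succ_of_not_isMax hk))) = 𝟙 _ :=
    F.map_id _
  rw [hid, Category.id_comp] at hw
  refine ⟨⟨?_⟩, ⟨PushoutCocone.IsColimit.mk _
    (fun s => (isPushout_attachSeq F i (Order.succ k)).desc (i k ≫ s.inl)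
      (attachSuccDesc hk ((cellsAttachSeq F i).app k ≫ s.inr) s.inl) ?_) ?_ ?_ ?_⟩⟩
  · rw [← hl, hw, Category.assoc]
  · have hs : F.map (homOfLE (Order.le_succ k)) ≫ i k ≫ s.inl =
        (toAttachSeq F i).app k ≫ s.inr := (Category.assoc _ _ _).symm.trans s.condition
    refine attach_succ_hom_ext hk ?_ ?_
    · refine attach_hom_ext fun j hj => ?_
      have h₁ := (attachSelf F).naturality
        (homOfLE (Order.le_succ k))
      have h₂ := (attachMap i).naturality (homOfLE (Order.le_succ k))
      rw [reassoc_of% h₁, reassoc_of% h₂, map_attachSuccDesc, hs,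
        reassoc_of% (isPushout_attachSeq F i k).w]
    · rw [reassoc_of% attachι_attachSelf, reassoc_of% attachι_attachMap,
        attachι_attachSuccDesc, hid, Category.id_comp]
  · intro s
    rw [Category.assoc, IsPushout.inr_desc, attachι_attachSuccDesc]
  · intro s
    have hs : F.map (homOfLE (Order.le_succ k)) ≫ i k ≫ s.inl =
        (toAttachSeq F i).app k ≫ s.inr := (Category.assoc _ _ _).symm.trans s.condition
    refine (isPushout_attachSeq F i k).hom_ext ?_ ?_
    · rw [← reassoc_of% hl, IsPushout.inl_desc, hs]
    · rw [← reassoc_of% hr, IsPushout.inr_desc, map_attachSuccDesc]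
  · intro s m h₁ h₂
    refine (isPushout_attachSeq F i _).hom_ext ?_ ?_
    · rw [IsPushout.inl_desc, hw, Category.assoc, ← h₁]
    · rw [IsPushout.inr_desc]
      refine attach_succ_hom_ext hk ?_ ?_
      · rw [map_attachSuccDesc, reassoc_of% hr, h₂]
      · rw [attachι_attachSuccDesc, ← h₁, Category.assoc]

variable {i} in
theorem exists_retraction_attachSeq (p : ∀ j, Z j ⟶ F.obj (Order.succ j))
    (h : ∀ j, i j ≫ p j = 𝟙 _) : ∃ r : attachSeq F i ⟶ F, toAttachSeq F i ≫ r = 𝟙 F := by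
  refine ⟨pushout.desc (𝟙 F) (attachTo p) ?_, pushout.inl_desc _ _ _⟩
  rw [Category.comp_id]
  ext k
  refine attach_hom_ext fun j hj => ?_
  rw [attachι_attachSelf, NatTrans.comp_app, reassoc_of% attachι_attachMap, attachι_attachTo,
    reassoc_of% h]

end

section

variable {C : Type*} [Category* C] {D : Type*} [Category* D] {J : Type*} [Category* J]
  [HasColimitsOfShape J C] [HasColimitsOfShape J D]

/-- The comparison map `colimit.post` for `F` is a retract of the one for `G`, and retracts of
isomorphisms are isomorphisms. -/
theorem preservesColimit_of_retract {F G : J ⥤ C} (s : F ⟶ G) (r : G ⟶ F) (h : s ≫ r = 𝟙 F)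
    (H : C ⥤ D) [PreservesColimit G H] : PreservesColimit F H := by
  have nat {F G : J ⥤ C} (s : F ⟶ G) : colimMap (Functor.whiskerRight s H) ≫ colimit.post G H =
      colimit.post F H ≫ H.map (colimMap s) := by
    refine colimit.hom_ext fun j => ?_
    rw [ι_colimMap_assoc, colimit.ι_post, colimit.ι_post_assoc, Functor.whiskerRight_app,
      ← H.map_comp, ← H.map_comp, ι_colimMap]
  have hc : colimMap s ≫ colimMap r = 𝟙 _ := by
    refine colimit.hom_ext fun j => ?_
    have := congrArg (fun x => NatTrans.app x j) h
    rw [ι_colimMap_assoc, ι_colimMap, Category.comp_id]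
    exact (Category.assoc _ _ _).symm.trans ((congrArg (· ≫ _) this).trans (Category.id_comp _))
  have hd : colimMap (Functor.whiskerRight s H) ≫ colimMap (Functor.whiskerRight r H) =
      𝟙 _ := by
    refine colimit.hom_ext fun j => ?_
    have := congrArg (fun x => H.map (NatTrans.app x j)) h
    rw [ι_colimMap_assoc, ι_colimMap, Category.comp_id]
    exact (Category.assoc _ _ _).symm.trans ((congrArg (· ≫ _)
      ((H.map_comp _ _).symm.trans (this.trans (H.map_id _)))).trans (Category.id_comp _))
  have : IsIso (colimit.post F H) :=
    (MorphismProperty.isomorphisms D).of_retract (f := colimit.post F H) (g := colimit.post G H)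
      { i := Arrow.homMk (colimMap (Functor.whiskerRight s H)) (H.map (colimMap s)) (nat s)
        r := Arrow.homMk (colimMap (Functor.whiskerRight r H)) (H.map (colimMap r)) (nat r)
        retract := by
          ext
          · exact hd
          · exact (H.map_comp _ _).symm.trans ((congrArg H.map hc).trans (H.map_id _)) }
      (MorphismProperty.isomorphisms.infer_property _)
  exact preservesColimit_of_isIso_post H F

end

end

/-! ### Cell complexes and relative smallness -/

section

attribute [-instance] CategoryTheory.catToReflQuiver

section

variable {C : Type u} [Category.{v} C]

theorem le_cell (I : MorphismProperty C) :
    (MorphismProperty.coproducts.{v} I).pushouts ≤ cell I :=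
  MorphismProperty.le_transfiniteCompositions _

instance [HasPushouts C] (I : MorphismProperty C) : (cell I).IsStableUnderCobaseChange :=
  isStableUnderCobaseChange_transfiniteCompositions _

theorem cell_le_llp_rlp (I : MorphismProperty C) : cell I ≤ I.rlp.llp :=
  I.transfiniteCompositions_pushouts_coproducts_le_llp_rlp

theorem exists_cell_comp_rlp (I : MorphismProperty C)
    [MorphismProperty.HasSmallObjectArgument.{v} I] {X Y : C} (f : X ⟶ Y) :
    ∃ (Z : C) (g : X ⟶ Z) (p : Z ⟶ Y), cell I g ∧ I.rlp p ∧ g ≫ p = f := by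
  obtain ⟨κ, _, _, _⟩ := MorphismProperty.HasSmallObjectArgument.exists_cardinal.{v} (I := I)
  exact ⟨_, SmallObject.ιObj I κ f, SmallObject.πObj I κ f,
    MorphismProperty.transfiniteCompositionsOfShape_le_transfiniteCompositions _ _ _
      (SmallObject.transfiniteCompositionsOfShape_ιObj I κ f),
    SmallObject.rlp_πObj I κ f, SmallObject.ιObj_πObj I κ f⟩

/-- The retract argument, with the source of `f` left fixed: only the target is enlarged, so it can
be applied to every step of a sequence simultaneously. -/
theorem exists_cell_retract (I : MorphismProperty C)
    [MorphismProperty.HasSmallObjectArgument.{v} I] {X Y : C} (f : X ⟶ Y) (hf : I.rlp.llp f) :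
    ∃ (Z : C) (i : Y ⟶ Z) (p : Z ⟶ Y), cell I (f ≫ i) ∧ i ≫ p = 𝟙 Y := by
  obtain ⟨Z, g, p, hg, hp, fac⟩ := exists_cell_comp_rlp I f
  have := hf p hp
  have sq : CommSq g f p (𝟙 Y) := ⟨fac.trans (Category.comp_id f).symm⟩
  refine ⟨Z, sq.lift, p, ?_, sq.fac_right⟩
  rw [sq.fac_left]
  exact hg

variable [HasColimitsOfSize.{v, v} C]

/-- An object which is small relative to the relative `I`-cell complexes is small relative to
their retracts. -/
theorem IsSmallRelativeTo.llp_rlp (I : MorphismProperty C)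
    [MorphismProperty.HasSmallObjectArgument.{v} I] {A : C} (h : IsSmallRelativeTo A (cell I)) :
    IsSmallRelativeTo A I.rlp.llp := by
  obtain ⟨κ, _, h⟩ := h
  refine ⟨κ, inferInstance, fun J _ _ _ _ _ F _ hF => ?_⟩
  have hF' (j : J) : I.rlp.llp (F.map (homOfLE (Order.le_succ j))) := by
    -- The choice below runs over all `j`; at a maximal one the step is an isomorphism, on which
    -- nothing is assumed.
    by_cases hj : IsMax j
    · have : IsIso (F.map (homOfLE (Order.le_succ j))) := by
        have : IsIso (homOfLE (Order.le_succ j)) :=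
          ⟨homOfLE (hj (Order.le_succ j)), rfl, rfl⟩
        infer_instance
      exact MorphismProperty.llp_of_isIso _ _
    · exact hF j hj
  choose Z i p hi hp using fun j => exists_cell_retract I _ (hF' j)
  -- `F` is a retract of the sequence with each `Z j` attached, whose steps are cobase changes of
  -- the cell complexes `hi j`.
  obtain ⟨r, hr⟩ := exists_retraction_attachSeq F p hp
  have := h J (attachSeq F i) fun j hj =>
    MorphismProperty.of_isPushout (isPushout_attachSeq_succ F i hj).flip (hi j)
  exact preservesColimit_of_retract (toAttachSeq F i) r hr _

/-- As `I` is small, one regular cardinal bounds all the individual ones, and its initial well-order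
is filtered enough for each of them. -/
theorem hasSmallObjectArgument_of_isSmallRelativeTo (I : MorphismProperty C)
    [MorphismProperty.IsSmall.{v} I]
    (h : ∀ {A B : C} (i : A ⟶ B), I i → IsSmallRelativeTo A (cell I)) :
    MorphismProperty.HasSmallObjectArgument.{v} I := by
  choose κ hκ h using fun i : I.toSet => h i.1.hom i.2
  obtain ⟨κ', hκ', hlt⟩ := HasCardinalLT.exists_regular_cardinal_forall.{v}
    fun i => (κ i).ord.ToType
  have : Fact κ'.IsRegular := ⟨hκ'⟩
  let : OrderBot κ'.ord.ToType :=
    have : Nonempty κ'.ord.ToType :=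
      Ordinal.nonempty_toType_iff.2 (Cardinal.ord_eq_zero.not.2 hκ'.ne_zero)
    WellFoundedLT.toOrderBot _
  refine ⟨κ', inferInstance, inferInstance, { preservesColimit := fun {A B X Y} i hi f hf => ?_ }⟩
  have hle : κ ⟨Arrow.mk i, hi⟩ ≤ κ' := by
    have := (hasCardinalLT_iff_cardinal_mk_lt _ _).1 (hlt ⟨Arrow.mk i, hi⟩)
    rw [Cardinal.mk_toType, Cardinal.card_ord] at this
    exact this.le
  have := hκ ⟨Arrow.mk i, hi⟩
  have : IsCardinalFiltered κ'.ord.ToType (κ ⟨Arrow.mk i, hi⟩) := .of_le _ hle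
  refine h ⟨Arrow.mk i, hi⟩ κ'.ord.ToType hf.F fun j hj => le_cell I _ ?_
  have := (hf.attachCells j hj).pushouts_coproducts
  rwa [MorphismProperty.ofHoms_homFamily] at this

end

section

variable {C : Type u} [Category.{v} C] {D : Type w} [Category.{v} D]

/-- `Hom(L A, -)` is `Hom(A, R -)`, and `R` preserves both the colimit of the sequence and its
continuity, since the colimits concerned are filtered. -/
theorem isSmallRelativeTo_leftAdjoint {L : C ⥤ D} {R : D ⥤ C} (adj : L ⊣ R)
    [PreservesFilteredColimitsOfSize.{v, v} R] {W : MorphismProperty D}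
    {W' : MorphismProperty C} (hW : ∀ {Y Z : D} (f : Y ⟶ Z), W f → W' (R.map f)) {A : C}
    (h : IsSmallRelativeTo A W') : IsSmallRelativeTo (L.obj A) W := by
  obtain ⟨κ, _, h⟩ := h
  refine ⟨κ, inferInstance, fun J _ _ _ _ _ F _ hF => ?_⟩
  have : PreservesWellOrderContinuousOfShape J R :=
    { preservesColimitsOfShape := fun j hj => by
        have : Nonempty (Set.Iio j) := by
          obtain ⟨i, hi⟩ := not_isMin_iff.1 hj.1
          exact ⟨⟨i, hi⟩⟩
        exact PreservesFilteredColimitsOfSize.preserves_filtered_colimits _ }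
  have : PreservesColimitsOfShape J R :=
    PreservesFilteredColimitsOfSize.preserves_filtered_colimits _
  have := h J (F ⋙ R) fun j hj => hW _ (hF j hj)
  have e : R ⋙ coyoneda.obj (op A) ≅ coyoneda.obj (op (L.obj A)) :=
    NatIso.ofComponents (fun Y => (adj.homEquiv A Y).symm.toIso) (fun f => by
      ext g
      exact adj.homEquiv_naturality_right_symm g f)
  have : PreservesColimit F (R ⋙ coyoneda.obj (op A)) := inferInstance
  exact preservesColimit_of_natIso F e

end

section

variable {M : Type u} [Category.{v} M] [MonoidalCategory M] [SymmetricCategory M]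
  [MonoidalClosed M] [HasColimitsOfSize.{v, v} M] {X : Type v}

instance : PreservesFilteredColimitsOfSize.{v, v} (forgetLax M X) where
  preserves_filtered_colimits J _ _ :=
    have : IsSifted J := IsFiltered.isSifted
    inferInstance

instance {A B : X} (t : Chain X A B) :
    PreservesFilteredColimitsOfSize.{v, v} (forgetLax M X ⋙ kEvAt t) where
  preserves_filtered_colimits J _ _ :=
    have : IsSifted J := IsFiltered.isSifted
    inferInstanceAs (PreservesColimitsOfShape J (evAt (M := M) t))

end

end

/-! ### The projective model structure -/

section

attribute [-instance] CategoryTheory.catToReflQuiver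

section

open MorphismProperty

/-- A pair of classes generated by two classes of morphisms which permit the small object argument
gives a model structure. -/
theorem exists_modelCategory {C : Type u} [Category.{v} C] [HasFiniteLimits C]
    [HasFiniteColimits C] (W Fib I J : MorphismProperty C)
    [HasSmallObjectArgument.{w} I] [HasSmallObjectArgument.{w} J]
    [W.HasTwoOutOfThreeProperty] (hI : I.rlp = Fib ⊓ W) (hJ : J.rlp = Fib)
    (hJW : J.rlp.llp ≤ W) :
    ∃ _ : ModelCategory C, weakEquivalences C = W ∧ fibrations C = Fib ∧
      cofibrations C = (trivialFibrations C).llp := by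
  let : CategoryWithFibrations C := ⟨Fib⟩
  let : CategoryWithCofibrations C := ⟨I.rlp.llp⟩
  let : CategoryWithWeakEquivalences C := ⟨W⟩
  have : (weakEquivalences C).HasTwoOutOfThreeProperty :=
    inferInstanceAs W.HasTwoOutOfThreeProperty
  have hfib : fibrations C = J.rlp := hJ.symm
  have htriv : trivialFibrations C = I.rlp := hI.symm
  have hcof : cofibrations C = I.rlp.llp := rfl
  have hJI : J.rlp.llp ≤ I.rlp.llp := antitone_llp (by
    rw [hI, hJ]
    exact inf_le_left)
  have htcof : trivialCofibrations C = J.rlp.llp := by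
    -- For the nontrivial inclusion, factor a trivial cofibration; its second factor is a trivial
    -- fibration by two-out-of-three, so the map is a retract of its first factor.
    refine le_antisymm ?_ fun _ _ f hf => ⟨hJI _ hf, hJW _ hf⟩
    rintro A B f ⟨hf, hf'⟩
    let h := factorizationData J.rlp.llp J.rlp f
    have hp : I.rlp h.p := by
      rw [hI]
      refine ⟨hJ ▸ h.hp, W.of_precomp h.i h.p (hJW _ h.hi) ?_⟩
      rw [h.fac]
      exact hf'
    have := hf h.p hp
    exact of_retract (RetractArrow.ofLeftLiftingProperty h.fac) h.hi
  have : IsWeakFactorizationSystem (cofibrations C) (trivialFibrations C) := by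
    rw [htriv]
    exact ⟨rlp_llp_rlp I, rfl, inferInstanceAs (HasFactorization I.rlp.llp I.rlp)⟩
  have : IsWeakFactorizationSystem (trivialCofibrations C) (fibrations C) := by
    rw [hfib, htcof]
    exact ⟨rlp_llp_rlp J, rfl, inferInstance⟩
  exact ⟨ModelCategory.mk' C, rfl, rfl, (llp_eq_of_wfs _ (trivialFibrations C)).symm⟩

end

section

variable {M : Type u} [Category.{v} M] [MonoidalCategory M]

/-- Tensoring with the initial object gives initial objects, so the pushout product of `⊥ ⟶ K` with
`i` is just `K ◁ i`. -/
theorem isIso_inl_pushoutProduct_initial [HasPushouts M] [HasInitial M] (K : M) {A B : M}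
    (i : A ⟶ B) [(tensorRight A).IsLeftAdjoint] [(tensorRight B).IsLeftAdjoint] :
    IsIso (Functor.PushoutObjObj.ofHasPushout (curriedTensor M) (initial.to K) i).inl := by
  have (A : M) [(tensorRight A).IsLeftAdjoint] : IsInitial ((⊥_ M) ⊗ A) :=
    initialIsInitial.isInitialObj (tensorRight A)
  have : IsIso (((curriedTensor M).obj (⊥_ M)).map i) :=
    ⟨(this B).to _, (this A).hom_ext _ _, (this B).hom_ext _ _⟩
  exact (Functor.PushoutObjObj.ofHasPushout (curriedTensor M) (initial.to K)
    i).isPushout.isIso_inl_of_isIso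

variable [SymmetricCategory M] [MonoidalClosed M] [ModelCategory M] [HasPushouts M]

noncomputable def arrowIsoPushoutProductInitial (K : M) {A B : M} (i : A ⟶ B) :
    Arrow.mk (K ◁ i) ≅
      (Arrow.pushoutProduct.obj (Arrow.mk (initial.to K))).obj (Arrow.mk i) :=
  Arrow.isoMk (@asIso _ _ _ _ _ (isIso_inl_pushoutProduct_initial K i))
    (Iso.refl _) (((Functor.PushoutObjObj.ofHasPushout (curriedTensor M)
      (initial.to K) i).inl_ι).trans (Category.comp_id _).symm)

variable [IsMonoidalModelCategory M]

theorem cofibration_whiskerLeft (K : M) [IsCofibrant K] {A B : M} (i : A ⟶ B) [Cofibration i] :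
    Cofibration (K ◁ i) := by
  have := IsMonoidalModelCategory.cofibration_pushoutProduct (initial.to K) i
  rw [cofibration_iff] at this ⊢
  exact (MorphismProperty.arrow_mk_iso_iff _ (arrowIsoPushoutProductInitial K i)).2 this

theorem weakEquivalence_whiskerLeft (K : M) [IsCofibrant K] {A B : M} (i : A ⟶ B) [Cofibration i]
    [WeakEquivalence i] : WeakEquivalence (K ◁ i) := by
  have := IsMonoidalModelCategory.weakEquivalence_pushoutProduct (initial.to K) i
    (Or.inr inferInstance)
  rw [weakEquivalence_iff] at this ⊢
  exact (MorphismProperty.arrow_mk_iso_iff _ (arrowIsoPushoutProductInitial K i)).2 this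

/-- By adjunction this is the dual of the fact that tensoring with a cofibrant `K` preserves trivial
cofibrations. Here the cofibrancy of all objects enters the proof. -/
theorem fibrations_ihom_map (K : M) [IsCofibrant K] {Y Z : M} (g : Y ⟶ Z)
    (hg : fibrations M g) : fibrations M ((ihom K).map g) := by
  have h := MorphismProperty.rlp_eq_of_wfs (trivialCofibrations M) (fibrations M)
  refine h.le _ fun A B i hi => ?_
  rw [mem_trivialCofibrations_iff] at hi
  obtain ⟨_, _⟩ := hi
  rw [← (ihom.adjunction K).hasLiftingProperty_iff]
  have h₁ := cofibration_whiskerLeft K i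
  have h₂ := weakEquivalence_whiskerLeft K i
  exact h.ge _ hg _ ((mem_trivialCofibrations_iff _).2 ⟨h₁, h₂⟩)

theorem trivialFibrations_ihom_map (K : M) [IsCofibrant K] {Y Z : M} (g : Y ⟶ Z)
    (hg : trivialFibrations M g) : trivialFibrations M ((ihom K).map g) := by
  have h := MorphismProperty.rlp_eq_of_wfs (cofibrations M) (trivialFibrations M)
  refine h.le _ fun A B i hi => ?_
  rw [← cofibration_iff] at hi
  rw [← (ihom.adjunction K).hasLiftingProperty_iff]
  exact h.ge _ hg _ ((cofibration_iff _).1 (cofibration_whiskerLeft K i))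

end

section

variable {M : Type u} [Category.{v} M] [HasColimitsOfSize.{v, v} M] {X : Type v}

instance isSmall_projGenerators (I : MorphismProperty M) [MorphismProperty.IsSmall.{v} I] :
    MorphismProperty.IsSmall.{v} (projGenerators X I) := by
  obtain ⟨ι, A, B, f, rfl⟩ := (MorphismProperty.isSmall_iff_eq_ofHoms.{v} I).1 inferInstance
  rw [MorphismProperty.isSmall_iff_eq_ofHoms]
  let c {A B : X} (t : Chain X A B) : Σ p : X × X, Chain X p.1 p.2 := ⟨(A, B), t⟩
  refine ⟨(Σ p : X × X, Chain X p.1 p.2) × ι, _, _,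
    fun i => (freeAt.{v, u} i.1.2).map (f i.2), ?_⟩
  ext G H g
  constructor
  · rintro ⟨t, _, ⟨i⟩⟩
    exact MorphismProperty.ofHoms.mk (c t, i)
  · rintro ⟨i⟩
    exact ⟨i.1.2, _, ⟨i.2⟩⟩

theorem isSmall_strictMap {C : Type*} [Category* C] {D : Type*} [Category* D]
    (I : MorphismProperty C) [MorphismProperty.IsSmall.{v} I] (F : C ⥤ D) :
    MorphismProperty.IsSmall.{v} (I.strictMap F) := by
  obtain ⟨ι, A, B, f, rfl⟩ := (MorphismProperty.isSmall_iff_eq_ofHoms.{v} I).1 inferInstance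
  rw [MorphismProperty.isSmall_iff_eq_ofHoms]
  refine ⟨ι, _, _, fun i => F.map (f i), ?_⟩
  ext G H g
  constructor
  · rintro ⟨⟨i⟩⟩
    exact ⟨i⟩
  · rintro ⟨i⟩
    exact ⟨⟨i⟩⟩

end

section

variable {M : Type u} [Category.{v} M] [MonoidalCategory M] [HasColimitsOfSize.{v, v} M]
  {X : Type v} {Γ : KX M X ⥤ PreCoSegal M X} (adj : Γ ⊣ forgetLax M X)

-- `freeAt t` followed by `Γ` is left adjoint to evaluation at `t`, so lifting problems transpose to
-- `M`.
include adj in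
theorem rlp_strictMap_projGenerators (I : MorphismProperty M) {G H : PreCoSegal M X}
    (g : G ⟶ H) : ((projGenerators X I).strictMap Γ).rlp g ↔
      ∀ (A B : X) (t : Chain X A B), I.rlp ((PreCoSegal.Hom.app g A B).app (op t)) := by
  have key {A B : X} (t : Chain X A B) {m m' : M} (α : m ⟶ m') :
      HasLiftingProperty (Γ.map ((freeAt t).map α)) g ↔
        HasLiftingProperty α ((PreCoSegal.Hom.app g A B).app (op t)) :=
    ((freeAtAdj t).comp adj).hasLiftingProperty_iff α g
  constructor
  · intro h A B t m m' α hα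
    exact (key t α).1 (h _ ⟨⟨t, α, hα⟩⟩)
  · rintro h _ _ _ ⟨⟨t, α, hα⟩⟩
    exact (key t α).2 (h _ _ t α hα)

variable [SymmetricCategory M] [MonoidalClosed M] [HasLimitsOfSize.{v, v} M]

include adj in
theorem app_mem_rlp_llp (I : MorphismProperty M)
    (hI : ∀ (K : M) {Y Z : M} (g : Y ⟶ Z), I.rlp g → I.rlp ((ihom K).map g))
    {G H : PreCoSegal M X} (f : G ⟶ H) (hf : ((projGenerators X I).strictMap Γ).rlp.llp f)
    (A B : X) (t : Chain X A B) : I.rlp.llp ((PreCoSegal.Hom.app f A B).app (op t)) :=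
  app_mem_llp f I.rlp hI
    (fun g hg => hf g ((rlp_strictMap_projGenerators adj I g).2 hg)) A B t

-- Evaluation at `t` is only known to send cell complexes into `I.rlp.llp`, hence the passage
-- through `IsSmallRelativeTo.llp_rlp` before transporting smallness along the adjunction.
include adj in
theorem isSmallRelativeTo_strictMap_projGenerators (I : MorphismProperty M)
    [MorphismProperty.HasSmallObjectArgument.{v} I]
    (hI : ∀ (K : M) {Y Z : M} (g : Y ⟶ Z), I.rlp g → I.rlp ((ihom K).map g))
    (h : ∀ {A B : M} (i : A ⟶ B), I i → IsSmallRelativeTo A (cell I))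
    {G H : PreCoSegal M X} (f : G ⟶ H) (hf : ((projGenerators X I).strictMap Γ) f) :
    IsSmallRelativeTo G (cell ((projGenerators X I).strictMap Γ)) := by
  obtain ⟨⟨t, α, hα⟩⟩ := hf
  exact isSmallRelativeTo_leftAdjoint ((freeAtAdj t).comp adj)
    (fun f hf => app_mem_rlp_llp adj I hI f (cell_le_llp_rlp _ _ hf) _ _ t)
    ((h α hα).llp_rlp)

end

end

/-! ### Assembling the model structure and its generators -/

section

attribute [-instance] CategoryTheory.catToReflQuiver

section

variable {C : Type u} [Category.{v} C] [ModelCategory C] {I J : MorphismProperty C}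

theorem IsCofibrantlyGeneratedBy.hasSmallObjectArgument_left [HasColimitsOfSize.{v, v} C]
    (h : IsCofibrantlyGeneratedBy I J) : MorphismProperty.HasSmallObjectArgument.{v} I :=
  have := h.isSmall_left
  hasSmallObjectArgument_of_isSmallRelativeTo I h.small_left

theorem IsCofibrantlyGeneratedBy.hasSmallObjectArgument_right [HasColimitsOfSize.{v, v} C]
    (h : IsCofibrantlyGeneratedBy I J) : MorphismProperty.HasSmallObjectArgument.{v} J :=
  have := h.isSmall_right
  hasSmallObjectArgument_of_isSmallRelativeTo J h.small_right

end

section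

variable {M : Type u} [Category.{v} M] [MonoidalCategory M] [ModelCategory M] (X : Type v)

instance : ((projWeakEquivalences M X).inverseImage
    (forgetLax M X)).HasTwoOutOfThreeProperty where
  comp_mem _ _ hf hg p t :=
    (weakEquivalence_iff _).2 ((weakEquivalences M).comp_mem _ _
      ((weakEquivalence_iff _).1 (hf p t)) ((weakEquivalence_iff _).1 (hg p t)))
  of_precomp _ _ hf hfg p t :=
    (weakEquivalence_iff _).2 ((weakEquivalences M).of_precomp _ _
      ((weakEquivalence_iff _).1 (hf p t)) ((weakEquivalence_iff _).1 (hfg p t)))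
  of_postcomp _ _ hg hfg p t :=
    (weakEquivalence_iff _).2 ((weakEquivalences M).of_postcomp _ _
      ((weakEquivalence_iff _).1 (hg p t)) ((weakEquivalence_iff _).1 (hfg p t)))

variable [SymmetricCategory M] [MonoidalClosed M] [HasLimitsOfSize.{v, v} M]
  [HasColimitsOfSize.{v, v} M] {X} {Γ : KX M X ⥤ PreCoSegal M X} (adj : Γ ⊣ forgetLax M X)
  {I J : MorphismProperty M} (hIJ : IsCofibrantlyGeneratedBy I J)

include adj hIJ

omit [SymmetricCategory M] [MonoidalClosed M] [HasLimitsOfSize.{v, v} M] in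
theorem rlp_strictMap_projGenerators_left : ((projGenerators X I).strictMap Γ).rlp =
    (projFibrations M X).inverseImage (forgetLax M X) ⊓
      (projWeakEquivalences M X).inverseImage (forgetLax M X) := by
  ext G H g
  rw [rlp_strictMap_projGenerators adj]
  simp only [← hIJ.trivialFibrations_eq, mem_trivialFibrations_iff]
  exact ⟨fun h => ⟨fun p t => (h p.1 p.2 t.unop).1, fun p t => (h p.1 p.2 t.unop).2⟩,
    fun h A B t => ⟨h.1 (A, B) (op t), h.2 (A, B) (op t)⟩⟩

omit [SymmetricCategory M] [MonoidalClosed M] [HasLimitsOfSize.{v, v} M] in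
theorem rlp_strictMap_projGenerators_right : ((projGenerators X J).strictMap Γ).rlp =
    (projFibrations M X).inverseImage (forgetLax M X) := by
  ext G H g
  rw [rlp_strictMap_projGenerators adj]
  simp only [← hIJ.fibrations_eq, ← fibration_iff]
  exact ⟨fun h p t => h p.1 p.2 t.unop, fun h A B t => h (A, B) (op t)⟩

variable [IsMonoidalModelCategory M] (hcof : ∀ A : M, IsCofibrant A)

include hcof

omit [HasLimitsOfSize.{v, v} M] adj in
theorem IsCofibrantlyGeneratedBy.rlp_left_ihom_map (K : M) {Y Z : M} (g : Y ⟶ Z)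
    (hg : I.rlp g) : I.rlp ((ihom K).map g) := by
  have := hcof K
  rw [← hIJ.trivialFibrations_eq] at hg ⊢
  exact trivialFibrations_ihom_map K g hg

omit [HasLimitsOfSize.{v, v} M] adj in
theorem IsCofibrantlyGeneratedBy.rlp_right_ihom_map (K : M) {Y Z : M} (g : Y ⟶ Z)
    (hg : J.rlp g) : J.rlp ((ihom K).map g) := by
  have := hcof K
  rw [← hIJ.fibrations_eq] at hg ⊢
  exact fibrations_ihom_map K g hg

/-- The acyclicity condition: `app_mem_rlp_llp` places every value in `J.rlp.llp`, the trivial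
cofibrations of `M`. -/
theorem rlp_llp_strictMap_projGenerators_le : ((projGenerators X J).strictMap Γ).rlp.llp ≤
    (projWeakEquivalences M X).inverseImage (forgetLax M X) := by
  intro G H f hf p t
  have := app_mem_rlp_llp adj J (hIJ.rlp_right_ihom_map hcof) f hf p.1 p.2 t.unop
  rw [← hIJ.fibrations_eq,
    MorphismProperty.llp_eq_of_wfs (trivialCofibrations M) (fibrations M)] at this
  exact (weakEquivalence_iff _).2 this.2

theorem isSmallRelativeTo_strictMap_left {G H : PreCoSegal M X} (f : G ⟶ H)
    (hf : ((projGenerators X I).strictMap Γ) f) :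
    IsSmallRelativeTo G (cell ((projGenerators X I).strictMap Γ)) :=
  have := hIJ.hasSmallObjectArgument_left
  isSmallRelativeTo_strictMap_projGenerators adj I (hIJ.rlp_left_ihom_map hcof)
    hIJ.small_left f hf

theorem isSmallRelativeTo_strictMap_right {G H : PreCoSegal M X} (f : G ⟶ H)
    (hf : ((projGenerators X J).strictMap Γ) f) :
    IsSmallRelativeTo G (cell ((projGenerators X J).strictMap Γ)) :=
  have := hIJ.hasSmallObjectArgument_right
  isSmallRelativeTo_strictMap_projGenerators adj J (hIJ.rlp_right_ihom_map hcof)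
    hIJ.small_right f hf

/-- The projective model structure on pre-Co-Segal categories. -/
theorem exists_modelCategory_preCoSegal : ∃ _ : ModelCategory (PreCoSegal M X),
    weakEquivalences (PreCoSegal M X) =
        (projWeakEquivalences M X).inverseImage (forgetLax M X) ∧
      fibrations (PreCoSegal M X) = (projFibrations M X).inverseImage (forgetLax M X) ∧
      cofibrations (PreCoSegal M X) = (trivialFibrations (PreCoSegal M X)).llp := by
  have := hIJ.isSmall_left
  have := hIJ.isSmall_right
  have := isSmall_strictMap (projGenerators X I) Γ
  have := isSmall_strictMap (projGenerators X J) Γ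
  have := hasSmallObjectArgument_of_isSmallRelativeTo _
    (isSmallRelativeTo_strictMap_left adj hIJ hcof)
  have := hasSmallObjectArgument_of_isSmallRelativeTo _
    (isSmallRelativeTo_strictMap_right adj hIJ hcof)
  have : HasFiniteLimits (PreCoSegal M X) :=
    hasFiniteLimits_of_hasLimitsOfSize.{v, v} _
  have : HasFiniteColimits (PreCoSegal M X) :=
    hasFiniteColimits_of_hasColimitsOfSize.{v, v} _
  exact exists_modelCategory.{v} _ _ _ _ (rlp_strictMap_projGenerators_left adj hIJ)
    (rlp_strictMap_projGenerators_right adj hIJ)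
    (rlp_llp_strictMap_projGenerators_le adj hIJ hcof)

theorem isCofibrantlyGeneratedBy_strictMap [ModelCategory (PreCoSegal M X)]
    (hW : weakEquivalences (PreCoSegal M X) =
      (projWeakEquivalences M X).inverseImage (forgetLax M X))
    (hF : fibrations (PreCoSegal M X) =
      (projFibrations M X).inverseImage (forgetLax M X)) :
    IsCofibrantlyGeneratedBy ((projGenerators X I).strictMap Γ)
      ((projGenerators X J).strictMap Γ) where
  isSmall_left :=
    have := hIJ.isSmall_left
    isSmall_strictMap _ Γ
  isSmall_right :=
    have := hIJ.isSmall_right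
    isSmall_strictMap _ Γ
  small_left := isSmallRelativeTo_strictMap_left adj hIJ hcof
  small_right := isSmallRelativeTo_strictMap_right adj hIJ hcof
  fibrations_eq := hF.trans (rlp_strictMap_projGenerators_right adj hIJ).symm
  trivialFibrations_eq := by
    rw [rlp_strictMap_projGenerators_left adj hIJ, ← hW, ← hF]
    rfl

end

end

/-! ### Local presentability -/

section

attribute [-instance] CategoryTheory.catToReflQuiver

section

/-- The images under left adjoints of a strong generator form a strong generator if the right
adjoints are jointly faithful and jointly reflect isomorphisms. -/
theorem isStrongGenerator_ofObj_leftAdjoint {C : Type*} [Category* C] {D : Type*} [Category* D]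
    {ι : Type*} {L : ι → C ⥤ D} {R : ι → D ⥤ C} (adj : ∀ i, L i ⊣ R i)
    (faithful : ∀ {G H : D} (f g : G ⟶ H), (∀ i, (R i).map f = (R i).map g) → f = g)
    (reflects : ∀ {G H : D} (f : G ⟶ H), (∀ i, IsIso ((R i).map f)) → IsIso f)
    {P : ObjectProperty C} (hP : P.IsStrongGenerator) :
    (ObjectProperty.ofObj fun k : ι × Subtype P => (L k.1).obj k.2.1).IsStrongGenerator := by
  rw [ObjectProperty.isStrongGenerator_iff] at hP ⊢
  obtain ⟨hP₁, hP₂⟩ := hP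
  refine ⟨fun G H f g hfg => faithful f g fun i => hP₁ _ _ fun K hK y => ?_,
    fun G H f _ hf => reflects f fun i => ?_⟩
  · have := hfg _ (ObjectProperty.ofObj_apply (fun k : ι × Subtype P => (L k.1).obj k.2.1)
      (i, ⟨K, hK⟩)) (((adj i).homEquiv K G).symm y)
    simpa [Adjunction.homEquiv_naturality_right] using congrArg ((adj i).homEquiv K H) this
  · have := (adj i).isRightAdjoint
    refine hP₂ _ fun K hK y => ?_
    obtain ⟨x, hx⟩ := hf _ (ObjectProperty.ofObj_apply
      (fun k : ι × Subtype P => (L k.1).obj k.2.1) (i, ⟨K, hK⟩)) (((adj i).homEquiv K H).symm y)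
    refine ⟨(adj i).homEquiv K G x, ?_⟩
    have := congrArg ((adj i).homEquiv K H) hx
    simpa [Adjunction.homEquiv_naturality_right] using this

end

section

variable {M : Type u} [Category.{v} M] [MonoidalCategory M] [SymmetricCategory M]
  [MonoidalClosed M] {X : Type v}

instance [HasColimitsOfSize.{v, v} M] {A B : X} (t : Chain X A B) (κ : Cardinal.{v})
    [Fact κ.IsRegular] :
    (forgetLax M X ⋙ kEvAt t).IsCardinalAccessible κ where
  preservesColimitOfShape J _ _ :=
    have := isFiltered_of_isCardinalFiltered J κ
    inferInstance

-- The left adjoints of the evaluations carry a strong generator of `M` to one of `PreCoSegal M X`,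
-- evaluations being jointly faithful and conservative; they preserve `κ`-presentability because
-- evaluations preserve filtered colimits.
variable (X) in
theorem isCardinalLocallyPresentable_preCoSegal (κ : Cardinal.{v}) [Fact κ.IsRegular]
    [IsCardinalLocallyPresentable M κ] : IsCardinalLocallyPresentable (PreCoSegal M X) κ := by
  obtain ⟨P, _, hP₁, hP₂⟩ :=
    (IsCardinalLocallyPresentable.iff_exists_isStrongGenerator M κ).1 inferInstance
  let adj (c : Σ p : X × X, Chain X p.1 p.2) :=
    (freeAtAdj.{v, u} (M := M) c.2).comp (Adjunction.ofIsRightAdjoint (forgetLax M X))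
  rw [IsCardinalLocallyPresentable.iff_exists_isStrongGenerator]
  refine ⟨_, inferInstance, isStrongGenerator_ofObj_leftAdjoint adj ?_ ?_ hP₁, ?_⟩
  · intro G H f g h
    refine PreCoSegal.Hom.ext ?_
    funext A B
    ext t
    exact h ⟨(A, B), t.unop⟩
  · intro G H f h
    exact isIso_of_isIso_app _ _ f fun A B =>
      have : ∀ t, IsIso ((PreCoSegal.Hom.app f A B).app t) := fun t => h ⟨(A, B), t.unop⟩
      NatIso.isIso_of_isIso_app _
  · rintro _ ⟨c, G, hG⟩
    have := hP₂ _ hG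
    rw [isCardinalPresentable_iff] at this ⊢
    exact (adj c).isCardinalPresentable_leftAdjoint_obj κ G

variable (M X) in
theorem isLocallyPresentable_preCoSegal [IsLocallyPresentable.{v} M] :
    IsLocallyPresentable.{v} (PreCoSegal M X) where
  exists_cardinal := by
    obtain ⟨κ, _, _⟩ := IsLocallyPresentable.exists_cardinal.{v} M
    exact ⟨κ, inferInstance, isCardinalLocallyPresentable_preCoSegal X κ⟩

end

end

end CoSegal

theorem mainTheorem4 {M : Type u} [Category.{v} M] [MonoidalCategory M] [SymmetricCategory M]
    [MonoidalClosed M] [HasLimitsOfSize.{v, v} M] [HasColimitsOfSize.{v, v} M]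
    [ModelCategory M] [CoSegal.IsMonoidalModelCategory M]
    (hcof : ∀ A : M, IsCofibrant A)
    (I J : MorphismProperty M) (hIJ : CoSegal.IsCofibrantlyGeneratedBy I J)
    (X : Type v) :
    HasLimitsOfSize.{v, v} (CoSegal.PreCoSegal M X) ∧
    HasColimitsOfSize.{v, v} (CoSegal.PreCoSegal M X) ∧
    (CoSegal.forgetLax M X).IsRightAdjoint ∧
    (∀ (Γ : CoSegal.KX M X ⥤ CoSegal.PreCoSegal M X) (adj : Γ ⊣ CoSegal.forgetLax M X),
      (Monad.comparison adj).IsEquivalence) ∧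
    (∃ _ : ModelCategory (CoSegal.PreCoSegal M X),
      weakEquivalences (CoSegal.PreCoSegal M X) =
        (CoSegal.projWeakEquivalences M X).inverseImage (CoSegal.forgetLax M X) ∧
      fibrations (CoSegal.PreCoSegal M X) =
        (CoSegal.projFibrations M X).inverseImage (CoSegal.forgetLax M X) ∧
      cofibrations (CoSegal.PreCoSegal M X) =
        (trivialFibrations (CoSegal.PreCoSegal M X)).llp ∧
      ∀ (Γ : CoSegal.KX M X ⥤ CoSegal.PreCoSegal M X), (Γ ⊣ CoSegal.forgetLax M X) →
        CoSegal.IsCofibrantlyGeneratedBy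
          ((CoSegal.projGenerators X I).strictMap Γ)
          ((CoSegal.projGenerators X J).strictMap Γ)) ∧
    (IsLocallyPresentable.{v} M → IsLocallyPresentable.{v} (CoSegal.PreCoSegal M X)) := by
  refine ⟨inferInstance, inferInstance, inferInstance,
    fun Γ adj => CoSegal.comparison_isEquivalence adj, ?_,
    fun _ => CoSegal.isLocallyPresentable_preCoSegal M X⟩
  -- One left adjoint suffices to build the structure, whose classes do not mention `Γ`; the
  -- generators are then checked for an arbitrary left adjoint.
  obtain ⟨h, hW, hF, hC⟩ := CoSegal.exists_modelCategory_preCoSegal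
    (Adjunction.ofIsRightAdjoint (CoSegal.forgetLax M X)) hIJ hcof
  exact ⟨h, hW, hF, hC, fun Γ adj =>
    CoSegal.isCofibrantlyGeneratedBy_strictMap adj hIJ hcof hW hF⟩
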